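/- Let $n\ge 1$, let $\mathcal U$ be an open neighborhood of the origin in $\mathbb C^{n+1}$ with coordinates $\mathbf z=(z_0,\dots,z_n)$, and let $f:(\mathcal U,\mathbf 0)\to(\mathbb C,0)$ be a complex analytic function such that its critical locus $\Sigma f$ satisfies $\dim_{\mathbf 0}\Sigma f=1$ and such that $\dim_{\mathbf 0}\Sigma(f_{|_{V(z_0)}})=0$. Let $\mathcal O$ be the ring of germs at $\mathbf 0$ of complex analytic functions on $\mathbb C^{n+1}$, and let $\Gamma^2_{f,\mathbf z}=\left[V\left(\frac{\partial f}{\partial z_2},\dots,\frac{\partial f}{\partial z_n}\right)\right]$ be the relative polar surface, as an analytic cycle at the origin: the sum of the irreducible components $V(\mathfrak p)$ at $\mathbf 0$ of the germ defined by the ideal $I=\left\langle\frac{\partial f}{\partial z_2},\dots,\frac{\partial f}{\partial z_n}\right\rangle\subseteq\mathcal O$, each with multiplicity the length of $(\mathcal O/I)_{\mathfrak p}$ (for $n=1$, $I=0$ and $\Gamma^2_{f,\mathbf z}=[\mathbb C^2]$). Then the following are equivalent: 1. $\dim_{\mathbf 0}\left(\Gamma^2_{f,\mathbf z}\cap V(f)\cap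 V(z_0)\right)=0$. 2. Every irreducible component $C$ at the origin of $\Gamma^2_{f,\mathbf z}\cap V(f)$ is $1$-dimensional and is properly intersected by $V(z_0)$ at the origin. 3. $\Gamma^2_{f,\mathbf z}$ is properly intersected by $V(z_0,z_1)$ at the origin, that is, $\dim_{\mathbf 0}(C\cap V(z_0,z_1))=\dim_{\mathbf 0} C-2$ for every component $C$ of $\Gamma^2_{f,\mathbf z}$. Furthermore, when these equivalent conditions hold, $$\left(\Gamma^2_{f,\mathbf z}\cdot V(f)\cdot V(z_0)\right)_{\mathbf 0}=\mu_{\mathbf 0}\left(f_{|_{V(z_0)}}\right)+\left(\Gamma^2_{f,\mathbf z}\cdot V(z_0,z_1)\right)_{\mathbf 0},$$ where $(\,\cdot\,)_{\mathbf 0}$ denotes the intersection number at $\mathbf 0$ of analytic cycles and $\mu_{\mathbf 0}$ denotes the Milnor number at $\mathbf 0$. -/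

import Mathlib

open Filter Topology

noncomputable section

/-- `𝒪_{ℂ^m,0}`: the ring of germs at the origin of complex analytic functions on `ℂ^m`. -/
def analyticGerms (m : ℕ) : Subring (Germ (𝓝 (0 : Fin m → ℂ)) ℂ) where
  carrier := {φ | ∃ g : (Fin m → ℂ) → ℂ, AnalyticAt ℂ g 0 ∧ (g : Germ (𝓝 (0 : Fin m → ℂ)) ℂ) = φ}
  mul_mem' := by
    rintro _ _ ⟨g, hg, rfl⟩ ⟨h, hh, rfl⟩
    exact ⟨g * h, hg.mul hh, rfl⟩
  one_mem' := ⟨fun _ => 1, analyticAt_const, rfl⟩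
  add_mem' := by
    rintro _ _ ⟨g, hg, rfl⟩ ⟨h, hh, rfl⟩
    exact ⟨g + h, hg.add hh, rfl⟩
  zero_mem' := ⟨fun _ => 0, analyticAt_const, rfl⟩
  neg_mem' := by
    rintro _ ⟨g, hg, rfl⟩
    exact ⟨-g, hg.neg, rfl⟩

/-- The local ring `𝒪_{ℂ^m,0}`. -/
abbrev LocalAnalyticRing (m : ℕ) : Type := ↥(analyticGerms m)

/-- The germ at the origin of a function that is analytic there. -/
def germAtZero {m : ℕ} (g : (Fin m → ℂ) → ℂ) (hg : AnalyticAt ℂ g 0) : LocalAnalyticRing m :=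
  ⟨(g : Germ (𝓝 (0 : Fin m → ℂ)) ℂ), g, hg, rfl⟩

/-- `𝒪_{ℂ^m,0}` is a `ℂ`-algebra through the constant functions. -/
instance LocalAnalyticRing.instAlgebra (m : ℕ) : Algebra ℂ (LocalAnalyticRing m) :=
  RingHom.toAlgebra
    { toFun := fun c => germAtZero (fun _ => c) analyticAt_const
      map_one' := rfl
      map_mul' := fun _ _ => rfl
      map_zero' := rfl
      map_add' := fun _ _ => rfl }

/-- The germ of the coordinate function `z_i`. -/
def coordGerm {m : ℕ} (i : Fin m) : LocalAnalyticRing m :=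
  germAtZero (fun z => z i) ((ContinuousLinearMap.proj (R := ℂ) (φ := fun _ : Fin m => ℂ) i).analyticAt 0)

/-- The partial derivative `∂f/∂z_i`. -/
def partialDeriv {m : ℕ} (f : (Fin m → ℂ) → ℂ) (i : Fin m) : (Fin m → ℂ) → ℂ :=
  fun z => fderiv ℂ f z (Pi.single i 1)

theorem analyticAt_partialDeriv {m : ℕ} {f : (Fin m → ℂ) → ℂ} (hf : AnalyticAt ℂ f 0)
    (i : Fin m) : AnalyticAt ℂ (partialDeriv f i) 0 :=
  ((ContinuousLinearMap.apply ℂ ℂ (Pi.single i 1 : Fin m → ℂ)).analyticAt _).comp hf.fderiv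

/-- The ideal `⟨∂f/∂z_i : i⟩` of `𝒪_{ℂ^m,0}`; it defines the germ at `0` of the critical locus
`Σf`. -/
def jacobianIdeal {m : ℕ} (f : (Fin m → ℂ) → ℂ) (hf : AnalyticAt ℂ f 0) :
    Ideal (LocalAnalyticRing m) :=
  Ideal.span (Set.range fun i : Fin m =>
    germAtZero (partialDeriv f i) (analyticAt_partialDeriv hf i))

/-- `dim_0 V(J)`: the dimension of the complex analytic germ `V(J)` at the origin is the Krull
dimension of its local ring `𝒪/J`. It is `⊥` exactly when `J` is the unit ideal, that is, when the
germ is empty. -/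
def germDim {m : ℕ} (J : Ideal (LocalAnalyticRing m)) : WithBot ℕ∞ :=
  ringKrullDim (LocalAnalyticRing m ⧸ J)

/-- The Milnor number `μ_0(g) = dim_ℂ 𝒪/⟨∂g/∂w_1, …, ∂g/∂w_m⟩`. -/
def milnorNumber {m : ℕ} (g : (Fin m → ℂ) → ℂ) (hg : AnalyticAt ℂ g 0) : ℕ :=
  Module.finrank ℂ (LocalAnalyticRing m ⧸ jacobianIdeal g hg)

/-- The restriction of `f` to the hyperplane `V(z_0)`, in the coordinates `z_1, …, z_n`. -/
def restrictHyperplane {n : ℕ} (f : (Fin (n + 1) → ℂ) → ℂ) : (Fin n → ℂ) → ℂ :=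
  fun w => f (Fin.cons 0 w)

theorem analyticAt_restrictHyperplane {n : ℕ} {f : (Fin (n + 1) → ℂ) → ℂ}
    (hf : AnalyticAt ℂ f 0) : AnalyticAt ℂ (restrictHyperplane f) 0 := by
  have hc : AnalyticAt ℂ (fun w : Fin n → ℂ => (Fin.cons 0 w : Fin (n + 1) → ℂ)) 0 := by
    rw [analyticAt_pi_iff]
    intro i
    refine Fin.cases ?_ (fun j => ?_) i
    · simp only [Fin.cons_zero]
      exact analyticAt_const
    · simp only [Fin.cons_succ]
      exact (ContinuousLinearMap.proj (R := ℂ) (φ := fun _ : Fin n => ℂ) j).analyticAt 0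
  have h0 : (Fin.cons 0 (0 : Fin n → ℂ) : Fin (n + 1) → ℂ) = 0 := by
    funext i
    refine Fin.cases ?_ (fun j => ?_) i <;> simp
  have hf' : AnalyticAt ℂ f ((fun w : Fin n → ℂ => (Fin.cons 0 w : Fin (n + 1) → ℂ)) 0) := by
    show AnalyticAt ℂ f (Fin.cons 0 0)
    rw [h0]
    exact hf
  exact AnalyticAt.comp (g := f)
    (f := fun w : Fin n → ℂ => (Fin.cons 0 w : Fin (n + 1) → ℂ)) hf' hc

/-! ### Analytic cycles at the origin -/

/-- Analytic cycles at the origin of `ℂ^m`: finite formal integer combinations of irreducible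
analytic germs `V(𝔭)`, with `𝔭` a prime ideal of `𝒪_{ℂ^m,0}`. -/
abbrev AnalyticCycle (m : ℕ) : Type := PrimeSpectrum (LocalAnalyticRing m) →₀ ℤ

/-- The multiplicity in `[V(J)]` of the irreducible component `V(𝔭)`: the length of the local ring
`(𝒪/J)_𝔭` (which is finite for `𝔭` minimal over `J`, as `𝒪` is Noetherian). -/
def componentMult {m : ℕ} (J : Ideal (LocalAnalyticRing m))
    (p : PrimeSpectrum (LocalAnalyticRing m)) : ℕ :=
  (Module.length (Localization.AtPrime p.asIdeal)
    (LocalizedModule p.asIdeal.primeCompl (LocalAnalyticRing m ⧸ J))).toNat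

/-- The cycle `[V(J)]`: the sum of the irreducible components of `V(J)` at the origin (the minimal
primes over `J`, finite in number), with their multiplicities. -/
def cycleOf {m : ℕ} (J : Ideal (LocalAnalyticRing m)) : AnalyticCycle m :=
  ∑ᶠ (p : PrimeSpectrum (LocalAnalyticRing m)) (_ : p.asIdeal ∈ J.minimalPrimes),
    Finsupp.single p (componentMult J p : ℤ)

open Classical in
/-- The intersection product `Z · V(g)` of a cycle with a hypersurface. It is linear in `Z`, and
`[V(𝔭)] · V(g) = [V(𝔭 + ⟨g⟩)]` when `V(g)` meets `V(𝔭)` properly, that is, when `g ∉ 𝔭` (the value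
`0` for `g ∈ 𝔭` is a convention for an undefined product). -/
def AnalyticCycle.inter {m : ℕ} (Z : AnalyticCycle m) (g : LocalAnalyticRing m) :
    AnalyticCycle m :=
  Z.sum fun p k => if g ∈ p.asIdeal then 0 else k • cycleOf (p.asIdeal ⊔ Ideal.span {g})

/-- The intersection product `Z · V(g_1, …, g_k)` of a cycle with the complete intersection
`V(g_1, …, g_k) = V(g_1) · … · V(g_k)`, namely `(…(Z · V(g_1)) · …) · V(g_k)`. -/
def AnalyticCycle.interCI {m : ℕ} (Z : AnalyticCycle m) (g : List (LocalAnalyticRing m)) :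
    AnalyticCycle m :=
  g.foldl AnalyticCycle.inter Z

/-- The value of an analytic germ at the origin. -/
def evalAtZero (m : ℕ) : LocalAnalyticRing m →+* ℂ :=
  (Germ.valueRingHom (X := Fin m → ℂ) (E := ℂ) (x := 0)).comp (analyticGerms m).subtype

/-- The origin as an irreducible germ: the maximal ideal of germs that vanish at the origin. -/
def originPrime (m : ℕ) : PrimeSpectrum (LocalAnalyticRing m) :=
  ⟨RingHom.ker (evalAtZero m), RingHom.ker_isPrime _⟩

/-- `(Z)_0`: the coefficient of the origin in a cycle; for the 0-dimensional cycle of a proper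
intersection this is the intersection number at the origin. -/
def AnalyticCycle.numberAtZero {m : ℕ} (Z : AnalyticCycle m) : ℤ :=
  Z (originPrime m)

/-- The irreducible germ `V(𝔭)` and the complete intersection germ `V(J)` in `ℂ^m` meet properly at
the origin: `dim_0 (V(𝔭) ∩ V(J)) = dim_0 V(𝔭) + dim_0 V(J) - m`. -/
def MeetsProperly {m : ℕ} (p : PrimeSpectrum (LocalAnalyticRing m))
    (J : Ideal (LocalAnalyticRing m)) : Prop :=
  germDim (p.asIdeal ⊔ J) + (m : WithBot ℕ∞) = germDim p.asIdeal + germDim J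

/-! ### The relative polar surface -/

/-- The ideal `⟨∂f/∂z_2, …, ∂f/∂z_n⟩` of `𝒪_{ℂ^{n+1},0}` (the zero ideal when `n = 1`). -/
def polarIdeal {n : ℕ} (f : (Fin (n + 1) → ℂ) → ℂ) (hf : AnalyticAt ℂ f 0) :
    Ideal (LocalAnalyticRing (n + 1)) :=
  Ideal.span {φ | ∃ i : Fin (n + 1), 2 ≤ (i : ℕ) ∧
    φ = germAtZero (partialDeriv f i) (analyticAt_partialDeriv hf i)}

/-- The relative polar surface `Γ²_{f,z} = [V(∂f/∂z_2, …, ∂f/∂z_n)]`, as a cycle at the origin. -/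
def polarSurface {n : ℕ} (f : (Fin (n + 1) → ℂ) → ℂ) (hf : AnalyticAt ℂ f 0) :
    AnalyticCycle (n + 1) :=
  cycleOf (polarIdeal f hf)

end

/-!
Let `𝒪` be the ring of germs at the origin, `I = ⟨∂f/∂z_2, …, ∂f/∂z_n⟩` and `ψ = ∂f/∂z_1`. That the
restriction of `f` to `V(z_0)` has an isolated critical point means that `I + ⟨ψ, z_0⟩` is primary to
the maximal ideal (`comap_jacobianIdeal_restrictHyperplane`). As the coordinates are a regular sequence
in `𝒪`, any system of parameters is one; so the generators of `I` form a regular sequence, the polar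
surface `V(I)` is purely two-dimensional without embedded components (`depthGE_two_polarIdeal`), and
`V(I, z_0)` is a curve that `V(ψ)` meets only at the origin.

On a branch of this curve `z_0` and `∂f/∂z_2, …, ∂f/∂z_n` vanish, so the chain rule along a
parametrization is `df = ψ dz_1` (`derivative_arc_polar`). Since `ψ` does not vanish on the branch,
`f` vanishes on it exactly when `z_1` does (`germ_mem_iff_coordGerm_mem`). Thus `V(f)` meets the curve
only at the origin exactly when `V(z_1)` does, and this gives the equivalences, the dimensions of the
components being forced by depth.

Moreover `ord f = ord ψ + ord z_1` along each parametrization. So on each branch the intersection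
number with `V(f)` is the sum of those with `V(ψ)` and `V(z_1)` (`lengthInt_quotient_germ_eq_add`):
two functions with the same order along all arcs differ by a factor that is integral in both
directions, and so define quotients of the same length (`length_quotient_eq_of_order_eq`). The arcs
come from the valuation rings that dominate the branch, which are discrete with residue field `ℂ` by
the Krull–Akizuki theorem.

Intersection numbers of cycles are computed by Herbrand indices `λ(M/aM) - λ(0 :_M a)`, starting from
the length (`numberHom_interHom_interHom`). These are additive on exact sequences
(`IsAdditiveOn.herbrand`), hence determined by the components and their multiplicities
(`IsAdditiveOn.eq_sum_minimalPrimes`), and iterating them does not depend on the order of the elements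
(`IsAdditiveOn.herbrand_comm`). So `Γ² · V(f) · V(z_0)` is the index of `f` on the curve `V(I, z_0)`,
which splits over the branches into the index of `ψ`, the length of `𝒪/(I + ⟨ψ, z_0⟩)`, that is the
Milnor number (`milnorNumber_restrictHyperplane`), and the index of `z_1`, that is
`Γ² · V(z_0, z_1)` (`herbrandIndex_surface_eq_add`).

The analytic input is that `𝒪` is a Noetherian local ring
(`instIsNoetherianRingLocalAnalyticRing`) in which the coordinates form a regular sequence
(`depthGE_localAnalyticRing`). Both follow from Weierstrass division, proved for convergent power
series by a Neumann series in a weighted `ℓ¹` norm (`exists_weierstrass_division`).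
-/

/-! ### Additive functions on modules and the Herbrand index -/

section Additive

variable {R : Type} [CommRing R]

/-- An integer-valued function on modules is additive on the finitely generated modules killed by
`I` if it is additive on short exact sequences of such modules. -/
def IsAdditiveOn (I : Ideal R) (lam : (M : Type) → [AddCommGroup M] → [Module R M] → ℤ) : Prop :=
  ∀ (N₁ N₂ N₃ : Type) [AddCommGroup N₁] [Module R N₁] [AddCommGroup N₂] [Module R N₂]
    [AddCommGroup N₃] [Module R N₃] [Module.Finite R N₁] [Module.Finite R N₂] [Module.Finite R N₃]
    (f : N₁ →ₗ[R] N₂) (g : N₂ →ₗ[R] N₃), Function.Injective f → Function.Surjective g →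
    Function.Exact f g → I ≤ Module.annihilator R N₂ → lam N₂ = lam N₁ + lam N₃

theorem IsAdditiveOn.mono {I J : Ideal R}
    {lam : (M : Type) → [AddCommGroup M] → [Module R M] → ℤ} (h : IsAdditiveOn I lam)
    (hIJ : I ≤ J) : IsAdditiveOn J lam := by
  intro N₁ N₂ N₃ _ _ _ _ _ _ _ _ _ f g hf hg hfg hJ
  exact h N₁ N₂ N₃ f g hf hg hfg (hIJ.trans hJ)

variable {I : Ideal R} {lam : (M : Type) → [AddCommGroup M] → [Module R M] → ℤ}

theorem IsAdditiveOn.eq_zero (h : IsAdditiveOn I lam) (N : Type) [AddCommGroup N] [Module R N]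
    [Subsingleton N] : lam N = 0 := by
  have := h N N N (LinearMap.id) (LinearMap.id) (fun _ _ h => h) (fun x => ⟨x, rfl⟩)
    (fun x => ⟨fun _ => ⟨x, rfl⟩, fun _ => Subsingleton.elim _ _⟩)
    (by rw [Module.annihilator_eq_top_iff.mpr ‹_›]; exact le_top)
  linarith

theorem IsAdditiveOn.congr (h : IsAdditiveOn I lam) {N N' : Type} [AddCommGroup N] [Module R N]
    [AddCommGroup N'] [Module R N'] [Module.Finite R N] (e : N ≃ₗ[R] N')
    (hN : I ≤ Module.annihilator R N) : lam N = lam N' := by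
  have : Module.Finite R N' := Module.Finite.equiv e
  have := h N N' PUnit e.toLinearMap 0 e.injective (Function.surjective_to_subsingleton _)
    ((e.toLinearMap.exact_zero_iff_surjective _).2 e.surjective) (by rwa [← e.annihilator_eq])
  rw [this, h.eq_zero PUnit, add_zero]

/-- Rank–nullity for an additive function. -/
theorem IsAdditiveOn.eq_ker_add_range [IsNoetherianRing R] (h : IsAdditiveOn I lam) {N N' : Type}
    [AddCommGroup N] [Module R N] [AddCommGroup N'] [Module R N'] [Module.Finite R N]
    (g : N →ₗ[R] N') (hN : I ≤ Module.annihilator R N) :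
    lam N = lam (LinearMap.ker g) + lam (LinearMap.range g) :=
  h _ N _ (LinearMap.ker g).subtype g.rangeRestrict (Submodule.subtype_injective _)
    g.surjective_rangeRestrict
    (by rw [LinearMap.exact_iff, LinearMap.ker_rangeRestrict, Submodule.range_subtype]) hN

/-- The length as an integer, with the value `0` for modules of infinite length. It is additive on
modules killed by an ideal `K` with `R/K` Artinian (`isAdditiveOn_lengthInt`). -/
noncomputable def lengthInt (R : Type) [CommRing R] (M : Type) [AddCommGroup M] [Module R M] : ℤ :=
  ((Module.length R M).toNat : ℤ)

/-- The Herbrand index `M ↦ λ(M/aM) - λ(0 :_M a)` attached to a function `λ` on modules. For `λ` the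
length it is the Euler characteristic of the Koszul complex of `a` on `M`, and iterating it computes
intersection numbers. -/
def herbrandIndex (lam : (M : Type) → [AddCommGroup M] → [Module R M] → ℤ) (a : R)
    (M : Type) [AddCommGroup M] [Module R M] : ℤ :=
  lam (M ⧸ LinearMap.range (LinearMap.lsmul R M a)) - lam (LinearMap.ker (LinearMap.lsmul R M a))

theorem annihilator_quotient_smul {J : Ideal R} (a : R) (M : Type) [AddCommGroup M] [Module R M]
    (hM : J ≤ Module.annihilator R M) :
    J ⊔ Ideal.span {a} ≤
      Module.annihilator R (M ⧸ LinearMap.range (LinearMap.lsmul R M a)) := by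
  refine sup_le (hM.trans (LinearMap.annihilator_le_of_surjective
    (Submodule.mkQ _) (Submodule.mkQ_surjective _))) ?_
  rw [Ideal.span_le, Set.singleton_subset_iff, SetLike.mem_coe, Module.mem_annihilator]
  intro m
  obtain ⟨m, rfl⟩ := Submodule.mkQ_surjective _ m
  rw [← map_smul, Submodule.mkQ_apply, Submodule.Quotient.mk_eq_zero]
  exact ⟨m, rfl⟩

theorem annihilator_ker_smul {J : Ideal R} (a : R) (M : Type) [AddCommGroup M] [Module R M]
    (hM : J ≤ Module.annihilator R M) :
    J ⊔ Ideal.span {a} ≤ Module.annihilator R (LinearMap.ker (LinearMap.lsmul R M a)) := by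
  refine sup_le (hM.trans (LinearMap.annihilator_le_of_injective
    (Submodule.subtype _) (Submodule.subtype_injective _))) ?_
  rw [Ideal.span_le, Set.singleton_subset_iff, SetLike.mem_coe, Module.mem_annihilator]
  intro m
  exact Subtype.ext m.2

/-- If `λ` is additive on modules killed by `I + (a)`, then `herbrandIndex λ a` is additive on modules
killed by `I`: this is the six term exact sequence of the snake lemma. -/
theorem IsAdditiveOn.herbrand [IsNoetherianRing R] {a : R}
    (h : IsAdditiveOn (I ⊔ Ideal.span {a}) lam) : IsAdditiveOn I (herbrandIndex lam a) := by
  intro N₁ N₂ N₃ _ _ _ _ _ _ _ _ _ f g hf hg hfg hI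
  have hI1 : I ≤ Module.annihilator R N₁ := hI.trans (LinearMap.annihilator_le_of_injective f hf)
  have hI3 : I ≤ Module.annihilator R N₃ := hI.trans (LinearMap.annihilator_le_of_surjective g hg)
  have k1 := annihilator_ker_smul a N₁ hI1
  have k2 := annihilator_ker_smul a N₂ hI
  have k3 := annihilator_ker_smul a N₃ hI3
  have q1 := annihilator_quotient_smul a N₁ hI1
  have q2 := annihilator_quotient_smul a N₂ hI
  set m1 := LinearMap.lsmul R N₁ a with hm1
  set m2 := LinearMap.lsmul R N₂ a with hm2
  set m3 := LinearMap.lsmul R N₃ a with hm3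
  have c1 : f.comp m1 = m2.comp f := by ext; simp [hm1, hm2]
  have c2 : g.comp m2 = m3.comp g := by ext; simp [hm3, hm2]
  -- the six term sequence of kernels and cokernels of multiplication by `a`
  let F1 : LinearMap.ker m1 →ₗ[R] LinearMap.ker m2 := f.restrict (fun x hx => by
    have := congr($c1 x)
    simp only [LinearMap.comp_apply, LinearMap.mem_ker.mp hx, map_zero] at this
    exact this.symm)
  let F2 : LinearMap.ker m2 →ₗ[R] LinearMap.ker m3 := g.restrict (fun x hx => by
    have := congr($c2 x)
    simp only [LinearMap.comp_apply, LinearMap.mem_ker.mp hx, map_zero] at this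
    exact this.symm)
  let G1 : (N₁ ⧸ LinearMap.range m1) →ₗ[R] (N₂ ⧸ LinearMap.range m2) :=
    Submodule.mapQ _ _ f (by rintro _ ⟨x, rfl⟩; exact ⟨f x, congr($c1 x).symm⟩)
  let G2 : (N₂ ⧸ LinearMap.range m2) →ₗ[R] (N₃ ⧸ LinearMap.range m3) :=
    Submodule.mapQ _ _ g (by rintro _ ⟨x, rfl⟩; exact ⟨g x, congr($c2 x).symm⟩)
  obtain ⟨σ, hσ⟩ := hg.hasRightInverse
  obtain ⟨ρ, hρ⟩ := hf.hasLeftInverse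
  have e2 : Function.Exact (LinearMap.ker m2).subtype m2 := m2.exact_subtype_ker_map
  have e3 : Function.Exact (LinearMap.ker m3).subtype m3 := m3.exact_subtype_ker_map
  have p1 : Function.Exact m1 (LinearMap.range m1).mkQ := m1.exact_map_mkQ_range
  have p2 : Function.Exact m2 (LinearMap.range m2).mkQ := m2.exact_map_mkQ_range
  let δ := SnakeLemma.δ m1 m2 m3 f g hfg f g hfg c1 c2 σ (funext hσ) ρ (funext hρ)
    (LinearMap.ker m3).subtype e3 (LinearMap.range m1).mkQ p1
  have hF1 : Function.Injective F1 := fun x y hxy => Subtype.ext (hf congr(($hxy : N₂)))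
  have hG2 : Function.Surjective G2 := by
    intro y
    obtain ⟨y, rfl⟩ := Submodule.mkQ_surjective _ y
    obtain ⟨x, rfl⟩ := hg y
    exact ⟨Submodule.Quotient.mk x, rfl⟩
  have E1 : Function.Exact F1 F2 := by
    intro x
    constructor
    · intro hx
      obtain ⟨y, hy⟩ := (hfg x.1).mp congr(($hx : N₃))
      refine ⟨⟨y, hf ?_⟩, Subtype.ext hy⟩
      have := congr($c1 y)
      simp only [LinearMap.comp_apply, hy] at this
      rw [this, map_zero]; exact x.2
    · rintro ⟨y, rfl⟩
      exact Subtype.ext (hfg.apply_apply_eq_zero y.1)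
  have E2 : Function.Exact F2 δ := SnakeLemma.exact_δ_right m1 m2 m3 f g hfg f g hfg c1 c2 σ
    (funext hσ) ρ (funext hρ) (LinearMap.ker m2).subtype e2 (LinearMap.ker m3).subtype e3
    (LinearMap.range m1).mkQ p1 F2 rfl (Submodule.subtype_injective _)
  have E3 : Function.Exact δ G1 := SnakeLemma.exact_δ_left m1 m2 m3 f g hfg f g hfg c1 c2 σ
    (funext hσ) ρ (funext hρ) (LinearMap.ker m3).subtype e3
    (LinearMap.range m1).mkQ p1 (LinearMap.range m2).mkQ p2 G1 rfl (Submodule.mkQ_surjective _)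
  have E4 : Function.Exact G1 G2 := by
    intro x
    constructor
    · obtain ⟨x, rfl⟩ := Submodule.mkQ_surjective _ x
      intro hx
      have hx' : Submodule.Quotient.mk (p := LinearMap.range m3) (g x) = 0 := hx
      rw [Submodule.Quotient.mk_eq_zero] at hx'
      obtain ⟨z, hz⟩ := hx'
      obtain ⟨z, rfl⟩ := hg z
      have h3 := congr($c2 z)
      simp only [LinearMap.comp_apply] at h3
      obtain ⟨w, hw⟩ := (hfg (x - m2 z)).mp (by rw [map_sub, h3, hz, sub_self])
      refine ⟨Submodule.Quotient.mk w, ?_⟩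
      show Submodule.Quotient.mk (p := LinearMap.range m2) (f w) = Submodule.Quotient.mk x
      rw [Submodule.Quotient.eq, hw]
      exact ⟨-z, by simp⟩
    · rintro ⟨y, rfl⟩
      obtain ⟨y, rfl⟩ := Submodule.mkQ_surjective _ y
      show Submodule.Quotient.mk (p := LinearMap.range m3) (g (f y)) = 0
      rw [hfg.apply_apply_eq_zero]; rfl
  have q3 : I ⊔ Ideal.span {a} ≤ Module.annihilator R (N₃ ⧸ LinearMap.range m3) :=
    q2.trans (LinearMap.annihilator_le_of_surjective G2 hG2)
  -- the alternating sum of `λ` along the exact sequence vanishes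
  have r2 := h.eq_ker_add_range F2 k2
  have r3 := h.eq_ker_add_range δ k3
  have s1 := h.eq_ker_add_range G1 q1
  have s2 := h.eq_ker_add_range G2 q2
  have t1 : lam (LinearMap.ker m1) = lam (LinearMap.range F1) :=
    h.congr (LinearEquiv.ofInjective F1 hF1) k1
  have t2 : lam (LinearMap.range G2) = lam (N₃ ⧸ LinearMap.range m3) :=
    (h.congr ((LinearEquiv.ofTop _ (LinearMap.range_eq_top.mpr hG2)).symm) q3).symm
  rw [LinearMap.exact_iff] at E1 E2 E3 E4
  rw [E1] at r2; rw [E2] at r3; rw [E3] at s1; rw [E4] at s2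
  simp only [herbrandIndex]
  linarith

end Additive

/-! ### Multiplicities and dévissage -/

section Devissage

variable {R : Type} [CommRing R]

/-- The length of the localization `M_𝔭` over `R_𝔭`, with the value `0` if it is infinite. -/
noncomputable def multAt (p : PrimeSpectrum R) (M : Type) [AddCommGroup M] [Module R M] : ℕ :=
  (Module.length (Localization.AtPrime p.asIdeal)
    (LocalizedModule p.asIdeal.primeCompl M)).toNat

/-- `V(𝔭)` has multiplicity one along itself. -/
theorem length_localizedModule_quotient_self (p : Ideal R) [p.IsPrime] :
    Module.length (Localization.AtPrime p) (LocalizedModule p.primeCompl (R ⧸ p)) = 1 := by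
  rw [Module.length_eq_one_iff]
  have : Nontrivial (LocalizedModule p.primeCompl (R ⧸ p)) := by
    refine ⟨LocalizedModule.mk 1 1, 0, ?_⟩
    rw [Ne, ← LocalizedModule.zero_mk 1, LocalizedModule.mk_eq]
    rintro ⟨⟨c, hc⟩, h⟩
    rw [one_smul, one_smul, smul_zero] at h
    have h' : Ideal.Quotient.mk p (c * 1) = 0 := h
    rw [Ideal.Quotient.eq_zero_iff_mem, mul_one] at h'
    exact hc h'
  rw [isSimpleModule_iff_toSpanSingleton_surjective]
  refine ⟨this, fun x hx y => ?_⟩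
  induction x using LocalizedModule.induction_on with
  | h r s =>
  induction y using LocalizedModule.induction_on with
  | h r' s' =>
  obtain ⟨r, rfl⟩ := Ideal.Quotient.mk_surjective r
  obtain ⟨r', rfl⟩ := Ideal.Quotient.mk_surjective r'
  have hr : r ∈ p.primeCompl := by
    intro hr
    apply hx
    rw [Ideal.Quotient.eq_zero_iff_mem.mpr hr, LocalizedModule.zero_mk]
  refine ⟨Localization.mk (s.1 * r') (s' * ⟨r, hr⟩), ?_⟩
  rw [LinearMap.toSpanSingleton_apply, LocalizedModule.mk_smul_mk, LocalizedModule.mk_eq]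
  refine ⟨1, ?_⟩
  simp only [one_smul]
  show Ideal.Quotient.mk p (s'.1 * ((s.1 * r') * r)) = Ideal.Quotient.mk p ((s'.1 * r) * s.1 * r')
  congr 1; ring

theorem subsingleton_localizedModule_quotient {p q : Ideal R} [p.IsPrime] (h : ¬ q ≤ p) :
    Subsingleton (LocalizedModule p.primeCompl (R ⧸ q)) := by
  obtain ⟨r, hrq, hrp⟩ := Set.not_subset.mp h
  rw [LocalizedModule.subsingleton_iff]
  intro m
  obtain ⟨m, rfl⟩ := Ideal.Quotient.mk_surjective m
  refine ⟨r, hrp, ?_⟩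
  show Ideal.Quotient.mk q (r * m) = 0
  rw [Ideal.Quotient.eq_zero_iff_mem]
  exact Ideal.mul_mem_right _ _ hrq

/-- Dévissage: an additive function that vanishes on `R/𝔮` for the non-minimal primes `𝔮 ⊇ I` is
determined by its values at the minimal primes of `I` and the multiplicities there. -/
theorem IsAdditiveOn.eq_sum_minimalPrimes [IsNoetherianRing R] {I : Ideal R}
    {lam : (M : Type) → [AddCommGroup M] → [Module R M] → ℤ} (h : IsAdditiveOn I lam)
    (S : Finset (PrimeSpectrum R)) (hS : ∀ p, p ∈ S ↔ p.asIdeal ∈ I.minimalPrimes)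
    (hq : ∀ q : PrimeSpectrum R, I ≤ q.asIdeal → q ∉ S → lam (R ⧸ q.asIdeal) = 0)
    (M : Type) [AddCommGroup M] [Module R M] [hM : Module.Finite R M]
    (hI : I ≤ Module.annihilator R M) :
    lam M = ∑ p ∈ S, (multAt p M : ℤ) * lam (R ⧸ p.asIdeal) := by
  -- the lengths at the minimal primes have to be known finite for `multAt` to be additive, so the
  -- induction over filtrations with quotients `R/𝔮` proves this along with the formula
  suffices H : (∀ p ∈ S, Module.length (Localization.AtPrime p.asIdeal)
      (LocalizedModule p.asIdeal.primeCompl M) ≠ ⊤) ∧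
      lam M = ∑ p ∈ S, (multAt p M : ℤ) * lam (R ⧸ p.asIdeal) from H.2
  revert hI
  induction hM using IsNoetherianRing.induction_on_isQuotientEquivQuotientPrime R with
  | subsingleton N =>
    intro _
    have (p : PrimeSpectrum R) : Module.length (Localization.AtPrime p.asIdeal)
      (LocalizedModule p.asIdeal.primeCompl N) = 0 := by
      rw [Module.length_eq_zero_iff]; infer_instance
    simp [multAt, h.eq_zero N]
  | quotient N q e =>
    intro hI
    have hIq : I ≤ q.asIdeal := by
      rw [e.annihilator_eq, Ideal.annihilator_quotient] at hI; exact hI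
    have hl (p : PrimeSpectrum R) : Module.length (Localization.AtPrime p.asIdeal)
        (LocalizedModule p.asIdeal.primeCompl N) = Module.length (Localization.AtPrime p.asIdeal)
        (LocalizedModule p.asIdeal.primeCompl (R ⧸ q.asIdeal)) :=
      (IsLocalizedModule.mapEquiv p.asIdeal.primeCompl
        (LocalizedModule.mkLinearMap p.asIdeal.primeCompl N)
        (LocalizedModule.mkLinearMap p.asIdeal.primeCompl (R ⧸ q.asIdeal))
        (Localization.AtPrime p.asIdeal) e).length_eq
    have hne : ∀ p ∈ S, p ≠ q → Module.length (Localization.AtPrime p.asIdeal)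
        (LocalizedModule p.asIdeal.primeCompl (R ⧸ q.asIdeal)) = 0 := by
      intro p hp hpq
      rw [Module.length_eq_zero_iff]
      apply subsingleton_localizedModule_quotient
      intro hqp
      exact hpq (PrimeSpectrum.ext (le_antisymm (((hS p).mp hp).2 ⟨q.2, hIq⟩ hqp) hqp))
    refine ⟨fun p hp => ?_, ?_⟩
    · rw [hl]
      by_cases hpq : p = q
      · subst hpq
        rw [length_localizedModule_quotient_self]; simp
      · rw [hne p hp hpq]; simp
    · rw [h.congr e hI]
      by_cases hqS : q ∈ S
      · rw [Finset.sum_eq_single_of_mem q hqS]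
        · simp [multAt, hl, length_localizedModule_quotient_self]
        · intro p hp hpq
          simp [multAt, hl, hne p hp hpq]
      · rw [hq q hIq hqS, Finset.sum_eq_zero]
        intro p hp
        have : p ≠ q := fun h => hqS (h ▸ hp)
        simp [multAt, hl, hne p hp this]
  | exact N₁ N₂ N₃ f g hf hg hfg h1 h3 =>
    intro hI
    obtain ⟨f1, s1⟩ := h1 (hI.trans (LinearMap.annihilator_le_of_injective f hf))
    obtain ⟨f3, s3⟩ := h3 (hI.trans (LinearMap.annihilator_le_of_surjective g hg))
    have hl (p : PrimeSpectrum R) : Module.length (Localization.AtPrime p.asIdeal)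
        (LocalizedModule p.asIdeal.primeCompl N₂) = Module.length (Localization.AtPrime p.asIdeal)
        (LocalizedModule p.asIdeal.primeCompl N₁) + Module.length (Localization.AtPrime p.asIdeal)
        (LocalizedModule p.asIdeal.primeCompl N₃) :=
      Module.length_eq_add_of_exact (LocalizedModule.map p.asIdeal.primeCompl f)
        (LocalizedModule.map p.asIdeal.primeCompl g)
        (LocalizedModule.map_injective _ _ hf) (LocalizedModule.map_surjective _ _ hg)
        (LocalizedModule.map_exact _ _ _ hfg)
    refine ⟨fun p hp => ?_, ?_⟩
    · rw [hl]; exact WithTop.add_ne_top.mpr ⟨f1 p hp, f3 p hp⟩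
    · rw [h N₁ N₂ N₃ f g hf hg hfg hI, s1, s3, ← Finset.sum_add_distrib]
      refine Finset.sum_congr rfl fun p hp => ?_
      simp only [multAt]
      rw [hl, ENat.toNat_add (f1 p hp) (f3 p hp)]
      push_cast; ring

/-- Finitely generated modules killed by `K` have finite length when `R/K` is Artinian. -/
theorem length_ne_top_of_annihilator [IsNoetherianRing R] {K : Ideal R} [IsArtinianRing (R ⧸ K)]
    (M : Type) [AddCommGroup M] [Module R M] [Module.Finite R M]
    (hK : K ≤ Module.annihilator R M) : Module.length R M ≠ ⊤ := by
  have hT : Module.IsTorsionBySet R M K := fun x a => Module.mem_annihilator.mp (hK a.2) x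
  let _ : Module (R ⧸ K) M := hT.module
  have : IsScalarTower R (R ⧸ K) M := hT.isScalarTower
  have : Module.Finite (R ⧸ K) M := Module.Finite.of_restrictScalars_finite R _ _
  rw [Module.length_eq_of_surjective (R := R ⧸ K) Ideal.Quotient.mk_surjective]
  exact Module.length_ne_top

theorem isAdditiveOn_lengthInt [IsNoetherianRing R] (K : Ideal R) [IsArtinianRing (R ⧸ K)] :
    IsAdditiveOn K (lengthInt R) := by
  intro N₁ N₂ N₃ _ _ _ _ _ _ _ _ _ f g hf hg hfg hK
  have h2 := length_ne_top_of_annihilator N₂ hK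
  have h := Module.length_eq_add_of_exact f g hf hg hfg
  rw [h] at h2
  obtain ⟨h1, h3⟩ := WithTop.add_ne_top.mp h2
  simp only [lengthInt]
  rw [h, ENat.toNat_add h1 h3]
  push_cast; rfl

theorem isMaximal_of_comap_mk {K : Ideal R} {q : Ideal (R ⧸ K)}
    (h : (q.comap (Ideal.Quotient.mk K)).IsMaximal) (hq : q ≠ ⊤) : q.IsMaximal := by
  have := Ideal.map_eq_top_or_isMaximal_of_surjective (Ideal.Quotient.mk K)
    Ideal.Quotient.mk_surjective h
  rw [Ideal.map_comap_of_surjective _ Ideal.Quotient.mk_surjective] at this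
  exact this.resolve_left hq

theorem isArtinianRing_quotient_of_forall_prime [IsNoetherianRing R] {K : Ideal R}
    (hK : ∀ q : Ideal R, q.IsPrime → K ≤ q → q.IsMaximal) :
    IsArtinianRing (R ⧸ K) := by
  rw [isArtinianRing_iff_krullDimLE_zero, Ring.krullDimLE_zero_iff]
  intro q hq
  refine isMaximal_of_comap_mk (hK (q.comap (Ideal.Quotient.mk K)) inferInstance ?_) hq.ne_top
  intro x hx
  rw [Ideal.mem_comap, Ideal.Quotient.eq_zero_iff_mem.mpr hx]
  exact zero_mem _

/-! ### Symmetry of the iterated Herbrand index -/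

section Herbrand

variable {I : Ideal R} {lam : (M : Type) → [AddCommGroup M] → [Module R M] → ℤ}

/-- Where `λ` itself is already additive, its Herbrand index vanishes: the kernel and the cokernel of
an endomorphism have the same value. -/
theorem IsAdditiveOn.herbrand_eq_zero [IsNoetherianRing R] (h : IsAdditiveOn I lam) (a : R)
    (M : Type) [AddCommGroup M] [Module R M] [Module.Finite R M]
    (hM : I ≤ Module.annihilator R M) : herbrandIndex lam a M = 0 := by
  have h1 := h.eq_ker_add_range (LinearMap.lsmul R M a) hM
  have h2 := h _ M _ (LinearMap.range (LinearMap.lsmul R M a)).subtype (Submodule.mkQ _)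
    (Submodule.subtype_injective _) (Submodule.mkQ_surjective _)
    (LinearMap.exact_subtype_mkQ _) hM
  simp only [herbrandIndex]; linarith

theorem IsAdditiveOn.herbrand_of_regular (h : IsAdditiveOn I lam) {a : R}
    {M : Type} [AddCommGroup M] [Module R M] (ha : ∀ m : M, a • m = 0 → m = 0) :
    herbrandIndex lam a M = lam (M ⧸ LinearMap.range (LinearMap.lsmul R M a)) := by
  have : Subsingleton (LinearMap.ker (LinearMap.lsmul R M a)) :=
    ⟨fun x y => Subtype.ext ((ha x.1 x.2).trans (ha y.1 y.2).symm)⟩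
  rw [herbrandIndex, h.eq_zero (LinearMap.ker (LinearMap.lsmul R M a)), sub_zero]

/-- `(R/J)/a(R/J) ≃ R/(J + (a))`. -/
noncomputable def quotSMulQuotientEquiv (J : Ideal R) (a : R) :
    (R ⧸ (J ⊔ Ideal.span {a})) ≃ₗ[R]
      ((R ⧸ J) ⧸ LinearMap.range (LinearMap.lsmul R (R ⧸ J) a)) :=
  (Submodule.quotEquivOfEq _ _ (by
    ext x
    rw [LinearMap.mem_ker, LinearMap.comp_apply, Submodule.mkQ_apply, Submodule.mkQ_apply,
      Submodule.Quotient.mk_eq_zero, Submodule.mem_sup]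
    constructor
    · rintro ⟨y, hy, z, hz, rfl⟩
      obtain ⟨c, rfl⟩ := Ideal.mem_span_singleton'.mp hz
      refine ⟨Ideal.Quotient.mk J c, ?_⟩
      show Ideal.Quotient.mk J (a * c) = Ideal.Quotient.mk J (y + c * a)
      rw [Ideal.Quotient.eq]
      convert J.neg_mem hy using 1
      ring
    · rintro ⟨y, hy⟩
      obtain ⟨c, rfl⟩ := Ideal.Quotient.mk_surjective y
      have hy' : Ideal.Quotient.mk J (a * c) = Ideal.Quotient.mk J x := hy
      rw [Ideal.Quotient.eq] at hy'
      exact ⟨x - a * c, by simpa using J.neg_mem hy', c * a,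
        Ideal.mem_span_singleton'.mpr ⟨c, rfl⟩, by ring⟩)).trans
    (LinearMap.quotKerEquivOfSurjective
      ((LinearMap.range (LinearMap.lsmul R (R ⧸ J) a)).mkQ.comp (Submodule.mkQ J))
      ((Submodule.mkQ_surjective _).comp (Submodule.mkQ_surjective _)))

/-- For `a` regular modulo `J` the Herbrand index of `R/J` is the value of `λ` on the hypersurface
section `R/(J + (a))`. -/
theorem IsAdditiveOn.herbrand_quotient {J : Ideal R} {a : R}
    (h : IsAdditiveOn (J ⊔ Ideal.span {a}) lam)
    (ha : ∀ r : R, a * r ∈ J → r ∈ J) :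
    herbrandIndex lam a (R ⧸ J) = lam (R ⧸ (J ⊔ Ideal.span {a})) := by
  rw [h.herbrand_of_regular, h.congr (quotSMulQuotientEquiv J a)]
  · rw [Ideal.annihilator_quotient]
  · intro m hm
    obtain ⟨r, rfl⟩ := Ideal.Quotient.mk_surjective m
    have hm' : Ideal.Quotient.mk J (a * r) = 0 := hm
    rw [Ideal.Quotient.eq_zero_iff_mem] at hm' ⊢
    exact ha r hm'

/-- `Tor₁(M/aM, R/b) ≃ Tor₁(M/bM, R/a)` when `a` and `b` are regular on `M`. -/
theorem exists_ker_smul_quotient_equiv {M : Type} [AddCommGroup M] [Module R M] {a b : R}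
    (ha : ∀ m : M, a • m = 0 → m = 0) (hb : ∀ m : M, b • m = 0 → m = 0) :
    Nonempty (LinearMap.ker (LinearMap.lsmul R (M ⧸ LinearMap.range (LinearMap.lsmul R M a)) b)
      ≃ₗ[R] LinearMap.ker (LinearMap.lsmul R (M ⧸ LinearMap.range (LinearMap.lsmul R M b)) a)) := by
  -- both kernels are quotients, by the same submodule, of the pairs `(u, v)` with `bu = av`
  let L : Submodule R (M × M) := LinearMap.ker
    ((LinearMap.lsmul R M b).comp (LinearMap.fst R M M) -
      (LinearMap.lsmul R M a).comp (LinearMap.snd R M M))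
  have hL : ∀ x : L, b • x.1.1 = a • x.1.2 := fun x => sub_eq_zero.mp x.2
  let f : L →ₗ[R] LinearMap.ker
      (LinearMap.lsmul R (M ⧸ LinearMap.range (LinearMap.lsmul R M a)) b) :=
    (((LinearMap.range (LinearMap.lsmul R M a)).mkQ.comp (LinearMap.fst R M M)).comp
      L.subtype).codRestrict _ (fun x => by
        show b • Submodule.Quotient.mk (p := LinearMap.range (LinearMap.lsmul R M a)) x.1.1 = 0
        rw [← Submodule.Quotient.mk_smul, Submodule.Quotient.mk_eq_zero, hL]
        exact ⟨_, rfl⟩)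
  let g : L →ₗ[R] LinearMap.ker
      (LinearMap.lsmul R (M ⧸ LinearMap.range (LinearMap.lsmul R M b)) a) :=
    (((LinearMap.range (LinearMap.lsmul R M b)).mkQ.comp (LinearMap.snd R M M)).comp
      L.subtype).codRestrict _ (fun x => by
        show a • Submodule.Quotient.mk (p := LinearMap.range (LinearMap.lsmul R M b)) x.1.2 = 0
        rw [← Submodule.Quotient.mk_smul, Submodule.Quotient.mk_eq_zero, ← hL]
        exact ⟨_, rfl⟩)
  have hf : Function.Surjective f := by
    rintro ⟨m, hm⟩
    obtain ⟨m, rfl⟩ := Submodule.mkQ_surjective _ m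
    have hm' : Submodule.Quotient.mk (p := LinearMap.range (LinearMap.lsmul R M a)) (b • m) = 0 :=
      hm
    rw [Submodule.Quotient.mk_eq_zero] at hm'
    obtain ⟨m', hm'⟩ := hm'
    exact ⟨⟨(m, m'), sub_eq_zero.mpr hm'.symm⟩, rfl⟩
  have hg : Function.Surjective g := by
    rintro ⟨m, hm⟩
    obtain ⟨m, rfl⟩ := Submodule.mkQ_surjective _ m
    have hm' : Submodule.Quotient.mk (p := LinearMap.range (LinearMap.lsmul R M b)) (a • m) = 0 :=
      hm
    rw [Submodule.Quotient.mk_eq_zero] at hm'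
    obtain ⟨m', hm'⟩ := hm'
    exact ⟨⟨(m', m), sub_eq_zero.mpr hm'⟩, rfl⟩
  have hfg : LinearMap.ker f = LinearMap.ker g := by
    ext x
    have h1 : x ∈ LinearMap.ker f ↔ x.1.1 ∈ LinearMap.range (LinearMap.lsmul R M a) := by
      rw [LinearMap.mem_ker, ← Submodule.Quotient.mk_eq_zero]
      exact Subtype.ext_iff
    have h2 : x ∈ LinearMap.ker g ↔ x.1.2 ∈ LinearMap.range (LinearMap.lsmul R M b) := by
      rw [LinearMap.mem_ker, ← Submodule.Quotient.mk_eq_zero]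
      exact Subtype.ext_iff
    rw [h1, h2]
    have hx := hL x
    constructor
    · rintro ⟨u, hu⟩
      rw [LinearMap.lsmul_apply] at hu
      refine ⟨u, sub_eq_zero.mp (ha _ ?_)⟩
      rw [smul_sub, ← hx, ← hu, LinearMap.lsmul_apply, smul_comm, sub_self]
    · rintro ⟨u, hu⟩
      rw [LinearMap.lsmul_apply] at hu
      refine ⟨u, sub_eq_zero.mp (hb _ ?_)⟩
      rw [smul_sub, hx, ← hu, LinearMap.lsmul_apply, smul_comm, sub_self]
  exact ⟨(LinearMap.quotKerEquivOfSurjective f hf).symm.trans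
    ((Submodule.quotEquivOfEq _ _ hfg).trans (LinearMap.quotKerEquivOfSurjective g hg))⟩

/-- Both iterated quotients are `M/(aM + bM)`. -/
theorem exists_quotient_smul_quotient_smul_equiv {M : Type} [AddCommGroup M] [Module R M]
    (a b : R) :
    Nonempty (((M ⧸ LinearMap.range (LinearMap.lsmul R M a)) ⧸
      LinearMap.range (LinearMap.lsmul R (M ⧸ LinearMap.range (LinearMap.lsmul R M a)) b)) ≃ₗ[R]
      ((M ⧸ LinearMap.range (LinearMap.lsmul R M b)) ⧸
      LinearMap.range (LinearMap.lsmul R (M ⧸ LinearMap.range (LinearMap.lsmul R M b)) a))) := by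
  have key (a b : R) (x : M) : x ∈ LinearMap.ker ((Submodule.mkQ (LinearMap.range
      (LinearMap.lsmul R (M ⧸ LinearMap.range (LinearMap.lsmul R M a)) b))).comp
      (Submodule.mkQ (LinearMap.range (LinearMap.lsmul R M a)))) ↔
      ∃ u v : M, x = a • u + b • v := by
    rw [LinearMap.mem_ker, LinearMap.comp_apply, Submodule.mkQ_apply,
      Submodule.Quotient.mk_eq_zero]
    constructor
    · rintro ⟨v, hv⟩
      obtain ⟨v, rfl⟩ := Submodule.mkQ_surjective _ v
      have hv' : Submodule.Quotient.mk (p := LinearMap.range (LinearMap.lsmul R M a)) x =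
        Submodule.Quotient.mk (b • v) := hv.symm
      rw [Submodule.Quotient.eq] at hv'
      obtain ⟨u, hu⟩ := hv'
      exact ⟨u, v, by rw [← sub_eq_iff_eq_add]; exact hu.symm⟩
    · rintro ⟨u, v, rfl⟩
      refine ⟨Submodule.Quotient.mk v, ?_⟩
      show Submodule.Quotient.mk (p := LinearMap.range (LinearMap.lsmul R M a)) (b • v) =
        Submodule.Quotient.mk (a • u + b • v)
      rw [Submodule.Quotient.eq]
      exact ⟨-u, by simp⟩
  have hs (a b : R) : Function.Surjective ((Submodule.mkQ (LinearMap.range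
      (LinearMap.lsmul R (M ⧸ LinearMap.range (LinearMap.lsmul R M a)) b))).comp
      (Submodule.mkQ (LinearMap.range (LinearMap.lsmul R M a)))) :=
    (Submodule.mkQ_surjective _).comp (Submodule.mkQ_surjective _)
  refine ⟨(LinearMap.quotKerEquivOfSurjective _ (hs a b)).symm.trans
    ((Submodule.quotEquivOfEq _ _ ?_).trans (LinearMap.quotKerEquivOfSurjective _ (hs b a)))⟩
  ext x
  rw [key, key]
  constructor <;> (rintro ⟨u, v, rfl⟩; exact ⟨v, u, add_comm _ _⟩)

/-- The iterated index of two regular elements does not depend on their order. -/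
theorem IsAdditiveOn.herbrand_comm [IsNoetherianRing R] {a b : R}
    (h : IsAdditiveOn (I ⊔ Ideal.span {a} ⊔ Ideal.span {b}) lam)
    {M : Type} [AddCommGroup M] [Module R M] [Module.Finite R M]
    (hM : I ≤ Module.annihilator R M)
    (ha : ∀ m : M, a • m = 0 → m = 0) (hb : ∀ m : M, b • m = 0 → m = 0) :
    herbrandIndex (herbrandIndex lam b) a M = herbrandIndex (herbrandIndex lam a) b M := by
  have h' : IsAdditiveOn (I ⊔ Ideal.span {b} ⊔ Ideal.span {a}) lam := by
    rwa [sup_right_comm]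
  rw [h.herbrand.herbrand_of_regular ha, h'.herbrand.herbrand_of_regular hb, herbrandIndex, herbrandIndex,
    h.congr (exists_quotient_smul_quotient_smul_equiv a b).some,
    h.congr (exists_ker_smul_quotient_equiv ha hb).some]
  · exact annihilator_ker_smul _ _ (annihilator_quotient_smul _ _ hM)
  · exact annihilator_quotient_smul _ _ (annihilator_quotient_smul _ _ hM)

end Herbrand

end Devissage

/-! ### Depth and systems of parameters -/

section Depth

variable {R : Type} [CommRing R]

/-- `𝔭` is an associated prime of `R/J`: a prime of the form `(J : u)`. -/
def IsAssociatedTo (J p : Ideal R) : Prop := p.IsPrime ∧ ∃ u, ∀ r, r ∈ p ↔ r * u ∈ J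

theorem isAssociatedTo_iff [IsNoetherianRing R] {J p : Ideal R} :
    IsAssociatedTo J p ↔ p ∈ associatedPrimes R (R ⧸ J) := by
  rw [AssociatedPrimes.mem_iff, isAssociatedPrime_iff]
  refine and_congr_right fun _ => ?_
  have key (u r : R) : r ∈ (⊥ : Submodule R (R ⧸ J)).colon {Ideal.Quotient.mk J u} ↔
      r * u ∈ J := by
    rw [Submodule.mem_colon_singleton, Submodule.mem_bot, ← Ideal.Quotient.eq_zero_iff_mem,
      map_mul]
    rfl
  constructor
  · rintro ⟨u, hu⟩
    exact ⟨Ideal.Quotient.mk J u, Ideal.ext fun r => (hu r).trans (key u r).symm⟩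
  · rintro ⟨u, rfl⟩
    obtain ⟨u, rfl⟩ := Ideal.Quotient.mk_surjective u
    exact ⟨u, key u⟩

/-- Every annihilator of a nonzero element of `R/J` lies in an associated prime. -/
theorem exists_isAssociatedTo [IsNoetherianRing R] {J : Ideal R} {u : R} (hu : u ∉ J) :
    ∃ p, IsAssociatedTo J p ∧ ∀ r, r * u ∈ J → r ∈ p := by
  obtain ⟨p, hp, hle⟩ := exists_le_isAssociatedPrime_of_isNoetherianRing R
    (Ideal.Quotient.mk J u) (by rwa [Ne, Ideal.Quotient.eq_zero_iff_mem])
  refine ⟨p, isAssociatedTo_iff.mpr hp, fun r hr => hle ?_⟩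
  rw [Submodule.mem_colon_singleton, Submodule.mem_bot]
  have := Ideal.Quotient.eq_zero_iff_mem.mpr hr
  rwa [map_mul] at this

theorem Ideal.mem_sup_span_singleton' {J : Ideal R} {x r : R} :
    r ∈ J ⊔ Ideal.span {x} ↔ ∃ t, r - x * t ∈ J := by
  rw [Submodule.mem_sup]
  constructor
  · rintro ⟨y, hy, z, hz, rfl⟩
    obtain ⟨c, rfl⟩ := Ideal.mem_span_singleton'.mp hz
    exact ⟨c, by convert hy using 1; ring⟩
  · rintro ⟨t, ht⟩
    exact ⟨_, ht, x * t, Ideal.mem_span_singleton'.mpr ⟨t, mul_comm _ _⟩, by ring⟩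

/-- If `x` is regular modulo `J` and `z` is regular modulo `J + (x)`, then `x` is regular modulo
`J + (z)`: regular sequences of length two may be exchanged in this one direction without any
completeness or locality. -/
theorem regular_sup_of_regular {J : Ideal R} {x z : R} (hx : ∀ r, x * r ∈ J → r ∈ J)
    (hz : ∀ r, z * r ∈ J ⊔ Ideal.span {x} → r ∈ J ⊔ Ideal.span {x}) :
    ∀ r, x * r ∈ J ⊔ Ideal.span {z} → r ∈ J ⊔ Ideal.span {z} := by
  intro r hr
  obtain ⟨s, hs⟩ := Ideal.mem_sup_span_singleton'.mp hr
  obtain ⟨t, ht⟩ := Ideal.mem_sup_span_singleton'.mp (hz s (Ideal.mem_sup_span_singleton'.mpr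
    ⟨r, by convert J.neg_mem hs using 1; ring⟩))
  refine Ideal.mem_sup_span_singleton'.mpr ⟨t, hx _ ?_⟩
  convert J.add_mem hs (J.mul_mem_left z ht) using 1
  ring

variable [IsLocalRing R]

open IsLocalRing

/-- `R/J` has a regular sequence of length `d` in the maximal ideal. The elements are not required to
generate a proper ideal together with `J`, so the unit ideal has every depth. -/
def DepthGE : ℕ → Ideal R → Prop
  | 0, _ => True
  | d + 1, J => ∃ x ∈ maximalIdeal R, (∀ r, x * r ∈ J → r ∈ J) ∧ DepthGE d (J ⊔ Ideal.span {x})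

/-- If no element outside `K` is multiplied into `K` by the whole maximal ideal, for finitely many
ideals `K`, then one element of the maximal ideal is regular modulo all of them. -/
theorem exists_regular_of_forall_exists_notMem [IsNoetherianRing R] (T : Set (Ideal R))
    (hT : T.Finite) (h : ∀ K ∈ T, ∀ u ∉ K, ∃ c ∈ maximalIdeal R, c * u ∉ K) :
    ∃ z ∈ maximalIdeal R, ∀ K ∈ T, ∀ r, z * r ∈ K → r ∈ K := by
  -- otherwise the maximal ideal is a union of finitely many associated primes, hence one of them
  by_contra! hcon
  have hfin : (⋃ K ∈ T, associatedPrimes R (R ⧸ K)).Finite :=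
    hT.biUnion fun K _ => associatedPrimes.finite R (R ⧸ K)
  have hsub : (maximalIdeal R : Set R) ⊆
      ⋃ p ∈ ⋃ K ∈ T, associatedPrimes R (R ⧸ K), (id p : Ideal R) := by
    intro z hz
    obtain ⟨K, hK, r, hr, hr'⟩ := hcon z hz
    obtain ⟨p, hp, hle⟩ := exists_isAssociatedTo hr'
    simp only [Set.mem_iUnion]
    exact ⟨p, ⟨K, hK, isAssociatedTo_iff.mp hp⟩, hle z hr⟩
  obtain ⟨p, hp, hle⟩ := (Ideal.subset_union_prime_finite hfin ⊥ ⊥ (by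
    intro p hp _ _
    simp only [Set.mem_iUnion] at hp
    obtain ⟨K, _, hp⟩ := hp
    exact hp.isPrime)).mp hsub
  simp only [Set.mem_iUnion] at hp
  obtain ⟨K, hK, hp⟩ := hp
  obtain ⟨hpp, u, hu⟩ := isAssociatedTo_iff.mpr hp
  obtain ⟨c, hc, hcu⟩ := h K hK u (fun huK => hpp.ne_top ((Ideal.eq_top_iff_one _).mpr
    ((hu 1).mpr (by rwa [one_mul]))))
  exact hcu ((hu c).mp (hle hc))

/-- Exchange: if `x` and `y` are regular modulo `J` and `R/(J + (x))` has positive depth, so has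
`R/(J + (y))`. -/
theorem exists_mul_notMem_of_exchange {J : Ideal R} {x y w : R}
    (hxm : x ∈ maximalIdeal R) (hw : w ∈ maximalIdeal R)
    (hx : ∀ r, x * r ∈ J → r ∈ J) (hy : ∀ r, y * r ∈ J → r ∈ J)
    (hwr : ∀ r, w * r ∈ J ⊔ Ideal.span {x} → r ∈ J ⊔ Ideal.span {x}) :
    ∀ v ∉ J ⊔ Ideal.span {y}, ∃ c ∈ maximalIdeal R, c * v ∉ J ⊔ Ideal.span {y} := by
  intro v hv
  by_contra! hcon
  obtain ⟨u, hu⟩ := Ideal.mem_sup_span_singleton'.mp (hcon x hxm)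
  obtain ⟨s, hs⟩ := Ideal.mem_sup_span_singleton'.mp (hcon w hw)
  have hwu : w * u ∈ J ⊔ Ideal.span {x} := by
    refine Ideal.mem_sup_span_singleton'.mpr ⟨s, hy _ ?_⟩
    convert J.sub_mem (J.mul_mem_left x hs) (J.mul_mem_left w hu) using 1
    ring
  obtain ⟨t, ht⟩ := Ideal.mem_sup_span_singleton'.mp (hwr u hwu)
  refine hv (Ideal.mem_sup_span_singleton'.mpr ⟨t, hx _ ?_⟩)
  convert J.add_mem hu (J.mul_mem_left y ht) using 1
  ring

/-- Any regular element of the maximal ideal starts a regular sequence of maximal length. -/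
theorem DepthGE.sup_span_singleton [IsNoetherianRing R] : ∀ {d : ℕ} {J : Ideal R},
    DepthGE (d + 1) J → ∀ {y : R}, y ∈ maximalIdeal R → (∀ r, y * r ∈ J → r ∈ J) →
    DepthGE d (J ⊔ Ideal.span {y})
  | 0, _, _, _, _, _ => trivial
  | d + 1, J, h, y, hym, hy => by
    obtain ⟨x, hxm, hx, hdx⟩ := h
    obtain ⟨w, hwm, hw, -⟩ := id hdx
    -- a common regular element `z` links the sequences that start with `x` and with `y`
    obtain ⟨z, hzm, hz⟩ := exists_regular_of_forall_exists_notMem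
      {J, J ⊔ Ideal.span {x}, J ⊔ Ideal.span {y}} (by simp) (by
        rintro K (rfl | rfl | rfl) u hu
        · exact ⟨x, hxm, fun h => hu (hx u h)⟩
        · exact ⟨w, hwm, fun h => hu (hw u h)⟩
        · exact exists_mul_notMem_of_exchange hxm hwm hx hy hw u hu)
    have hzJ := hz J (by simp)
    have hzx := hz (J ⊔ Ideal.span {x}) (by simp)
    have hzy := hz (J ⊔ Ideal.span {y}) (by simp)
    have h1 : DepthGE d (J ⊔ Ideal.span {x} ⊔ Ideal.span {z}) := hdx.sup_span_singleton hzm hzx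
    rw [sup_right_comm] at h1
    have h2 : DepthGE (d + 1) (J ⊔ Ideal.span {z}) :=
      ⟨x, hxm, regular_sup_of_regular hx hzx, h1⟩
    have h3 := h2.sup_span_singleton hym (regular_sup_of_regular hy hzy)
    rw [sup_right_comm] at h3
    exact ⟨z, hzm, hzy, h3⟩

/-- Associated primes of `R/J` have dimension at least the depth. -/
theorem DepthGE.le_ringKrullDim [IsNoetherianRing R] : ∀ {d : ℕ} {J : Ideal R},
    DepthGE d J → ∀ {p : Ideal R}, IsAssociatedTo J p → (d : WithBot ℕ∞) ≤ ringKrullDim (R ⧸ p)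
  | 0, J, _, p, hp => by
    have := hp.1
    simpa using ringKrullDim_nonneg_of_nontrivial
  | d + 1, J, h, p, hp => by
    obtain ⟨x, hxm, hx, hd⟩ := h
    obtain ⟨hpp, u, hu⟩ := hp
    -- the elements of `R/J` killed by `p` are not all divisible by `x`, by Nakayama's lemma
    let N : Ideal R :=
      { carrier := {r | ∀ c ∈ p, c * r ∈ J}
        add_mem' := fun {a b} ha hb c hc => by rw [mul_add]; exact J.add_mem (ha c hc) (hb c hc)
        zero_mem' := fun c _ => by simp
        smul_mem' := fun a r hr c hc => by
          rw [smul_eq_mul, mul_left_comm]; exact J.mul_mem_left _ (hr c hc) }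
    have huN : u ∈ N := fun c hc => (hu c).mp hc
    have huJ : u ∉ J := fun huJ => hpp.ne_top ((Ideal.eq_top_iff_one _).mpr
      ((hu 1).mpr (by rwa [one_mul])))
    obtain ⟨v, hvN, hv⟩ : ∃ v ∈ N, v ∉ J ⊔ Ideal.span {x} := by
      by_contra! hcon
      refine huJ ((Submodule.le_of_le_smul_of_le_jacobson_bot (I := maximalIdeal R) (N := J)
        (N' := N) (IsNoetherian.noetherian N) (IsLocalRing.maximalIdeal_le_jacobson _) ?_) huN)
      intro r hr
      obtain ⟨t, ht⟩ := Ideal.mem_sup_span_singleton'.mp (hcon r hr)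
      have htN : t ∈ N := by
        intro c hc
        refine hx _ ?_
        convert J.sub_mem (hr c hc) (J.mul_mem_left c ht) using 1
        ring
      rw [← sub_add_cancel r (x * t)]
      exact Submodule.add_mem_sup ht (Submodule.smul_mem_smul hxm htN)
    obtain ⟨q, hq, hle⟩ := exists_isAssociatedTo hv
    have hqp := hq.1
    have hpq : p ≤ q := fun c hc => hle c (Ideal.mem_sup_left (hvN c hc))
    have hxq : x ∈ q :=
      hle x (Ideal.mem_sup_right (Ideal.mul_mem_right _ _ (Ideal.mem_span_singleton_self x)))
    have hxp : x ∉ p := fun hxp => huJ (hx u ((hu x).mp hxp))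
    have h1 := hd.le_ringKrullDim hq
    have h2 := ringKrullDim_succ_le_of_surjective (Ideal.Quotient.factor hpq)
      (Ideal.Quotient.factor_surjective hpq) (r := Ideal.Quotient.mk p x)
      (mem_nonZeroDivisors_of_ne_zero (by rwa [Ne, Ideal.Quotient.eq_zero_iff_mem]))
      (by rw [Ideal.Quotient.factor_mk]; exact Ideal.Quotient.eq_zero_iff_mem.mpr hxq)
    refine le_trans ?_ h2
    push_cast
    gcongr

/-- A local ring in which `S` generates an ideal primary to the maximal ideal has dimension at most
the cardinality of `S`. The hypothesis is phrased in `R`, for the quotient `R/p`. -/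
theorem ringKrullDim_quotient_le_card [IsNoetherianRing R] {p : Ideal R} (S : Finset R)
    (hS : ∀ s ∈ S, s ∈ maximalIdeal R)
    (h : ∀ q : Ideal R, q.IsPrime → p ≤ q → (∀ s ∈ S, s ∈ q) → q = maximalIdeal R) :
    ringKrullDim (R ⧸ p) ≤ S.card := by
  classical
  by_cases hp : p = ⊤
  · subst hp
    have : Subsingleton (R ⧸ (⊤ : Ideal R)) := Ideal.Quotient.subsingleton_iff.mpr rfl
    rw [ringKrullDim_eq_bot_of_subsingleton]; exact bot_le
  have := Ideal.Quotient.nontrivial_iff.mpr hp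
  have : IsLocalRing (R ⧸ p) := .of_surjective' _ Ideal.Quotient.mk_surjective
  let T : Finset (R ⧸ p) := S.image (Ideal.Quotient.mk p)
  have hT : (T : Set (R ⧸ p)) ⊆ Ring.jacobson (R ⧸ p) := by
    intro t ht
    simp only [T, Finset.coe_image, Set.mem_image] at ht
    obtain ⟨s, hs, rfl⟩ := ht
    rw [SetLike.mem_coe, IsLocalRing.ringJacobson_eq_maximalIdeal, IsLocalRing.mem_maximalIdeal,
      mem_nonunits_iff]
    intro hu
    have hloc : IsLocalHom (Ideal.Quotient.mk p) :=
      IsLocalHom.of_surjective _ Ideal.Quotient.mk_surjective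
    exact hS s hs (hloc.map_nonunit s hu)
  refine (ringKrullDim_le_ringKrullDim_quotient_add_card T hT).trans ?_
  have h0 : ringKrullDim ((R ⧸ p) ⧸ Ideal.span (T : Set (R ⧸ p))) ≤ 0 := by
    refine (Order.krullDimLE_iff 0 _).mp (Ring.krullDimLE_zero_iff.mpr fun q hq => ?_)
    let q' : Ideal (R ⧸ p) := q.comap (Ideal.Quotient.mk _)
    have hq' := h (q'.comap (Ideal.Quotient.mk p)) inferInstance (by
      intro r hr
      rw [Ideal.mem_comap, Ideal.Quotient.eq_zero_iff_mem.mpr hr]; exact zero_mem _) (by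
      intro s hs
      rw [Ideal.mem_comap, Ideal.mem_comap, Ideal.Quotient.eq_zero_iff_mem.mpr]
      · exact zero_mem _
      · exact Ideal.subset_span (Finset.mem_image_of_mem _ hs))
    have hmax : (q'.comap (Ideal.Quotient.mk p)).IsMaximal := hq' ▸ inferInstance
    exact isMaximal_of_comap_mk (isMaximal_of_comap_mk hmax (Ideal.IsPrime.ne_top inferInstance)) hq.ne_top
  calc _ ≤ (0 : WithBot ℕ∞) + (T.card : WithBot ℕ∞) := by gcongr
    _ ≤ S.card := by
      rw [zero_add]; exact_mod_cast Finset.card_image_le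

/-- In a ring of large depth, an element that can be completed to a system of parameters is
regular. -/
theorem DepthGE.regular_of_parameter [IsNoetherianRing R] {d : ℕ} {J : Ideal R}
    (hd : DepthGE (d + 1) J) {a : R} (S : Finset R) (hcard : S.card ≤ d)
    (hS : ∀ s ∈ S, s ∈ maximalIdeal R)
    (h : ∀ q : Ideal R, q.IsPrime → J ≤ q → a ∈ q → (∀ s ∈ S, s ∈ q) → q = maximalIdeal R) :
    ∀ r, a * r ∈ J → r ∈ J := by
  intro r hr
  by_contra hrJ
  obtain ⟨p, hp, hle⟩ := exists_isAssociatedTo hrJ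
  have hJp : J ≤ p := by
    obtain ⟨-, u, hu⟩ := hp
    exact fun c hc => (hu c).mpr (J.mul_mem_right _ hc)
  have h1 := hd.le_ringKrullDim hp
  have h2 := ringKrullDim_quotient_le_card S hS fun q hq hpq hSq =>
    h q hq (hJp.trans hpq) (hpq (hle a hr)) hSq
  have h3 := h1.trans h2
  norm_cast at h3
  omega

/-- Dividing by part of a system of parameters lowers the depth by the number of elements. -/
theorem DepthGE.sup_span_list [IsNoetherianRing R] {d : ℕ} (S : Finset R) (hcard : S.card ≤ d)
    (hS : ∀ s ∈ S, s ∈ maximalIdeal R) : ∀ (l : List R) {J : Ideal R},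
    DepthGE (d + l.length) J → (∀ a ∈ l, a ∈ maximalIdeal R) →
    (∀ q : Ideal R, q.IsPrime → J ≤ q → (∀ a ∈ l, a ∈ q) → (∀ s ∈ S, s ∈ q) →
      q = maximalIdeal R) →
    DepthGE d (J ⊔ Ideal.span {a | a ∈ l})
  | [], J, hd, _, _ => by simpa using hd
  | a :: l, J, hd, hl, h => by
    classical
    have ha := hl a (by simp)
    have hreg := DepthGE.regular_of_parameter (d := d + l.length) (J := J) hd (a := a)
      (S ∪ l.toFinset) ((Finset.card_union_le _ _).trans
        (add_le_add hcard (List.toFinset_card_le l))) (by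
        intro s hs
        rcases Finset.mem_union.mp hs with hs | hs
        · exact hS s hs
        · exact hl s (List.mem_cons_of_mem _ (List.mem_toFinset.mp hs))) (by
        intro q hq hJ haq hSq
        refine h q hq hJ ?_ fun s hs => hSq s (Finset.mem_union_left _ hs)
        intro b hb
        rcases List.mem_cons.mp hb with rfl | hb
        · exact haq
        · exact hSq b (Finset.mem_union_right _ (List.mem_toFinset.mpr hb)))
    have hd' : DepthGE (d + l.length) (J ⊔ Ideal.span {a}) :=
      DepthGE.sup_span_singleton (d := d + l.length) hd ha hreg
    have := hd'.sup_span_list S hcard hS l (fun b hb => hl b (List.mem_cons_of_mem _ hb)) (by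
      intro q hq hJ hlq hSq
      refine h q hq (le_sup_left.trans hJ) ?_ hSq
      intro b hb
      rcases List.mem_cons.mp hb with rfl | hb
      · exact hJ (Ideal.mem_sup_right (Ideal.mem_span_singleton_self _))
      · exact hlq b hb)
    rw [sup_assoc, ← Ideal.span_union] at this
    convert this using 3
    ext b
    simp

end Depth

/-! ### Lengths over one-dimensional domains and the Krull–Akizuki theorem -/

section Length

/-- The length of a module is the supremum of the lengths of its finitely generated submodules. -/
theorem length_le_of_forall_fg {R M : Type*} [Ring R] [AddCommGroup M] [Module R M] {l : ℕ∞}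
    (h : ∀ P : Submodule R M, P.FG → Module.length R P ≤ l) : Module.length R M ≤ l := by
  rw [← WithBot.coe_le_coe, Module.coe_length, Order.krullDim]
  refine iSup_le fun s => ?_
  -- a chain of submodules is detected on the submodule spanned by witnesses of its strictness
  have hx : ∀ i : Fin s.length, ∃ x ∈ s i.succ, x ∉ s i.castSucc := fun i =>
    Set.exists_of_ssubset (s.strictMono (Fin.castSucc_lt_succ (i := i)))
  choose x hx hx' using hx
  let P : Submodule R M := Submodule.span R (Set.range x)
  have hxP : ∀ i, x i ∈ P := fun i => Submodule.subset_span ⟨i, rfl⟩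
  let t : LTSeries (Submodule R P) :=
    { length := s.length
      toFun := fun i => (s i).comap P.subtype
      step := fun i => by
        refine lt_of_le_of_ne (Submodule.comap_mono (s.step i).le) fun heq => hx' i ?_
        have : (⟨x i, hxP i⟩ : P) ∈ (s i.succ).comap P.subtype := hx i
        rw [← heq] at this
        exact this }
  have h1 : (t.length : WithBot ℕ∞) ≤ Order.krullDim (Submodule R P) :=
    Order.LTSeries.length_le_krullDim t
  rw [← Module.coe_length] at h1
  refine h1.trans (WithBot.coe_le_coe.mpr (h P (Submodule.fg_span (Set.finite_range x))))

variable {B W : Type} [CommRing B] [IsDomain B] [IsNoetherianRing B] [Ring.KrullDimLE 1 B]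
  [CommRing W] [IsDomain W] [Algebra B W] [FaithfulSMul B W]

theorem isArtinianRing_quotient_of_ne_bot {J : Ideal B} (hJ : J ≠ ⊥) : IsArtinianRing (B ⧸ J) :=
  isArtinianRing_quotient_of_forall_prime fun _ hq hJq =>
    hq.isMaximal_of_ne_bot fun h => hJ (le_bot_iff.mp (h ▸ hJq))

omit [IsDomain B] [IsNoetherianRing B] [Ring.KrullDimLE 1 B] [IsDomain W] [FaithfulSMul B W] in
/-- A finitely generated submodule of the fraction field has a common denominator. -/
theorem exists_common_denominator [IsDomain B]
    (hW : ∀ w : W, ∃ s : B, s ≠ 0 ∧ ∃ x, s • w = algebraMap B W x)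
    {M : Submodule B W} (hM : M.FG) :
    ∃ s : B, s ≠ 0 ∧ ∀ w ∈ M, ∃ x, s • w = algebraMap B W x := by
  induction M, hM using Submodule.fg_induction with
  | singleton w =>
    obtain ⟨s, hs, x, hx⟩ := hW w
    refine ⟨s, hs, fun v hv => ?_⟩
    obtain ⟨b, rfl⟩ := Submodule.mem_span_singleton.mp hv
    exact ⟨b * x, by rw [smul_comm, hx, map_mul, Algebra.smul_def]⟩
  | sup M₁ M₂ _ _ h₁ h₂ =>
    obtain ⟨s₁, hs₁, h₁⟩ := h₁
    obtain ⟨s₂, hs₂, h₂⟩ := h₂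
    refine ⟨s₁ * s₂, mul_ne_zero hs₁ hs₂, fun w hw => ?_⟩
    obtain ⟨w₁, hw₁, w₂, hw₂, rfl⟩ := Submodule.mem_sup.mp hw
    obtain ⟨x₁, hx₁⟩ := h₁ w₁ hw₁
    obtain ⟨x₂, hx₂⟩ := h₂ w₂ hw₂
    refine ⟨s₂ * x₁ + s₁ * x₂, ?_⟩
    rw [smul_add, mul_smul, smul_comm, hx₁, mul_smul, hx₂, map_add, map_mul, map_mul,
      Algebra.smul_def, Algebra.smul_def]

/-- A finitely generated module `M` of rank one over a one-dimensional domain satisfies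
`ℓ(M/bM) = ℓ(B/b)`. -/
theorem length_quotient_smul_eq
    (hW : ∀ w : W, ∃ s : B, s ≠ 0 ∧ ∃ x, s • w = algebraMap B W x)
    {M : Submodule B W} (hM : M.FG) (hM0 : M ≠ ⊥) {b : B} (hb : b ≠ 0) :
    Module.length B (M ⧸ LinearMap.range (LinearMap.lsmul B M b)) =
      Module.length B (B ⧸ Ideal.span {b}) := by
  have hMfin : Module.Finite B M := Module.Finite.iff_fg.mpr hM
  obtain ⟨s, hs, hsM⟩ := exists_common_denominator hW hM
  have hinj : Function.Injective (algebraMap B W) := FaithfulSMul.algebraMap_injective B W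
  have hsm : ∀ (c : B), c ≠ 0 → ∀ w : W, c • w = 0 → w = 0 := by
    intro c hc w hw
    rw [Algebra.smul_def, mul_eq_zero] at hw
    exact hw.resolve_left fun h => hc (hinj (h.trans (map_zero _).symm))
  -- multiplication by a common denominator identifies `M` with an ideal
  choose φ hφ using fun w : M => hsM w.1 w.2
  let Φ : M →ₗ[B] B :=
    { toFun := φ
      map_add' := fun v w => hinj (by
        rw [map_add, ← hφ, ← hφ, ← hφ, ← smul_add]; rfl)
      map_smul' := fun c w => hinj (by
        rw [RingHom.id_apply, smul_eq_mul, map_mul, ← hφ, ← hφ, ← Algebra.smul_def, smul_comm]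
        rfl) }
  have hΦ : Function.Injective Φ := by
    rw [injective_iff_map_eq_zero]
    intro w hw
    refine Subtype.ext (hsm s hs w.1 ?_)
    rw [hφ w, show φ w = 0 from hw, map_zero]
  set J : Ideal B := LinearMap.range Φ with hJdef
  have hJ : J ≠ ⊥ := by
    obtain ⟨w, hw, hw0⟩ := (Submodule.ne_bot_iff M).mp hM0
    intro hJ
    have h0 : Φ ⟨w, hw⟩ ∈ J := ⟨_, rfl⟩
    rw [hJ, Ideal.mem_bot, ← map_zero Φ] at h0
    exact hw0 congr(($(hΦ h0) : W))
  have := isArtinianRing_quotient_of_ne_bot hJ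
  have hb' : (⊥ : Ideal B) ⊔ Ideal.span {b} ≠ ⊥ := by simpa using hb
  have := isArtinianRing_quotient_of_ne_bot hb'
  have hadd : IsAdditiveOn ((⊥ : Ideal B) ⊔ Ideal.span {b}) (lengthInt B) :=
    isAdditiveOn_lengthInt _
  have h1 := hadd.herbrand M B (B ⧸ J) Φ J.mkQ hΦ (Submodule.mkQ_surjective _)
    (LinearMap.exact_map_mkQ_range Φ) bot_le
  -- `B/J` has finite length, so its Herbrand index vanishes and those of `J` and `B` agree
  rw [(isAdditiveOn_lengthInt J).herbrand_eq_zero b (B ⧸ J) (by rw [Ideal.annihilator_quotient]),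
    add_zero, hadd.herbrand_of_regular (fun m hm => (mul_eq_zero.mp hm).resolve_left hb),
    hadd.herbrand_of_regular (fun m hm => Subtype.ext (hsm b hb m.1 (Subtype.ext_iff.mp hm)))] at h1
  have hr : LinearMap.range (LinearMap.lsmul B B b) = Ideal.span {b} := by
    ext x
    rw [Ideal.mem_span_singleton']
    exact exists_congr fun c => by rw [LinearMap.lsmul_apply, smul_eq_mul, mul_comm]
  rw [hr] at h1
  have hf1 := length_ne_top_of_annihilator (K := (⊥ : Ideal B) ⊔ Ideal.span {b}) (B ⧸ Ideal.span {b})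
    (by rw [Ideal.annihilator_quotient, bot_sup_eq])
  have hf2 := length_ne_top_of_annihilator (K := (⊥ : Ideal B) ⊔ Ideal.span {b})
    (M ⧸ LinearMap.range (LinearMap.lsmul B M b)) (annihilator_quotient_smul _ _ bot_le)
  simp only [lengthInt, Nat.cast_inj] at h1
  rw [← ENat.natCast_toNat hf1, ← ENat.natCast_toNat hf2, h1]

/-- For every ring `W` between `B` and its fraction field, `ℓ(W/bW) ≤ ℓ(B/bB)`, although `W` need not
be a finite `B`-module: it suffices to bound finitely generated submodules. -/
theorem length_quotient_span_algebraMap_le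
    (hW : ∀ w : W, ∃ s : B, s ≠ 0 ∧ ∃ x, s • w = algebraMap B W x) {b : B} (hb : b ≠ 0) :
    Module.length B (W ⧸ Ideal.span {algebraMap B W b}) ≤
      Module.length B (B ⧸ Ideal.span {b}) := by
  let π : W →ₗ[B] W ⧸ Ideal.span {algebraMap B W b} :=
    (Ideal.Quotient.mkₐ B (Ideal.span {algebraMap B W b})).toLinearMap
  have hπ : Function.Surjective π := Ideal.Quotient.mk_surjective
  refine length_le_of_forall_fg fun P hP => ?_
  obtain ⟨M, hM, rfl⟩ : ∃ M : Submodule B W, M.FG ∧ M.map π = P := by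
    obtain ⟨S, rfl⟩ := hP
    choose σ hσ using hπ
    classical
    refine ⟨Submodule.span B (S.image σ), ⟨_, rfl⟩, ?_⟩
    rw [Submodule.map_span, Finset.coe_image, ← Set.image_comp]
    have : (π ∘ σ) = id := funext hσ
    rw [this, Set.image_id]
  -- enlarging `M` by `1` makes it nonzero, so that its length is known
  let M' : Submodule B W := M ⊔ Submodule.span B {1}
  have hM' : M'.FG := hM.sup (Submodule.fg_span_singleton _)
  have hM'0 : M' ≠ ⊥ := fun h => one_ne_zero (α := W) (by
    rw [← Submodule.mem_bot B, ← h]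
    exact Submodule.mem_sup_right (Submodule.mem_span_singleton_self _))
  rw [← length_quotient_smul_eq hW hM' hM'0 hb]
  have hle : M.map π ≤ M'.map π := Submodule.map_mono le_sup_left
  refine (Module.length_le_of_injective (Submodule.inclusion hle)
    (Submodule.inclusion_injective hle)).trans ?_
  let g : M' →ₗ[B] M'.map π := (π.comp M'.subtype).codRestrict _ fun w => ⟨w.1, w.2, rfl⟩
  have hg : Function.Surjective g := by
    rintro ⟨_, w, hw, rfl⟩
    exact ⟨⟨w, hw⟩, rfl⟩
  have hker : LinearMap.range (LinearMap.lsmul B M' b) ≤ LinearMap.ker g := by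
    rintro _ ⟨w, rfl⟩
    refine Subtype.ext ?_
    show Ideal.Quotient.mk (Ideal.span {algebraMap B W b}) (b • w.1) = 0
    rw [Ideal.Quotient.eq_zero_iff_mem, Algebra.smul_def]
    exact Ideal.mul_mem_right _ _ (Ideal.mem_span_singleton_self _)
  refine Module.length_le_of_surjective (Submodule.liftQ _ g hker) fun y => ?_
  obtain ⟨w, rfl⟩ := hg y
  exact ⟨Submodule.Quotient.mk w, rfl⟩

theorem isNoetherian_quotient_span_algebraMap
    (hW : ∀ w : W, ∃ s : B, s ≠ 0 ∧ ∃ x, s • w = algebraMap B W x) {b : B} (hb : b ≠ 0) :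
    IsNoetherian B (W ⧸ Ideal.span {algebraMap B W b}) := by
  have h1 := length_quotient_span_algebraMap_le hW hb
  have h2 := Module.length_ne_top_iff.mpr (isFiniteLength_quotient_span_singleton B
    (mem_nonZeroDivisors_of_ne_zero hb))
  exact (isFiniteLength_iff_isNoetherian_isArtinian.mp
    (Module.length_ne_top_iff.mp (ne_top_of_le_ne_top h2 h1))).1

/-- Krull–Akizuki: every ring between a one-dimensional Noetherian domain and its fraction field is
Noetherian. The hypothesis `hW` says that `W` lies in the fraction field of `B`. -/
theorem isNoetherianRing_of_birational
    (hW : ∀ w : W, ∃ s : B, s ≠ 0 ∧ ∃ x, s • w = algebraMap B W x) : IsNoetherianRing W := by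
  refine ⟨fun a => ?_⟩
  by_cases ha : a = ⊥
  · rw [ha]; exact Submodule.fg_bot
  obtain ⟨w, hw, hw0⟩ := (Submodule.ne_bot_iff a).mp ha
  obtain ⟨s, hs, x, hx⟩ := hW w
  have hinj : Function.Injective (algebraMap B W) := FaithfulSMul.algebraMap_injective B W
  -- a nonzero ideal of `W` contains a nonzero element of `B`
  have hxa : algebraMap B W x ∈ a := by
    rw [← hx, Algebra.smul_def]; exact Ideal.mul_mem_left a _ hw
  have hx0 : x ≠ 0 := by
    rintro rfl
    rw [map_zero, Algebra.smul_def, mul_eq_zero] at hx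
    exact hx.elim (fun h => hs (hinj (h.trans (map_zero _).symm))) hw0
  have hN := isNoetherian_quotient_span_algebraMap hW hx0
  have hN' : IsNoetherian W (W ⧸ Ideal.span {algebraMap B W x}) := isNoetherian_of_tower B hN
  refine Submodule.fg_of_fg_map_of_fg_inf_ker (Submodule.mkQ (Ideal.span {algebraMap B W x}))
    (IsNoetherian.noetherian _) ?_
  rw [Submodule.ker_mkQ, inf_eq_right.mpr]
  · exact Submodule.fg_span_singleton _
  · rwa [Ideal.span_singleton_le_iff_mem]

end Length

/-! ### Expansions in powers of a uniformizer -/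

section Expansion

variable {W : Type} [CommRing W] [Algebra ℂ W]

open Polynomial in
/-- `φ` is the expansion of `w` in powers of `t`: its truncations approximate `w` to all orders. No
topology and no completeness of `W` are involved. -/
def IsExpansion (t w : W) (φ : PowerSeries ℂ) : Prop :=
  ∀ n, t ^ n ∣ w - aeval t (φ.trunc n)

open Polynomial in
theorem pow_dvd_aeval_sub_aeval_trunc (t : W) (p : ℂ[X]) (n : ℕ) :
    t ^ n ∣ aeval t p - aeval t (PowerSeries.trunc n (p : PowerSeries ℂ)) := by
  have h : (X : ℂ[X]) ^ n ∣ p - PowerSeries.trunc n (p : PowerSeries ℂ) := by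
    rw [X_pow_dvd_iff]
    intro d hd
    rw [coeff_sub, PowerSeries.coeff_trunc, if_pos hd, coeff_coe, sub_self]
  obtain ⟨q, hq⟩ := h
  rw [← map_sub, hq, map_mul, map_pow, aeval_X]
  exact dvd_mul_right _ _

open Polynomial in
theorem IsExpansion.add {t w v : W} {φ ψ : PowerSeries ℂ} (hw : IsExpansion t w φ)
    (hv : IsExpansion t v ψ) : IsExpansion t (w + v) (φ + ψ) := by
  intro n
  have := dvd_add (hw n) (hv n)
  rwa [← add_sub_add_comm, ← map_add, ← map_add] at this

open Polynomial in
theorem IsExpansion.mul {t w v : W} {φ ψ : PowerSeries ℂ} (hw : IsExpansion t w φ)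
    (hv : IsExpansion t v ψ) : IsExpansion t (w * v) (φ * ψ) := by
  intro n
  have h1 := pow_dvd_aeval_sub_aeval_trunc t (φ.trunc n * ψ.trunc n) n
  rw [coe_mul, PowerSeries.trunc_trunc_mul_trunc, map_mul] at h1
  have h2 := dvd_add (dvd_add ((hw n).mul_right v) ((hv n).mul_left (aeval t (φ.trunc n)))) h1
  convert h2 using 1
  ring

open Polynomial in
theorem isExpansion_algebraMap (t : W) (c : ℂ) :
    IsExpansion t (algebraMap ℂ W c) (PowerSeries.C c) := by
  intro n
  have := pow_dvd_aeval_sub_aeval_trunc t (C c) n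
  rwa [aeval_C, coe_C] at this

open Polynomial in
theorem isExpansion_self (t : W) : IsExpansion t t PowerSeries.X := by
  intro n
  have := pow_dvd_aeval_sub_aeval_trunc t X n
  rwa [aeval_X, coe_X] at this

open Polynomial in
/-- Expansions are unique: the first coefficient in which they differ would make `t` a unit. -/
theorem IsExpansion.unique [IsDomain W] {t w : W} (ht0 : t ≠ 0) (ht : ¬ IsUnit t) {φ ψ : PowerSeries ℂ}
    (hφ : IsExpansion t w φ) (hψ : IsExpansion t w ψ) : φ = ψ := by
  rw [← sub_eq_zero]
  have h : ∀ n, t ^ n ∣ aeval t ((φ - ψ).trunc n) := by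
    intro n
    have h1 := dvd_sub (hψ n) (hφ n)
    rw [sub_sub_sub_cancel_left, ← map_sub] at h1
    convert h1 using 2
    ext k
    simp only [PowerSeries.coeff_trunc, coeff_sub, map_sub]
  ext n
  induction n using Nat.strong_induction_on with
  | _ n ih =>
    rw [map_zero]
    by_contra hne
    have h1 := h (n + 1)
    have h2 : (φ - ψ).trunc (n + 1) = monomial n (PowerSeries.coeff n (φ - ψ)) := by
      ext k
      rw [PowerSeries.coeff_trunc, coeff_monomial]
      rcases lt_trichotomy k n with hk | rfl | hk
      · rw [ih k hk, map_zero, if_neg hk.ne', ite_self]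
      · simp
      · rw [if_neg (by omega), if_neg hk.ne]
    rw [h2, aeval_monomial, pow_succ', mul_dvd_mul_iff_right (pow_ne_zero _ ht0)] at h1
    exact ht (isUnit_of_dvd_unit h1 ((IsUnit.mk0 _ hne).map (algebraMap ℂ W)))

/-- If every element is congruent to a constant modulo `t`, then every element has an expansion. -/
theorem exists_isExpansion {t : W} (h : ∀ w : W, ∃ c : ℂ, t ∣ w - algebraMap ℂ W c) (w : W) :
    ∃ φ, IsExpansion t w φ := by
  choose c s hs using h
  -- `w = c(w) + t s(w)`, so the coefficients are the constants of the successive remainders `s^[n] w`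
  refine ⟨PowerSeries.mk fun n => c (s^[n] w), fun n => ⟨s^[n] w, ?_⟩⟩
  induction n with
  | zero => simp
  | succ n ih =>
    rw [PowerSeries.trunc_succ, map_add, Polynomial.aeval_monomial, ← sub_sub, ih,
      PowerSeries.coeff_mk, Function.iterate_succ_apply', pow_succ]
    linear_combination t ^ n * hs (s^[n] w)

/-- A discrete valuation ring over `ℂ` with residue field `ℂ` embeds into `ℂ⟦X⟧`. -/
theorem exists_ringHom_powerSeries [IsDomain W] [IsDiscreteValuationRing W]
    (h : ∀ w : W, ∃ c : ℂ, w - algebraMap ℂ W c ∈ IsLocalRing.maximalIdeal W) :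
    ∃ ψ : W →+* PowerSeries ℂ, Function.Injective ψ ∧
      (∀ w ∈ IsLocalRing.maximalIdeal W, PowerSeries.X ∣ ψ w) ∧
      ∀ c, ψ (algebraMap ℂ W c) = PowerSeries.C c := by
  obtain ⟨t, ht⟩ := IsDiscreteValuationRing.exists_irreducible W
  have hm := ht.maximalIdeal_eq
  choose ψ hψ using exists_isExpansion (t := t) (fun w => by
    obtain ⟨c, hc⟩ := h w
    rw [hm, Ideal.mem_span_singleton] at hc
    exact ⟨c, hc⟩)
  have huniq {w : W} {φ : PowerSeries ℂ} (hφ : IsExpansion t w φ) : ψ w = φ :=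
    (hψ w).unique ht.ne_zero ht.not_isUnit hφ
  have hC (c : ℂ) : ψ (algebraMap ℂ W c) = PowerSeries.C c := huniq (isExpansion_algebraMap t c)
  let Ψ : W →+* PowerSeries ℂ :=
    { toFun := ψ
      map_one' := by have := hC 1; rwa [map_one, map_one] at this
      map_zero' := by have := hC 0; rwa [map_zero, map_zero] at this
      map_add' := fun v w => huniq ((hψ v).add (hψ w))
      map_mul' := fun v w => huniq ((hψ v).mul (hψ w)) }
  have hX : Ψ t = PowerSeries.X := huniq (isExpansion_self t)
  refine ⟨Ψ, ?_, ?_, hC⟩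
  · rw [injective_iff_map_eq_zero]
    intro w hw
    by_contra hw0
    obtain ⟨n, u, rfl⟩ := IsDiscreteValuationRing.eq_unit_mul_pow_irreducible hw0 ht
    rw [map_mul, map_pow, hX, mul_eq_zero] at hw
    exact hw.elim (u.isUnit.map Ψ).ne_zero (pow_ne_zero _ PowerSeries.X_ne_zero)
  · intro w hw
    rw [hm, Ideal.mem_span_singleton] at hw
    rw [← hX]
    exact map_dvd Ψ hw

end Expansion

/-! ### Arcs on curve germs -/

section CurveAlgebra

open IsLocalRing

variable {B : Type} [CommRing B] [IsDomain B] [IsNoetherianRing B] [Ring.KrullDimLE 1 B]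
  [IsLocalRing B] [Algebra ℂ B]

/-- A valuation ring that dominates a one-dimensional local domain `B` with residue field `ℂ`, and
has the same fraction field, is a discrete valuation ring with residue field `ℂ`; so it embeds
into `ℂ⟦X⟧`. -/
theorem exists_ringHom_powerSeries_of_dominates {W : Type} [CommRing W] [IsDomain W] [Algebra B W]
    [FaithfulSMul B W] [ValuationRing W]
    (hB : ∀ b : B, ∃ c : ℂ, b - algebraMap ℂ B c ∈ maximalIdeal B)
    (hW : ∀ w : W, ∃ s : B, s ≠ 0 ∧ ∃ x, s • w = algebraMap B W x)
    (hdom : ∀ b ∈ maximalIdeal B, algebraMap B W b ∈ maximalIdeal W)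
    {b : B} (hbm : b ∈ maximalIdeal B) (hb : b ≠ 0) :
    ∃ ψ : W →+* PowerSeries ℂ, Function.Injective ψ ∧
      (∀ w ∈ maximalIdeal W, PowerSeries.X ∣ ψ w) ∧
      ∀ c, ψ (algebraMap B W (algebraMap ℂ B c)) = PowerSeries.C c := by
  have hinj : Function.Injective (algebraMap B W) := FaithfulSMul.algebraMap_injective B W
  have hN : IsNoetherianRing W := isNoetherianRing_of_birational hW
  have hfield : ¬ IsField W := by
    intro hF
    have hbW := hdom b hbm
    rw [(isField_iff_maximalIdeal_eq.mp hF), Ideal.mem_bot] at hbW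
    exact hb (hinj (hbW.trans (map_zero _).symm))
  have hdvr : IsDiscreteValuationRing W :=
    ((IsDiscreteValuationRing.TFAE W hfield).out 0 1 :
      IsDiscreteValuationRing W ↔ ValuationRing W).mpr inferInstance
  let _ : Algebra ℂ W := ((algebraMap B W).comp (algebraMap ℂ B)).toAlgebra
  have halg : ∀ c : ℂ, algebraMap ℂ W c = algebraMap B W (algebraMap ℂ B c) := fun _ => rfl
  have hQ := isNoetherian_quotient_span_algebraMap hW hb
  -- the residue field of `W` is a finite `B`-module on which `B` acts through `ℂ`
  have hκ : Module.Finite B (W ⧸ maximalIdeal W) := by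
    have hle : Ideal.span {algebraMap B W b} ≤ maximalIdeal W := by
      rw [Ideal.span_singleton_le_iff_mem]; exact hdom b hbm
    exact Module.Finite.of_surjective (Ideal.Quotient.factorₐ B hle).toLinearMap
      (Ideal.Quotient.factor_surjective hle)
  let _ : Field (W ⧸ maximalIdeal W) := Ideal.Quotient.field _
  have hact : ∀ (b : B) (k : W ⧸ maximalIdeal W), ∃ c : ℂ, b • k = c • k := by
    intro b k
    obtain ⟨c, hc⟩ := hB b
    obtain ⟨k, rfl⟩ := Ideal.Quotient.mk_surjective k
    refine ⟨c, ?_⟩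
    show Ideal.Quotient.mk _ (b • k) = Ideal.Quotient.mk _ (c • k)
    rw [Ideal.Quotient.eq, Algebra.smul_def, Algebra.smul_def, halg, ← sub_mul, ← map_sub]
    exact Ideal.mul_mem_right _ _ (hdom _ hc)
  have hκC : Module.Finite ℂ (W ⧸ maximalIdeal W) := by
    obtain ⟨S, hS⟩ := hκ.1
    refine ⟨⟨S, eq_top_iff.mpr fun k _ => ?_⟩⟩
    have hk : k ∈ Submodule.span B (S : Set (W ⧸ maximalIdeal W)) := hS ▸ Submodule.mem_top
    induction hk using Submodule.span_induction with
    | mem x hx => exact Submodule.subset_span hx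
    | zero => exact zero_mem _
    | add x y _ _ hx hy => exact add_mem (hx trivial) (hy trivial)
    | smul b x _ hx =>
      obtain ⟨c, hc⟩ := hact b x
      rw [hc]
      exact Submodule.smul_mem _ _ (hx trivial)
  have hsurj := (IsAlgClosed.algebraMap_bijective_of_isIntegral (k := ℂ)
    (K := W ⧸ maximalIdeal W)).2
  exact exists_ringHom_powerSeries fun w => by
    obtain ⟨c, hc⟩ := hsurj (Ideal.Quotient.mk _ w)
    exact ⟨c, (Ideal.Quotient.eq).mp hc.symm⟩

/-- A valuation ring of the fraction field of `B`, other than the whole field, that contains `B`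
gives an arc: a local embedding of `B` into `ℂ⟦X⟧` that extends to the valuation ring. -/
theorem exists_arc_of_valuationSubring (hB : ∀ b : B, ∃ c : ℂ, b - algebraMap ℂ B c ∈ maximalIdeal B)
    (V : ValuationSubring (FractionRing B)) (hBV : ∀ b, algebraMap B (FractionRing B) b ∈ V)
    (hV : V ≠ ⊤) :
    ∃ ψ : V →+* PowerSeries ℂ, Function.Injective ψ ∧
      (∀ w ∈ maximalIdeal V, PowerSeries.X ∣ ψ w) ∧
      (∀ b ∈ maximalIdeal B, PowerSeries.X ∣ ψ ⟨_, hBV b⟩) ∧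
      ∀ c, ψ ⟨_, hBV (algebraMap ℂ B c)⟩ = PowerSeries.C c := by
  let ι : B →+* V := (algebraMap B (FractionRing B)).codRestrict V.toSubring hBV
  let _ : Algebra B V := ι.toAlgebra
  have hι : ∀ b, ((algebraMap B V b : V) : FractionRing B) = algebraMap B (FractionRing B) b :=
    fun _ => rfl
  have hKinj : Function.Injective (algebraMap B (FractionRing B)) :=
    IsFractionRing.injective B (FractionRing B)
  have hfaith : FaithfulSMul B V := (faithfulSMul_iff_algebraMap_injective B V).mpr
    fun a b hab => hKinj congr(($hab : FractionRing B))
  have hfrac : ∀ k : FractionRing B, ∃ s : B, s ≠ 0 ∧ ∃ x,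
      algebraMap B (FractionRing B) s * k = algebraMap B (FractionRing B) x := by
    intro k
    obtain ⟨x, s, hs, rfl⟩ := IsFractionRing.div_surjective (A := B) k
    refine ⟨s, nonZeroDivisors.ne_zero hs, x, ?_⟩
    rw [mul_div_cancel₀]
    exact fun h => nonZeroDivisors.ne_zero hs (hKinj (h.trans (map_zero _).symm))
  have hW : ∀ w : V, ∃ s : B, s ≠ 0 ∧ ∃ x, s • w = algebraMap B V x := by
    intro w
    obtain ⟨s, hs, x, hx⟩ := hfrac w
    exact ⟨s, hs, x, Subtype.ext (by rw [Algebra.smul_def]; exact hx)⟩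
  -- the centre of `V` on `B` is not zero, since `V` is not the whole field; so it is maximal
  let P : Ideal B := (maximalIdeal V).comap (algebraMap B V)
  have hP : P ≠ ⊥ := by
    intro hP
    refine hV (eq_top_iff.mpr fun k _ => ?_)
    obtain ⟨s, hs, x, hx⟩ := hfrac k
    have hsu : IsUnit (algebraMap B V s) := by
      by_contra hu
      have hsP : s ∈ P := hu
      rw [hP, Ideal.mem_bot] at hsP
      exact hs hsP
    obtain ⟨u, hu⟩ := hsu
    have hk : k = ((u⁻¹.1 * algebraMap B V x : V) : FractionRing B) := by
      have h1 : ((u⁻¹.1 * u.1 : V) : FractionRing B) = 1 := by rw [Units.inv_mul]; rfl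
      rw [hu] at h1
      have h2 : ((u⁻¹.1 * algebraMap B V s : V) : FractionRing B) =
        u⁻¹.1 * algebraMap B (FractionRing B) s := rfl
      show k = u⁻¹.1 * algebraMap B (FractionRing B) x
      rw [← hx, ← mul_assoc, ← h2, h1, one_mul]
    rw [hk]
    exact Subtype.property _
  have hPmax : P = maximalIdeal B :=
    IsLocalRing.eq_maximalIdeal (Ideal.IsPrime.isMaximal_of_ne_bot inferInstance hP)
  have hdom : ∀ b ∈ maximalIdeal B, algebraMap B V b ∈ maximalIdeal V := by
    intro b hb
    rw [← hPmax] at hb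
    exact hb
  obtain ⟨b, hbP, hb0⟩ := (Submodule.ne_bot_iff P).mp hP
  obtain ⟨ψ, h1, h2, h3⟩ := exists_ringHom_powerSeries_of_dominates hB hW hdom (hPmax ▸ hbP) hb0
  exact ⟨ψ, h1, h2, fun b hb => h2 _ (hdom b hb), h3⟩

/-- An arc on `B`: a local embedding over `ℂ` into the ring of formal power series. -/
structure IsArc (ψ : B →+* PowerSeries ℂ) : Prop where
  injective : Function.Injective ψ
  X_dvd : ∀ b ∈ maximalIdeal B, PowerSeries.X ∣ ψ b
  algebraMap : ∀ c, ψ (algebraMap ℂ B c) = PowerSeries.C c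

omit [IsNoetherianRing B] [Ring.KrullDimLE 1 B] [IsLocalRing B] [Algebra ℂ B] in
/-- The integral closure of `B` is the intersection of the valuation rings that contain it. -/
theorem exists_valuationSubring_of_not_isIntegral {u : FractionRing B} (hu : ¬ IsIntegral B u) :
    ∃ V : ValuationSubring (FractionRing B), (∀ b, algebraMap B (FractionRing B) b ∈ V) ∧ u ∉ V := by
  let R : Subring (FractionRing B) := (integralClosure B (FractionRing B)).toSubring
  have : IsIntegrallyClosedIn R (FractionRing B) :=
    inferInstanceAs (IsIntegrallyClosedIn (integralClosure B (FractionRing B)) (FractionRing B))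
  obtain ⟨V, hRV, hV⟩ := R.exists_le_valuationSubring_of_isIntegrallyClosedIn (x := u) hu
  exact ⟨V, fun b => hRV (isIntegral_algebraMap (x := b)), hV⟩

/-- A one-dimensional local domain with residue field `ℂ` has an arc: a valuation ring dominating it
is found by the non-integrality of the inverse of a non-unit. -/
theorem exists_isArc (hB : ∀ b : B, ∃ c : ℂ, b - algebraMap ℂ B c ∈ maximalIdeal B)
    (hf : ¬ IsField B) : ∃ ψ : B →+* PowerSeries ℂ, IsArc ψ := by
  obtain ⟨b, hb, hb0⟩ := (Submodule.ne_bot_iff _).mp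
    (fun h => hf (IsLocalRing.isField_iff_maximalIdeal_eq.mpr h))
  have hKinj : Function.Injective (algebraMap B (FractionRing B)) :=
    IsFractionRing.injective B (FractionRing B)
  have hb0' : algebraMap B (FractionRing B) b ≠ 0 := fun h =>
    hb0 (hKinj (h.trans (map_zero _).symm))
  obtain ⟨V, hBV, hV⟩ := exists_valuationSubring_of_not_isIntegral
    (u := (algebraMap B (FractionRing B) b)⁻¹) (by
      -- Nakayama's lemma for the finite module `B[b⁻¹]`, on which `b` acts invertibly
      intro hint
      have hfg := hint.fg_adjoin_singleton
      set A := Algebra.adjoin B {(algebraMap B (FractionRing B) b)⁻¹} with hA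
      have hbot := Submodule.eq_bot_of_le_smul_of_le_jacobson_bot (maximalIdeal B)
        (Subalgebra.toSubmodule A) hfg (fun x hx => by
          have h1 : x = b • ((algebraMap B (FractionRing B) b)⁻¹ * x) := by
            rw [Algebra.smul_def, mul_inv_cancel_left₀ hb0']
          rw [h1]
          exact Submodule.smul_mem_smul hb
            (A.mul_mem (Algebra.subset_adjoin (Set.mem_singleton _)) hx))
        (IsLocalRing.maximalIdeal_le_jacobson _)
      refine one_ne_zero (α := FractionRing B) ?_
      rw [← Submodule.mem_bot B, ← hbot]
      exact A.one_mem)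
  obtain ⟨ψ, h1, h2, h3, h4⟩ := exists_arc_of_valuationSubring hB V hBV (by rintro rfl; exact hV trivial)
  exact ⟨ψ.comp ((algebraMap B (FractionRing B)).codRestrict V.toSubring hBV),
    fun x y hxy => hKinj congr(($(h1 hxy) : FractionRing B)), h3, h4⟩

/-- If `f` and `g` have the same order along each arc, then `f/g` is integral over `B`. -/
theorem isIntegral_div_of_order_eq (hB : ∀ b : B, ∃ c : ℂ, b - algebraMap ℂ B c ∈ maximalIdeal B)
    {f g : B} (hf : f ≠ 0)
    (h : ∀ ψ : B →+* PowerSeries ℂ, IsArc ψ → (ψ f).order = (ψ g).order) :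
    IsIntegral B (algebraMap B (FractionRing B) f / algebraMap B (FractionRing B) g) := by
  have hKinj : Function.Injective (algebraMap B (FractionRing B)) :=
    IsFractionRing.injective B (FractionRing B)
  have hne : ∀ {b : B}, b ≠ 0 → algebraMap B (FractionRing B) b ≠ 0 := fun hb0 h =>
    hb0 (hKinj (h.trans (map_zero _).symm))
  by_contra hint
  obtain ⟨V, hBV, hV⟩ := exists_valuationSubring_of_not_isIntegral hint
  obtain ⟨ψ, h1, h2, h3, h4⟩ := exists_arc_of_valuationSubring hB V hBV (by rintro rfl; exact hV trivial)
  let ι : B →+* V := (algebraMap B (FractionRing B)).codRestrict V.toSubring hBV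
  have harc : IsArc (ψ.comp ι) :=
    ⟨fun x y hxy => hKinj congr(($(h1 hxy) : FractionRing B)), h3, h4⟩
  have hord := h _ harc
  -- `g/f` is a non-unit of `V`, so `g` vanishes to higher order than `f`
  have hv := (V.mem_or_inv_mem _).resolve_left hV
  rw [inv_div] at hv
  let v : V := ⟨_, hv⟩
  have hvm : v ∈ maximalIdeal V := by
    rw [IsLocalRing.mem_maximalIdeal, mem_nonunits_iff]
    rintro ⟨w, hw⟩
    refine hV ?_
    have h1 : ((w⁻¹.1 * w.1 : V) : FractionRing B) = 1 := by rw [Units.inv_mul]; rfl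
    have h2 : ((w⁻¹.1 * w.1 : V) : FractionRing B) = w⁻¹.1 *
      (algebraMap B (FractionRing B) g / algebraMap B (FractionRing B) f) := by rw [hw]; rfl
    rw [← inv_div, ← eq_inv_of_mul_eq_one_left (h2.symm.trans h1)]
    exact Subtype.property _
  have hgf : ι g = v * ι f := Subtype.ext (by
    show algebraMap B (FractionRing B) g = algebraMap B (FractionRing B) g /
      algebraMap B (FractionRing B) f * algebraMap B (FractionRing B) f
    rw [div_mul_cancel₀ _ (hne hf)])
  have hg' : (ψ.comp ι) g = ψ v * (ψ.comp ι) f := by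
    rw [RingHom.comp_apply, RingHom.comp_apply, hgf, map_mul]
  rw [hg', PowerSeries.order_mul] at hord
  have hfin : ((ψ.comp ι) f).order ≠ ⊤ := by
    rw [Ne, PowerSeries.order_eq_top]
    exact fun h0 => hf (harc.injective (h0.trans (map_zero _).symm))
  have hpos : 1 ≤ (ψ v).order := by
    obtain ⟨φ, hφ⟩ := h2 v hvm
    rw [hφ, PowerSeries.order_mul, PowerSeries.order_X]
    exact le_self_add
  lift ((ψ.comp ι) f).order to ℕ using hfin with a ha
  have : 1 + (a : ℕ∞) ≤ a := by
    conv_rhs => rw [hord]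
    gcongr
  norm_cast at this
  omega

/-- Two functions on a curve germ with the same order along each arc have the same intersection
number with the curve. -/
theorem length_quotient_eq_of_order_eq
    (hB : ∀ b : B, ∃ c : ℂ, b - algebraMap ℂ B c ∈ maximalIdeal B)
    {f g : B} (hf : f ≠ 0) (hg : g ≠ 0)
    (h : ∀ ψ : B →+* PowerSeries ℂ, IsArc ψ → (ψ f).order = (ψ g).order) :
    Module.length B (B ⧸ Ideal.span {f}) = Module.length B (B ⧸ Ideal.span {g}) := by
  let K := FractionRing B
  have hKinj : Function.Injective (algebraMap B K) := IsFractionRing.injective B K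
  have hne : ∀ {b : B}, b ≠ 0 → algebraMap B K b ≠ 0 := fun hb0 h =>
    hb0 (hKinj (h.trans (map_zero _).symm))
  have h1 := isIntegral_div_of_order_eq hB hf h
  have h2 := isIntegral_div_of_order_eq hB hg fun ψ hψ => (h ψ hψ).symm
  have hfrac : ∀ k : K, ∃ s : B, s ≠ 0 ∧ ∃ x, s • k = algebraMap B K x := by
    intro k
    obtain ⟨x, s, hs, rfl⟩ := IsFractionRing.div_surjective (A := B) k
    refine ⟨s, nonZeroDivisors.ne_zero hs, x, ?_⟩
    rw [Algebra.smul_def, mul_div_cancel₀]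
    exact hne (nonZeroDivisors.ne_zero hs)
  set u : K := algebraMap B K f / algebraMap B K g
  set v : K := algebraMap B K g / algebraMap B K f
  -- on the finite `B`-module `B[u, u⁻¹]`, multiplication by `f` and by `g` have the same image
  let A := Algebra.adjoin B ({u, v} : Set K)
  have hu : u ∈ A := Algebra.subset_adjoin (by simp)
  have hv : v ∈ A := Algebra.subset_adjoin (by simp)
  let M : Submodule B K := Subalgebra.toSubmodule A
  have hM : M.FG := fg_adjoin_of_finite (by simp) (by rintro x (rfl | rfl) <;> assumption)
  have hM0 : M ≠ ⊥ := fun h0 => one_ne_zero (α := K) (by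
    rw [← Submodule.mem_bot B, ← h0]; exact A.one_mem)
  have key : ∀ (a b : B) (w : K), w ∈ A → algebraMap B K a = algebraMap B K b * w →
      LinearMap.range (LinearMap.lsmul B M a) ≤ LinearMap.range (LinearMap.lsmul B M b) := by
    rintro a b w hw hab _ ⟨m, rfl⟩
    refine ⟨⟨w * m.1, A.mul_mem hw m.2⟩, Subtype.ext ?_⟩
    show b • (w * m.1) = a • m.1
    rw [Algebra.smul_def, Algebra.smul_def, hab, mul_assoc]
  have hrange : LinearMap.range (LinearMap.lsmul B M f) =
      LinearMap.range (LinearMap.lsmul B M g) :=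
    le_antisymm (key f g u hu (mul_div_cancel₀ _ (hne hg)).symm)
      (key g f v hv (mul_div_cancel₀ _ (hne hf)).symm)
  rw [← length_quotient_smul_eq hfrac hM hM0 hf, ← length_quotient_smul_eq hfrac hM hM0 hg, hrange]

end CurveAlgebra

/-! ### Convergent power series -/

section Convergent

open scoped NNReal ENNReal

variable {m : ℕ}

/-- The monomial `z^α`. -/
def monom {M : Type*} [CommMonoid M] (z : Fin m → M) (α : Fin m →₀ ℕ) : M := ∏ i, z i ^ α i

theorem monom_add {M : Type*} [CommMonoid M] (z : Fin m → M) (α β : Fin m →₀ ℕ) :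
    monom z (α + β) = monom z α * monom z β := by
  simp only [monom, Finsupp.add_apply, pow_add, Finset.prod_mul_distrib]

theorem monom_single {M : Type*} [CommMonoid M] (z : Fin m → M) (i : Fin m) (k : ℕ) :
    monom z (Finsupp.single i k) = z i ^ k := by
  rw [monom, Finset.prod_eq_single i]
  · simp
  · intro j _ hj; rw [Finsupp.single_eq_of_ne hj, pow_zero]
  · simp

theorem monom_pos {r : Fin m → ℝ≥0} (hr : ∀ i, 0 < r i) (α : Fin m →₀ ℕ) : 0 < monom r α :=
  Finset.prod_pos fun i _ => pow_pos (hr i) _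

theorem monom_mono {r s : Fin m → ℝ≥0} (h : r ≤ s) (α : Fin m →₀ ℕ) : monom r α ≤ monom s α :=
  Finset.prod_le_prod' fun i _ => pow_le_pow_left' (h i) _

theorem nnnorm_monom (z : Fin m → ℂ) (α : Fin m →₀ ℕ) :
    ‖monom z α‖₊ = monom (fun i => ‖z i‖₊) α := by
  simp [monom]

/-- The weighted `ℓ¹` norm `∑ |a_α| r^α` of the power series `∑ a_α z^α`, possibly infinite. -/
noncomputable def weightedNorm (r : Fin m → ℝ≥0) (φ : MvPowerSeries (Fin m) ℂ) : ℝ≥0∞ :=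
  ∑' α, ((‖MvPowerSeries.coeff α φ‖₊ * monom r α : ℝ≥0) : ℝ≥0∞)

theorem weightedNorm_mono {r s : Fin m → ℝ≥0} (h : r ≤ s) (φ : MvPowerSeries (Fin m) ℂ) :
    weightedNorm r φ ≤ weightedNorm s φ :=
  ENNReal.tsum_le_tsum fun α => by
    have := monom_mono h α
    gcongr

theorem weightedNorm_add_le (r : Fin m → ℝ≥0) (φ ψ : MvPowerSeries (Fin m) ℂ) :
    weightedNorm r (φ + ψ) ≤ weightedNorm r φ + weightedNorm r ψ := by
  rw [weightedNorm, weightedNorm, weightedNorm, ← ENNReal.tsum_add]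
  refine ENNReal.tsum_le_tsum fun α => ?_
  rw [← ENNReal.coe_add, ← add_mul, map_add]
  have := nnnorm_add_le (MvPowerSeries.coeff α φ) (MvPowerSeries.coeff α ψ)
  gcongr

theorem weightedNorm_neg (r : Fin m → ℝ≥0) (φ : MvPowerSeries (Fin m) ℂ) :
    weightedNorm r (-φ) = weightedNorm r φ := by
  simp [weightedNorm]

/-- The weighted norm is submultiplicative, being an `ℓ¹` norm for a convolution product. -/
theorem weightedNorm_mul_le (r : Fin m → ℝ≥0) (φ ψ : MvPowerSeries (Fin m) ℂ) :
    weightedNorm r (φ * ψ) ≤ weightedNorm r φ * weightedNorm r ψ := by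
  classical
  have h1 : weightedNorm r φ * weightedNorm r ψ = ∑' p : (Fin m →₀ ℕ) × (Fin m →₀ ℕ),
      ((‖MvPowerSeries.coeff p.1 φ‖₊ * monom r p.1 : ℝ≥0) : ℝ≥0∞) *
      ((‖MvPowerSeries.coeff p.2 ψ‖₊ * monom r p.2 : ℝ≥0) : ℝ≥0∞) := by
    rw [ENNReal.tsum_prod', weightedNorm, weightedNorm, ← ENNReal.tsum_mul_right]
    exact tsum_congr fun α => ENNReal.tsum_mul_left.symm
  rw [h1, ← (Finset.HasAntidiagonal.sigmaAntidiagonalEquivProd (A := Fin m →₀ ℕ)).tsum_eq, ENNReal.tsum_sigma']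
  refine ENNReal.tsum_le_tsum fun α => ?_
  rw [tsum_fintype, Finset.univ_eq_attach]
  refine le_trans ?_ (Finset.sum_attach (Finset.HasAntidiagonal.antidiagonal α) (fun p =>
    ((‖MvPowerSeries.coeff p.1 φ‖₊ * monom r p.1 : ℝ≥0) : ℝ≥0∞) *
      ((‖MvPowerSeries.coeff p.2 ψ‖₊ * monom r p.2 : ℝ≥0) : ℝ≥0∞))).ge
  norm_cast
  rw [MvPowerSeries.coeff_mul]
  refine (mul_le_mul_left (nnnorm_sum_le _ _) _).trans ?_
  rw [Finset.sum_mul]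
  refine Finset.sum_le_sum fun p hp => ?_
  rw [← Finset.HasAntidiagonal.mem_antidiagonal.mp hp, monom_add, nnnorm_mul]
  exact (by ring : _ = _).le

theorem summable_norm_of_weightedNorm {r : Fin m → ℝ≥0} {φ : MvPowerSeries (Fin m) ℂ}
    (h : weightedNorm r φ ≠ ⊤) {z : Fin m → ℂ} (hz : ∀ i, ‖z i‖₊ ≤ r i) :
    Summable fun α => ‖MvPowerSeries.coeff α φ * monom z α‖ := by
  have h1 := ENNReal.tsum_coe_ne_top_iff_summable.mp h
  have h2 : Summable fun α => ‖MvPowerSeries.coeff α φ * monom z α‖₊ := by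
    refine NNReal.summable_of_le (fun α => ?_) h1
    rw [nnnorm_mul, nnnorm_monom]
    have := monom_mono (r := fun i => ‖z i‖₊) (s := r) hz α
    gcongr
  exact NNReal.summable_coe.mpr h2

/-- `φ` is the Taylor series of `f` at the origin: it converges absolutely on some polydisc, with
sum `f` near the origin. -/
def HasTaylor (φ : MvPowerSeries (Fin m) ℂ) (f : (Fin m → ℂ) → ℂ) : Prop :=
  (∃ r : ℝ≥0, 0 < r ∧ weightedNorm (fun _ => r) φ ≠ ⊤) ∧
    ∀ᶠ z in 𝓝 0, f z = ∑' α, MvPowerSeries.coeff α φ * monom z α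

theorem eventually_nnnorm_le {r : ℝ≥0} (hr : 0 < r) :
    ∀ᶠ z : Fin m → ℂ in 𝓝 0, ∀ i, ‖z i‖₊ ≤ r := by
  filter_upwards [Metric.ball_mem_nhds (0 : Fin m → ℂ) (NNReal.coe_pos.mpr hr)] with z hz i
  rw [mem_ball_zero_iff] at hz
  exact (nnnorm_le_pi_nnnorm z i).trans (NNReal.coe_le_coe.mp hz.le)

theorem HasTaylor.eventually_hasSum {φ : MvPowerSeries (Fin m) ℂ} {f : (Fin m → ℂ) → ℂ}
    (h : HasTaylor φ f) :
    ∀ᶠ z in 𝓝 0, HasSum (fun α => MvPowerSeries.coeff α φ * monom z α) (f z) ∧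
      Summable fun α => ‖MvPowerSeries.coeff α φ * monom z α‖ := by
  obtain ⟨⟨r, hr, hφ⟩, hf⟩ := h
  filter_upwards [hf, eventually_nnnorm_le hr] with z hz hzr
  have hs := summable_norm_of_weightedNorm hφ hzr
  exact ⟨hz ▸ hs.of_norm.hasSum, hs⟩

theorem HasTaylor.add {φ ψ : MvPowerSeries (Fin m) ℂ} {f g : (Fin m → ℂ) → ℂ}
    (hf : HasTaylor φ f) (hg : HasTaylor ψ g) : HasTaylor (φ + ψ) (f + g) := by
  refine ⟨?_, ?_⟩
  · obtain ⟨r, hr, hφ⟩ := hf.1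
    obtain ⟨s, hs, hψ⟩ := hg.1
    refine ⟨min r s, lt_min hr hs, ne_top_of_le_ne_top ?_ (weightedNorm_add_le _ _ _)⟩
    exact ENNReal.add_ne_top.mpr
      ⟨ne_top_of_le_ne_top hφ (weightedNorm_mono (fun _ => min_le_left _ _) _),
      ne_top_of_le_ne_top hψ (weightedNorm_mono (fun _ => min_le_right _ _) _)⟩
  · filter_upwards [hf.eventually_hasSum, hg.eventually_hasSum] with z h1 h2
    rw [Pi.add_apply, ← (h1.1.add h2.1).tsum_eq]
    exact tsum_congr fun α => by rw [map_add, add_mul]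

theorem HasTaylor.mul {φ ψ : MvPowerSeries (Fin m) ℂ} {f g : (Fin m → ℂ) → ℂ}
    (hf : HasTaylor φ f) (hg : HasTaylor ψ g) : HasTaylor (φ * ψ) (f * g) := by
  classical
  refine ⟨?_, ?_⟩
  · obtain ⟨r, hr, hφ⟩ := hf.1
    obtain ⟨s, hs, hψ⟩ := hg.1
    refine ⟨min r s, lt_min hr hs, ne_top_of_le_ne_top ?_ (weightedNorm_mul_le _ _ _)⟩
    exact ENNReal.mul_ne_top
      (ne_top_of_le_ne_top hφ (weightedNorm_mono (fun _ => min_le_left _ _) _))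
      (ne_top_of_le_ne_top hψ (weightedNorm_mono (fun _ => min_le_right _ _) _))
  · filter_upwards [hf.eventually_hasSum, hg.eventually_hasSum] with z h1 h2
    have h3 := summable_mul_of_summable_norm h1.2 h2.2
    rw [Pi.mul_apply, ← h1.1.tsum_eq, ← h2.1.tsum_eq,
      h1.1.summable.tsum_mul_tsum_eq_tsum_sum_antidiagonal h2.1.summable h3]
    refine tsum_congr fun α => ?_
    rw [MvPowerSeries.coeff_mul, Finset.sum_mul]
    refine Finset.sum_congr rfl fun p hp => ?_
    rw [← Finset.HasAntidiagonal.mem_antidiagonal.mp hp, monom_add]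
    ring

end Convergent

/-! ### Analytic functions and their Taylor series -/

section Taylor

open scoped NNReal ENNReal

variable {m : ℕ}

/-- Each monomial of degree `k` is the diagonal of a `k`-linear form of norm at most one. -/
theorem exists_multilinear_monom (k : ℕ) (α : Fin m →₀ ℕ) (hα : α.degree = k) :
    ∃ M : ContinuousMultilinearMap ℂ (fun _ : Fin k => Fin m → ℂ) ℂ, ‖M‖ ≤ 1 ∧
      ∀ z : Fin m → ℂ, M (fun _ => z) = monom z α := by
  -- a monomial of degree `k` is a product of `k` coordinates, the letters of a word
  obtain ⟨c, hc⟩ : ∃ c : Fin k → Fin m, ∀ z : Fin m → ℂ, ∏ j, z (c j) = monom z α := by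
    induction k generalizing α with
    | zero =>
      rw [Finsupp.degree_eq_zero_iff] at hα
      subst hα
      exact ⟨Fin.elim0, fun z => by simp [monom]⟩
    | succ k ih =>
      obtain ⟨i, hi⟩ : ∃ i, α i ≠ 0 := by
        by_contra! h
        have : α = 0 := Finsupp.ext h
        rw [this, map_zero] at hα
        omega
      have hle : Finsupp.single i 1 ≤ α := by
        rw [Finsupp.single_le_iff]; omega
      obtain ⟨β, rfl⟩ := exists_add_of_le hle
      have hβ : β.degree = k := by
        rw [map_add, Finsupp.degree_single] at hα; omega
      obtain ⟨c, hc⟩ := ih β hβ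
      refine ⟨Fin.cons i c, fun z => ?_⟩
      rw [Fin.prod_univ_succ, monom_add, monom_single, pow_one, ← hc]
      simp
  refine ⟨(ContinuousMultilinearMap.mkPiAlgebraFin ℂ k ℂ).compContinuousLinearMap
    fun j => ContinuousLinearMap.proj (c j), ?_, fun z => ?_⟩
  · refine (ContinuousMultilinearMap.norm_compContinuousLinearMap_le _ _).trans ?_
    rw [ContinuousMultilinearMap.norm_mkPiAlgebraFin, one_mul]
    refine Finset.prod_le_one (fun _ _ => norm_nonneg _) fun j _ => ?_
    refine ContinuousLinearMap.opNorm_le_bound _ zero_le_one fun z => ?_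
    rw [one_mul]
    exact norm_le_pi_norm z (c j)
  · rw [← hc z]
    simp [ContinuousMultilinearMap.compContinuousLinearMap_apply, List.prod_ofFn]

theorem mem_finsuppAntidiag_univ {k : ℕ} {α : Fin m →₀ ℕ} :
    α ∈ Finset.univ.finsuppAntidiag k ↔ α.degree = k := by
  simp [Finset.mem_finsuppAntidiag, Finsupp.degree_eq_sum]

/-- A convergent sum over multi-indices may be grouped by degree. -/
theorem hasSum_degree {F : (Fin m →₀ ℕ) → ℂ} {a : ℂ} (h : HasSum F a) :
    HasSum (fun k : ℕ => ∑ α ∈ Finset.univ.finsuppAntidiag k, F α) a := by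
  rw [← (Equiv.sigmaFiberEquiv fun α : Fin m →₀ ℕ => α.degree).hasSum_iff] at h
  refine h.sigma fun k => ?_
  let e : (Finset.univ.finsuppAntidiag k : Finset (Fin m →₀ ℕ)) ≃ {α : Fin m →₀ ℕ // α.degree = k} :=
    Equiv.subtypeEquivRight fun _ => mem_finsuppAntidiag_univ
  rw [← e.hasSum_iff]
  exact Finset.hasSum _ F

/-- A convergent power series is analytic. -/
theorem HasTaylor.analyticAt {φ : MvPowerSeries (Fin m) ℂ} {f : (Fin m → ℂ) → ℂ}
    (h : HasTaylor φ f) : AnalyticAt ℂ f 0 := by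
  classical
  obtain ⟨⟨r, hr, hφ⟩, hf⟩ := h
  refine AnalyticAt.congr ?_ (hf.mono fun z hz => hz.symm)
  choose M hM1 hM using fun (k : ℕ) (α : Fin m →₀ ℕ) (hα : α.degree = k) =>
    exists_multilinear_monom k α hα
  have hsum := ENNReal.tsum_coe_ne_top_iff_summable.mp hφ
  have hsum' : Summable fun α => ‖MvPowerSeries.coeff α φ‖ * (r : ℝ) ^ α.degree := by
    have := NNReal.summable_coe.mpr hsum
    convert this using 2 with α
    rw [NNReal.coe_mul, coe_nnnorm, monom, Finset.prod_pow_eq_pow_sum, NNReal.coe_pow,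
      Finsupp.degree_eq_sum]
  let S : ℕ → Finset (Fin m →₀ ℕ) := fun k => Finset.univ.finsuppAntidiag k
  have hS : ∀ k α, α ∈ S k ↔ α.degree = k := fun k α => mem_finsuppAntidiag_univ
  -- the homogeneous parts of `φ` form a power series in the sense of `HasFPowerSeriesOnBall`
  let p : FormalMultilinearSeries ℂ (Fin m → ℂ) ℂ := fun k =>
    ∑ α ∈ (S k).attach, MvPowerSeries.coeff α.1 φ • M k α.1 ((hS k α.1).mp α.2)
  have hp : ∀ k z, p k (fun _ => z) = ∑ α ∈ S k, MvPowerSeries.coeff α φ * monom z α := by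
    intro k z
    rw [← Finset.sum_attach]
    simp only [p, sum_apply, smul_apply, hM,
      smul_eq_mul]
  refine ⟨p, r, ?_, by exact_mod_cast hr, ?_⟩
  · refine p.le_radius_of_bound (∑' α, ‖MvPowerSeries.coeff α φ‖ * (r : ℝ) ^ α.degree) fun k => ?_
    calc ‖p k‖ * (r : ℝ) ^ k ≤ (∑ α ∈ S k, ‖MvPowerSeries.coeff α φ‖) * (r : ℝ) ^ k := by
          gcongr
          rw [← Finset.sum_attach]
          refine (norm_sum_le _ _).trans (Finset.sum_le_sum fun α _ => ?_)
          rw [norm_smul]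
          exact mul_le_of_le_one_right (norm_nonneg _) (hM1 _ _ _)
      _ = ∑ α ∈ S k, ‖MvPowerSeries.coeff α φ‖ * (r : ℝ) ^ α.degree := by
          rw [Finset.sum_mul]
          exact Finset.sum_congr rfl fun α hα => by rw [(hS k α).mp hα]
      _ ≤ _ := hsum'.sum_le_tsum _ fun _ _ => by positivity
  · intro z hz
    rw [zero_add]
    have hz' : ∀ i, ‖z i‖₊ ≤ r := by
      rw [Metric.mem_eball, edist_zero_right, enorm_eq_nnnorm] at hz
      exact fun i => (nnnorm_le_pi_nnnorm z i).trans (by exact_mod_cast hz.le)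
    have hs := (summable_norm_of_weightedNorm hφ hz').of_norm.hasSum
    simp only [hp]
    exact hasSum_degree hs

/-- The multi-index counting the letters of a word. -/
noncomputable def wordContent (w : Σ k, Fin k → Fin m) : Fin m →₀ ℕ :=
  ∑ j, Finsupp.single (w.2 j) 1

theorem monom_wordContent {M : Type*} [CommMonoid M] (z : Fin m → M) (w : Σ k, Fin k → Fin m) :
    monom z (wordContent w) = ∏ j, z (w.2 j) := by
  have h : ∀ s : Finset (Fin w.1),
      monom z (∑ j ∈ s, Finsupp.single (w.2 j) 1) = ∏ j ∈ s, z (w.2 j) := by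
    classical
    intro s
    induction s using Finset.induction_on with
    | empty => simp [monom]
    | insert a s ha ih => rw [Finset.sum_insert ha, Finset.prod_insert ha, monom_add, ih,
        monom_single, pow_one]
  exact h Finset.univ

/-- Every function analytic at the origin is the sum of a convergent power series. -/
theorem exists_hasTaylor {f : (Fin m → ℂ) → ℂ} (hf : AnalyticAt ℂ f 0) :
    ∃ φ, HasTaylor φ f := by
  classical
  obtain ⟨p, R, hp⟩ := hf
  -- the coefficients of `p` in the noncommuting coordinates, indexed by words
  let a : (Σ k, Fin k → Fin m) → ℂ := fun w => p w.1 fun j => Pi.single (w.2 j) 1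
  -- there are `m ^ k` words of length `k`; a radius smaller by the factor `m` absorbs their number
  obtain ⟨r, hr0, hrR⟩ : ∃ r : ℝ≥0, 0 < r ∧ (((m : ℝ≥0) * r : ℝ≥0) : ℝ≥0∞) < R := by
    obtain ⟨s, hs0, hsR⟩ := ENNReal.lt_iff_exists_nnreal_btwn.mp hp.r_pos
    have hs0' : 0 < s := by exact_mod_cast hs0
    refine ⟨s / (m + 1), by positivity, lt_of_le_of_lt ?_ hsR⟩
    rw [ENNReal.coe_le_coe, ← mul_div_assoc, mul_comm, mul_div_assoc]
    refine mul_le_of_le_one_right zero_le ?_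
    rw [div_le_one (by positivity)]
    exact le_self_add
  have hsum : ∑' w : Σ k, Fin k → Fin m, ((‖a w‖₊ * r ^ w.1 : ℝ≥0) : ℝ≥0∞) ≠ ⊤ := by
    have h1 := p.summable_norm_mul_pow (hrR.trans_le hp.r_le)
    have h2 : Summable fun k => ‖p k‖₊ * ((m : ℝ≥0) * r) ^ k := by
      rw [← NNReal.summable_coe]
      simpa using h1
    rw [ENNReal.tsum_sigma']
    refine ne_top_of_le_ne_top (ENNReal.tsum_coe_ne_top_iff_summable.mpr h2)
      (ENNReal.tsum_le_tsum fun k => ?_)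
    rw [tsum_fintype]
    norm_cast
    calc ∑ c : Fin k → Fin m, ‖a ⟨k, c⟩‖₊ * r ^ k ≤ ∑ c : Fin k → Fin m, ‖p k‖₊ * r ^ k := by
          refine Finset.sum_le_sum fun c _ => ?_
          gcongr
          refine ((p k).le_opNNNorm _).trans ?_
          refine mul_le_of_le_one_right zero_le (Finset.prod_le_one' fun j _ => ?_)
          rw [Pi.nnnorm_single, nnnorm_one]
      _ = _ := by
          rw [Finset.sum_const, Finset.card_univ, Fintype.card_fun, Fintype.card_fin,
            Fintype.card_fin, nsmul_eq_mul, mul_pow]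
          push_cast; ring
  have hcontent : ∀ w : Σ k, Fin k → Fin m, monom (fun _ => r) (wordContent w) = r ^ w.1 :=
    fun w => by rw [monom_wordContent]; simp
  have hword : ∀ z : Fin m → ℂ, (∀ i, ‖z i‖₊ ≤ r) →
      Summable fun w => a w * monom z (wordContent w) := by
    intro z hz
    refine Summable.of_enorm (ne_top_of_le_ne_top hsum (ENNReal.tsum_le_tsum fun w => ?_))
    rw [enorm_eq_nnnorm, ENNReal.coe_le_coe, nnnorm_mul, nnnorm_monom, ← hcontent]
    have := monom_mono (r := fun i => ‖z i‖₊) (s := fun _ => r) hz (wordContent w)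
    gcongr
  -- collecting the words with the same content gives the coefficients in commuting coordinates
  let φ : MvPowerSeries (Fin m) ℂ := fun α => ∑' w : {w // wordContent w = α}, a w
  have hφ : ∀ α, MvPowerSeries.coeff α φ = ∑' w : {w // wordContent w = α}, a w := fun _ => rfl
  refine ⟨φ, ⟨r, hr0, ?_⟩, ?_⟩
  · refine ne_top_of_le_ne_top hsum ?_
    rw [← (Equiv.sigmaFiberEquiv (wordContent (m := m))).tsum_eq, ENNReal.tsum_sigma']
    refine ENNReal.tsum_le_tsum fun α => ?_
    rw [ENNReal.coe_mul, hφ, ← enorm_eq_nnnorm]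
    refine (mul_le_mul_left enorm_tsum_le_tsum_enorm _).trans ?_
    rw [← ENNReal.tsum_mul_right]
    refine ENNReal.tsum_le_tsum fun w => ?_
    show _ ≤ ((‖a w.1‖₊ * r ^ w.1.1 : ℝ≥0) : ℝ≥0∞)
    rw [ENNReal.coe_mul, ← enorm_eq_nnnorm, ← hcontent, w.2]
  · filter_upwards [eventually_nnnorm_le hr0, Metric.eball_mem_nhds (0 : Fin m → ℂ) hp.r_pos]
      with z hz hzR
    have h1 := hp.hasSum hzR
    rw [zero_add] at h1
    have h2 := (hword z hz).hasSum
    have h3 := h2.sigma fun k => hasSum_fintype _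
    -- multilinear expansion in the standard basis
    have hk : ∀ k, p k (fun _ => z) = ∑ c : Fin k → Fin m, a ⟨k, c⟩ * monom z (wordContent ⟨k, c⟩) := by
      intro k
      have hz1 : z = ∑ i, z i • (Pi.single i 1 : Fin m → ℂ) := by
        conv_lhs => rw [← Finset.univ_sum_single z]
        exact Finset.sum_congr rfl fun i _ => by rw [← Pi.single_smul, smul_eq_mul, mul_one]
      conv_lhs => rw [hz1]
      have := (p k).toMultilinearMap.map_sum (α := fun _ => Fin m)
        (fun _ i => z i • (Pi.single i 1 : Fin m → ℂ))
      refine this.trans (Finset.sum_congr rfl fun c _ => ?_)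
      rw [MultilinearMap.map_smul_univ, monom_wordContent, smul_eq_mul, mul_comm]
      rfl
    rw [← funext hk] at h3
    rw [h1.unique h3, ← (Equiv.sigmaFiberEquiv (wordContent (m := m))).tsum_eq
      (fun w => a w * monom z (wordContent w))]
    have h4 := (Equiv.sigmaFiberEquiv (wordContent (m := m))).summable_iff.mpr (hword z hz)
    refine h4.tsum_sigma.trans ?_
    refine tsum_congr fun α => ?_
    rw [hφ, ← tsum_mul_right]
    refine tsum_congr fun w => ?_
    show a w.1 * monom z (wordContent w.1) = _
    rw [w.2]

end Taylor

/-! ### Weierstrass division -/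

section Weierstrass

open scoped NNReal ENNReal

variable {n : ℕ}

theorem weightedNorm_smul (r : Fin n → ℝ≥0) (c : ℂ) (φ : MvPowerSeries (Fin n) ℂ) :
    weightedNorm r (c • φ) = ‖c‖₊ * weightedNorm r φ := by
  rw [weightedNorm, weightedNorm, ← ENNReal.tsum_mul_left]
  refine tsum_congr fun α => ?_
  rw [map_smul, smul_eq_mul, nnnorm_mul, mul_assoc, ENNReal.coe_mul]

theorem nnnorm_coeff_mul_le (r : Fin n → ℝ≥0) (φ : MvPowerSeries (Fin n) ℂ) (α : Fin n →₀ ℕ) :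
    ((‖MvPowerSeries.coeff α φ‖₊ * monom r α : ℝ≥0) : ℝ≥0∞) ≤ weightedNorm r φ :=
  ENNReal.le_tsum (f := fun α => ((‖MvPowerSeries.coeff α φ‖₊ * monom r α : ℝ≥0) : ℝ≥0∞)) α

/-- Division by `z_0^d`, discarding the monomials that are not divisible. -/
noncomputable def shiftSeries (d : ℕ) (φ : MvPowerSeries (Fin (n + 1)) ℂ) : MvPowerSeries (Fin (n + 1)) ℂ :=
  fun α => MvPowerSeries.coeff (α + Finsupp.single 0 d) φ

theorem coeff_shiftSeries (d : ℕ) (φ : MvPowerSeries (Fin (n + 1)) ℂ) (α) :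
    MvPowerSeries.coeff α (shiftSeries d φ) = MvPowerSeries.coeff (α + Finsupp.single 0 d) φ := rfl

theorem weightedNorm_shiftSeries_mul_le (r : Fin (n + 1) → ℝ≥0) (d : ℕ)
    (φ : MvPowerSeries (Fin (n + 1)) ℂ) :
    weightedNorm r (shiftSeries d φ) * ((r 0 ^ d : ℝ≥0) : ℝ≥0∞) ≤ weightedNorm r φ := by
  rw [weightedNorm, ← ENNReal.tsum_mul_right]
  refine le_trans (le_of_eq (tsum_congr fun α => ?_))
    (ENNReal.tsum_comp_le_tsum_of_injective
    (add_left_injective (Finsupp.single (0 : Fin (n + 1)) d)) fun α =>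
      ((‖MvPowerSeries.coeff α φ‖₊ * monom r α : ℝ≥0) : ℝ≥0∞))
  rw [coeff_shiftSeries, monom_add, monom_single, ← ENNReal.coe_mul, mul_assoc]

/-- The Neumann series behind division: if `q ↦ (q P) / z_0^d` contracts, then
`q - (q P) / z_0^d = t` is solvable. -/
theorem exists_sub_shiftSeries_eq {r : Fin (n + 1) → ℝ≥0} (hr : ∀ i, 0 < r i) {d : ℕ}
    {P t : MvPowerSeries (Fin (n + 1)) ℂ}
    (hP : weightedNorm r P ≤ ((r 0 ^ d : ℝ≥0) : ℝ≥0∞) * 2⁻¹) (ht : weightedNorm r t ≠ ⊤) :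
    ∃ q, weightedNorm r q ≠ ⊤ ∧ q - shiftSeries d (q * P) = t := by
  classical
  let S : MvPowerSeries (Fin (n + 1)) ℂ → MvPowerSeries (Fin (n + 1)) ℂ :=
    fun q => shiftSeries d (q * P)
  have hS : ∀ q, weightedNorm r (S q) ≤ weightedNorm r q * 2⁻¹ := by
    intro q
    have h0 : ((r 0 ^ d : ℝ≥0) : ℝ≥0∞) ≠ 0 := by
      exact_mod_cast (pow_pos (hr 0) d).ne'
    refine (ENNReal.mul_le_mul_iff_left h0 ENNReal.coe_ne_top).mp ?_
    calc _ ≤ weightedNorm r (q * P) := weightedNorm_shiftSeries_mul_le r d _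
      _ ≤ weightedNorm r q * weightedNorm r P := weightedNorm_mul_le _ _ _
      _ ≤ weightedNorm r q * (((r 0 ^ d : ℝ≥0) : ℝ≥0∞) * 2⁻¹) := by gcongr
      _ = _ := by ring
  -- the terms `S^k t` of the Neumann series decay geometrically
  let u : ℕ → MvPowerSeries (Fin (n + 1)) ℂ := fun k => S^[k] t
  have hu : ∀ k, weightedNorm r (u k) ≤ weightedNorm r t * 2⁻¹ ^ k := by
    intro k
    induction k with
    | zero => simp [u]
    | succ k ih =>
      have : u (k + 1) = S (u k) := Function.iterate_succ_apply' _ _ _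
      rw [this, pow_succ, ← mul_assoc]
      exact (hS _).trans (by gcongr)
  have hfin : ∑' k, weightedNorm r (u k) ≠ ⊤ := by
    refine ne_top_of_le_ne_top ?_ (ENNReal.tsum_le_tsum hu)
    rw [ENNReal.tsum_mul_left]
    refine ENNReal.mul_ne_top ht ?_
    rw [ENNReal.tsum_geometric]
    simp
  have hsum : ∀ α, Summable fun k => MvPowerSeries.coeff α (u k) := by
    intro α
    have h1 : ∑' k, ((‖MvPowerSeries.coeff α (u k)‖₊ * monom r α : ℝ≥0) : ℝ≥0∞) ≠ ⊤ :=
      ne_top_of_le_ne_top hfin (ENNReal.tsum_le_tsum fun k => nnnorm_coeff_mul_le r (u k) α)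
    rw [ENNReal.tsum_coe_ne_top_iff_summable] at h1
    have h2 := (NNReal.summable_coe.mpr
      ((summable_mul_right_iff (monom_pos hr α).ne').mp h1))
    exact Summable.of_norm h2
  let q : MvPowerSeries (Fin (n + 1)) ℂ := fun α => ∑' k, MvPowerSeries.coeff α (u k)
  have hq : ∀ α, HasSum (fun k => MvPowerSeries.coeff α (u k)) (MvPowerSeries.coeff α q) :=
    fun α => (hsum α).hasSum
  refine ⟨q, ?_, ?_⟩
  · refine ne_top_of_le_ne_top hfin ?_
    simp only [weightedNorm]
    rw [ENNReal.tsum_comm]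
    refine ENNReal.tsum_le_tsum fun α => ?_
    simp only [ENNReal.coe_mul]
    rw [ENNReal.tsum_mul_right]
    gcongr
    rw [← (hq α).tsum_eq]
    have h3 : ∑' k, (‖MvPowerSeries.coeff α (u k)‖₊ : ℝ≥0∞) = ∑' k, ‖MvPowerSeries.coeff α (u k)‖ₑ :=
      rfl
    rw [h3]
    exact enorm_tsum_le_tsum_enorm (f := fun k => MvPowerSeries.coeff α (u k))
  · ext α
    rw [map_sub, sub_eq_iff_eq_add]
    refine (hq α).unique ?_
    rw [← hasSum_nat_add_iff' 1]
    simp only [Finset.range_one, Finset.sum_singleton]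
    have h0 : u 0 = t := rfl
    rw [h0, add_sub_cancel_left]
    have h1 : ∀ k, u (k + 1) = shiftSeries d (u k * P) :=
      fun k => Function.iterate_succ_apply' _ _ _
    simp only [h1, coeff_shiftSeries, MvPowerSeries.coeff_mul]
    exact hasSum_sum fun p _ => (hq p.1).mul_right _

/-- With weight `s` for `z_0` and `ρ` for the other variables, monomials that involve another variable
carry the small factor `ρ / r`. -/
theorem monom_le_of_tail {r s ρ : ℝ≥0} (hs : s ≤ r) (hρ : ρ ≤ r) (hr : 0 < r)
    {α : Fin (n + 1) →₀ ℕ} {i : Fin n} (hi : α i.succ ≠ 0) :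
    monom (Fin.cons s fun _ => ρ : Fin (n + 1) → ℝ≥0) α ≤ ρ / r * monom (fun _ => r) α := by
  obtain ⟨β, rfl⟩ := exists_add_of_le (a := Finsupp.single i.succ 1) (b := α)
    (by rw [Finsupp.single_le_iff]; omega)
  rw [monom_add, monom_add, monom_single, monom_single, pow_one, pow_one, Fin.cons_succ,
    ← mul_assoc, div_mul_cancel₀ _ hr.ne']
  gcongr
  refine monom_mono (fun j => ?_) β
  refine Fin.cases ?_ (fun j => ?_) j <;> simpa

/-- With weight `s` for `z_0`, monomials divisible by `z_0 ^ d` carry the small factor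
`(s / r) ^ d`. -/
theorem monom_le_of_le {r s ρ : ℝ≥0} (hs : s ≤ r) (hρ : ρ ≤ r) (hr : 0 < r)
    {α : Fin (n + 1) →₀ ℕ} {d : ℕ} (hi : d ≤ α 0) :
    monom (Fin.cons s fun _ => ρ : Fin (n + 1) → ℝ≥0) α ≤ (s / r) ^ d * monom (fun _ => r) α := by
  obtain ⟨β, rfl⟩ := exists_add_of_le (a := Finsupp.single 0 d) (b := α)
    (by rw [Finsupp.single_le_iff]; omega)
  rw [monom_add, monom_add, monom_single, monom_single, Fin.cons_zero,
    ← mul_assoc, ← mul_pow, div_mul_cancel₀ _ hr.ne']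
  gcongr
  refine monom_mono (fun j => ?_) β
  refine Fin.cases ?_ (fun j => ?_) j <;> simpa

/-- Weierstrass division for convergent power series: modulo a series of order `d` in `z_0`, every
convergent series is congruent to a polynomial of degree less than `d` in `z_0`. -/
theorem exists_weierstrass_division {φ h : MvPowerSeries (Fin (n + 1)) ℂ} {d : ℕ}
    (h0 : ∀ k < d, MvPowerSeries.coeff (Finsupp.single 0 k) φ = 0)
    (hd : MvPowerSeries.coeff (Finsupp.single 0 d) φ ≠ 0)
    (hφ : ∃ r : ℝ≥0, 0 < r ∧ weightedNorm (fun _ => r) φ ≠ ⊤)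
    (hh : ∃ r : ℝ≥0, 0 < r ∧ weightedNorm (fun _ => r) h ≠ ⊤) :
    ∃ q, (∃ r : ℝ≥0, 0 < r ∧ weightedNorm (fun _ => r) q ≠ ⊤) ∧
      ∀ α : Fin (n + 1) →₀ ℕ, d ≤ α 0 → MvPowerSeries.coeff α (h - q * φ) = 0 := by
  classical
  obtain ⟨r₁, hr₁, hφ⟩ := hφ
  obtain ⟨r₂, hr₂, hh⟩ := hh
  set c := MvPowerSeries.coeff (Finsupp.single 0 d) φ with hc
  let r := min r₁ r₂
  have hr : 0 < r := lt_min hr₁ hr₂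
  let ψ := c⁻¹ • φ
  have hψ : weightedNorm (fun _ => r) ψ ≠ ⊤ := by
    rw [weightedNorm_smul]
    exact ENNReal.mul_ne_top ENNReal.coe_ne_top
      (ne_top_of_le_ne_top hφ (weightedNorm_mono (fun _ => min_le_left _ _) _))
  have hh' : weightedNorm (fun _ => r) h ≠ ⊤ :=
    ne_top_of_le_ne_top hh (weightedNorm_mono (fun _ => min_le_right _ _) _)
  -- `φ = c (z_0 ^ d - P)`, where `P` has no monomials `z_0 ^ k` with `k ≤ d`
  let P : MvPowerSeries (Fin (n + 1)) ℂ := MvPowerSeries.monomial (Finsupp.single 0 d) 1 - ψ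
  obtain ⟨N, hN⟩ : ∃ N : ℝ≥0, (N : ℝ≥0∞) = weightedNorm (fun _ => r) ψ :=
    ⟨_, ENNReal.coe_toNNReal hψ⟩
  -- `s` makes the powers `z_0^k` with `k > d` small against `z_0^d`, then `ρ` all other monomials
  obtain ⟨s, hs0, hsr, hs⟩ : ∃ s : ℝ≥0, 0 < s ∧ s ≤ r ∧ (s / r) ^ (d + 1) * (2 * (N + 1)) ≤ s ^ d := by
    refine ⟨min r (r ^ (d + 1) / (2 * (N + 1))), by positivity, min_le_left _ _, ?_⟩
    set s := min r (r ^ (d + 1) / (2 * (N + 1)))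
    have h1 : s ≤ r ^ (d + 1) / (2 * (N + 1)) := min_le_right _ _
    rw [le_div_iff₀ (by positivity)] at h1
    rw [div_pow, div_mul_eq_mul_div, div_le_iff₀ (by positivity), pow_succ s, mul_assoc]
    gcongr
  obtain ⟨ρ, hρ0, hρr, hρ⟩ : ∃ ρ : ℝ≥0, 0 < ρ ∧ ρ ≤ r ∧ (ρ / r) * (2 * (N + 1)) ≤ s ^ d := by
    refine ⟨min r (r * s ^ d / (2 * (N + 1))), by positivity, min_le_left _ _, ?_⟩
    set ρ := min r (r * s ^ d / (2 * (N + 1)))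
    have h1 : ρ ≤ r * s ^ d / (2 * (N + 1)) := min_le_right _ _
    rw [le_div_iff₀ (by positivity)] at h1
    rw [div_mul_eq_mul_div, div_le_iff₀ (by positivity), mul_comm (s ^ d)]
    exact h1
  let w : Fin (n + 1) → ℝ≥0 := Fin.cons s fun _ => ρ
  have hw0 : ∀ i, 0 < w i := fun i => by refine Fin.cases ?_ (fun j => ?_) i <;> simpa [w]
  have hwr : w ≤ fun _ => r := fun i => by refine Fin.cases ?_ (fun j => ?_) i <;> simpa [w]
  let K : ℝ≥0 := s ^ d / (2 * (N + 1))
  have hPK : ∀ α, ‖MvPowerSeries.coeff α P‖₊ * monom w α ≤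
      K * (‖MvPowerSeries.coeff α ψ‖₊ * monom (fun _ => r) α) := by
    intro α
    by_cases h1 : ∃ i : Fin n, α i.succ ≠ 0
    · obtain ⟨i, hi⟩ := h1
      have h2 : MvPowerSeries.coeff α P = - MvPowerSeries.coeff α ψ := by
        rw [map_sub, MvPowerSeries.coeff_monomial_ne, zero_sub]
        rintro rfl
        simp at hi
      rw [h2, nnnorm_neg, mul_left_comm]
      gcongr
      refine (monom_le_of_tail hsr hρr hr hi).trans ?_
      gcongr
      exact (le_div_iff₀ (by positivity)).mpr hρ
    · push Not at h1
      have hα : α = Finsupp.single 0 (α 0) := by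
        ext i
        refine Fin.cases ?_ (fun j => ?_) i
        · simp
        · rw [h1, Finsupp.single_eq_of_ne (Fin.succ_ne_zero j)]
      by_cases h3 : α 0 ≤ d
      · have h2 : MvPowerSeries.coeff α P = 0 := by
          rcases h3.lt_or_eq with h3 | h3
          · rw [map_sub, MvPowerSeries.coeff_monomial_ne, zero_sub, neg_eq_zero, map_smul, hα,
              h0 _ h3, smul_zero]
            rintro rfl
            simp at h3
          · rw [map_sub, hα, h3, MvPowerSeries.coeff_monomial_same, map_smul, ← hc, smul_eq_mul,
              inv_mul_cancel₀ hd, sub_self]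
        rw [h2]
        simp
      · have h2 : MvPowerSeries.coeff α P = - MvPowerSeries.coeff α ψ := by
          rw [map_sub, MvPowerSeries.coeff_monomial_ne, zero_sub]
          rintro rfl
          simp at h3
        rw [h2, nnnorm_neg, mul_left_comm]
        gcongr
        refine (monom_le_of_le (d := d + 1) hsr hρr hr (by omega)).trans ?_
        gcongr
        exact (le_div_iff₀ (by positivity)).mpr hs
  have hP : weightedNorm w P ≤ ((w 0 ^ d : ℝ≥0) : ℝ≥0∞) * 2⁻¹ := by
    calc weightedNorm w P ≤ ∑' α, (K : ℝ≥0∞) *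
          ((‖MvPowerSeries.coeff α ψ‖₊ * monom (fun _ => r) α : ℝ≥0) : ℝ≥0∞) :=
          ENNReal.tsum_le_tsum fun α => by rw [← ENNReal.coe_mul]; exact_mod_cast hPK α
      _ = ((K * N : ℝ≥0) : ℝ≥0∞) := by
          rw [ENNReal.tsum_mul_left, ENNReal.coe_mul K N, hN, weightedNorm]
      _ ≤ ((s ^ d * 2⁻¹ : ℝ≥0) : ℝ≥0∞) := by
          rw [ENNReal.coe_le_coe]
          simp only [K]
          rw [div_mul_eq_mul_div, div_le_iff₀ (by positivity)]
          calc s ^ d * N ≤ s ^ d * (N + 1) := by gcongr; exact le_self_add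
            _ = s ^ d * 2⁻¹ * (2 * (N + 1)) := by
              rw [mul_assoc, inv_mul_cancel_left₀ two_ne_zero]
      _ = _ := by
          rw [ENNReal.coe_mul, ENNReal.coe_inv two_ne_zero]
          rfl
  have ht : weightedNorm w (shiftSeries d h) ≠ ⊤ := by
    intro htop
    have h1 := weightedNorm_shiftSeries_mul_le w d h
    rw [htop, ENNReal.top_mul (by exact_mod_cast (pow_pos (hw0 0) d).ne'), top_le_iff] at h1
    exact ne_top_of_le_ne_top hh' (weightedNorm_mono hwr h) h1
  obtain ⟨q, hq, hqt⟩ := exists_sub_shiftSeries_eq hw0 hP ht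
  refine ⟨c⁻¹ • q, ⟨min s ρ, lt_min hs0 hρ0, ?_⟩, fun α hα => ?_⟩
  · rw [weightedNorm_smul]
    refine ENNReal.mul_ne_top ENNReal.coe_ne_top (ne_top_of_le_ne_top hq (weightedNorm_mono ?_ _))
    intro i
    refine Fin.cases ?_ (fun j => ?_) i <;> simp [w]
  · obtain ⟨β, rfl⟩ := exists_add_of_le (a := Finsupp.single 0 d) (b := α)
      (by rw [Finsupp.single_le_iff]; omega)
    -- `q - (q P) / z_0 ^ d = h / z_0 ^ d` says that `h` and `q (z_0 ^ d - P)` have the same coefficients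
    -- at the monomials divisible by `z_0 ^ d`
    have h1 : MvPowerSeries.coeff (β + Finsupp.single 0 d) (q * P) =
        MvPowerSeries.coeff β q - MvPowerSeries.coeff (β + Finsupp.single 0 d) (q * ψ) := by
      rw [mul_sub, map_sub]
      congr 1
      rw [MvPowerSeries.coeff_add_mul_monomial, mul_one]
    have h2 := congrArg (MvPowerSeries.coeff β) hqt
    rw [map_sub, coeff_shiftSeries, coeff_shiftSeries, h1, sub_sub_cancel] at h2
    rw [add_comm (Finsupp.single 0 d) β, map_sub, ← h2, smul_mul_assoc, ← mul_smul_comm, sub_self]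

theorem HasTaylor.neg {φ : MvPowerSeries (Fin n) ℂ} {f : (Fin n → ℂ) → ℂ}
    (hf : HasTaylor φ f) : HasTaylor (-φ) (-f) := by
  refine ⟨?_, ?_⟩
  · obtain ⟨r, hr, hφ⟩ := hf.1
    exact ⟨r, hr, by rwa [weightedNorm_neg]⟩
  · filter_upwards [hf.2] with z hz
    rw [Pi.neg_apply, hz, ← tsum_neg]
    exact tsum_congr fun α => by rw [map_neg, neg_mul]

theorem exists_hasTaylor_of_weightedNorm {φ : MvPowerSeries (Fin n) ℂ}
    (h : ∃ r : ℝ≥0, 0 < r ∧ weightedNorm (fun _ => r) φ ≠ ⊤) : ∃ f, HasTaylor φ f :=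
  ⟨_, h, Eventually.of_forall fun _ => rfl⟩

/-- A convergent power series of degree less than `d` in `z_0` is a polynomial in `z_0` whose
coefficients are convergent in the other variables. -/
theorem HasTaylor.exists_eq_sum {φ : MvPowerSeries (Fin (n + 1)) ℂ} {f : (Fin (n + 1) → ℂ) → ℂ}
    (hf : HasTaylor φ f) {d : ℕ}
    (hd : ∀ α : Fin (n + 1) →₀ ℕ, d ≤ α 0 → MvPowerSeries.coeff α φ = 0) :
    ∃ R : Fin d → (Fin n → ℂ) → ℂ, (∀ k, AnalyticAt ℂ (R k) 0) ∧
      ∀ᶠ z in 𝓝 0, f z = ∑ k, R k (Fin.tail z) * z 0 ^ (k : ℕ) := by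
  classical
  let ψ : Fin d → MvPowerSeries (Fin n) ℂ := fun k β =>
    MvPowerSeries.coeff (Finsupp.cons (k : ℕ) β) φ
  have hmon : ∀ {M : Type} [CommMonoid M] (z : Fin (n + 1) → M) (k : ℕ) (β : Fin n →₀ ℕ),
      monom z (Finsupp.cons k β) = z 0 ^ k * monom (Fin.tail z) β := by
    intro M _ z k β
    rw [monom, Fin.prod_univ_succ]
    rfl
  have hψ : ∀ k, ∃ R, HasTaylor (ψ k) R := by
    intro k
    obtain ⟨r, hr, hφ⟩ := hf.1
    refine exists_hasTaylor_of_weightedNorm ⟨r, hr, fun htop => ?_⟩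
    have h1 : weightedNorm (fun _ => r) (ψ k) * ((r ^ (k : ℕ) : ℝ≥0) : ℝ≥0∞) ≤
        weightedNorm (fun _ => r) φ := by
      rw [weightedNorm, ← ENNReal.tsum_mul_right]
      refine le_trans (le_of_eq (tsum_congr fun β => ?_))
        (ENNReal.tsum_comp_le_tsum_of_injective (Finsupp.cons_right_injective (k : ℕ)) fun α =>
          ((‖MvPowerSeries.coeff α φ‖₊ * monom (fun _ => r) α : ℝ≥0) : ℝ≥0∞))
      rw [hmon, ← ENNReal.coe_mul, mul_assoc, mul_comm (r ^ (k : ℕ))]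
      rfl
    rw [htop, ENNReal.top_mul (by exact_mod_cast (pow_pos hr _).ne'), top_le_iff] at h1
    exact hφ h1
  choose R hR using hψ
  refine ⟨R, fun k => (hR k).analyticAt, ?_⟩
  have htail : Tendsto (fun z : Fin (n + 1) → ℂ => Fin.tail z) (𝓝 0) (𝓝 0) := by
    have : Continuous fun z : Fin (n + 1) → ℂ => Fin.tail z :=
      continuous_pi fun i => continuous_apply _
    exact this.tendsto' _ _ rfl
  have hev : ∀ᶠ z : Fin (n + 1) → ℂ in 𝓝 0, ∀ k, HasSum (fun β => MvPowerSeries.coeff β (ψ k) *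
      monom (Fin.tail z) β) (R k (Fin.tail z)) :=
    eventually_all.mpr fun k => htail.eventually ((hR k).eventually_hasSum.mono fun _ h => h.1)
  filter_upwards [hev, hf.eventually_hasSum] with z h1 h2
  let j : Fin d × (Fin n →₀ ℕ) → (Fin (n + 1) →₀ ℕ) := fun p => Finsupp.cons (p.1 : ℕ) p.2
  have hj : Function.Injective j := by
    rintro ⟨a, β⟩ ⟨b, γ⟩ h
    have h3 := congrArg (fun α : Fin (n + 1) →₀ ℕ => α 0) h
    have h4 := congrArg Finsupp.tail h
    simp only [j, Finsupp.cons_zero, Finsupp.tail_cons] at h3 h4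
    rw [Prod.mk.injEq]
    exact ⟨Fin.ext h3, h4⟩
  have h3 := (hj.hasSum_iff (f := fun α => MvPowerSeries.coeff α φ * monom z α) (a := f z) ?_).mpr
    h2.1
  · refine (h3.prod_fiberwise (g := fun k => R k (Fin.tail z) * z 0 ^ (k : ℕ)) fun k => ?_).unique
      (hasSum_fintype _)
    refine ((h1 k).mul_right (z 0 ^ (k : ℕ))).congr_fun fun β => ?_
    show MvPowerSeries.coeff (Finsupp.cons (k : ℕ) β) φ * monom z (Finsupp.cons (k : ℕ) β) = _
    rw [hmon]
    rw [mul_assoc, mul_comm (z 0 ^ _)]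
    rfl
  · intro α hα
    rw [hd α, zero_mul]
    by_contra! hlt
    refine hα ⟨(⟨α 0, hlt⟩, α.tail), ?_⟩
    exact Finsupp.cons_tail α

end Weierstrass

/-! ### The local ring of analytic germs -/

section GermRing

open IsLocalRing

variable {m k n : ℕ}

theorem LocalAnalyticRing.exists_germAtZero_eq (φ : LocalAnalyticRing m) :
    ∃ g hg, germAtZero g hg = φ := by
  obtain ⟨φ, g, hg, rfl⟩ := φ
  exact ⟨g, hg, rfl⟩

theorem germAtZero_eq_iff {g h : (Fin m → ℂ) → ℂ} {hg : AnalyticAt ℂ g 0} {hh : AnalyticAt ℂ h 0} :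
    germAtZero g hg = germAtZero h hh ↔ g =ᶠ[𝓝 0] h :=
  Subtype.ext_iff.trans Germ.coe_eq

theorem evalAtZero_germAtZero {g : (Fin m → ℂ) → ℂ} {hg : AnalyticAt ℂ g 0} :
    evalAtZero m (germAtZero g hg) = g 0 := rfl

theorem analyticAt_comp_linear {g : (Fin k → ℂ) → ℂ} (hg : AnalyticAt ℂ g 0)
    (L : (Fin m → ℂ) →L[ℂ] (Fin k → ℂ)) : AnalyticAt ℂ (g ∘ L) 0 :=
  AnalyticAt.comp (f := L) (by rwa [map_zero]) (L.analyticAt 0)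

/-- Composition of germs with a linear map. -/
noncomputable def germComp (L : (Fin m → ℂ) →L[ℂ] (Fin k → ℂ)) :
    LocalAnalyticRing k →ₐ[ℂ] LocalAnalyticRing m where
  toFun φ := ⟨φ.1.compTendsto L (L.continuous.tendsto' 0 0 (map_zero L)), by
    obtain ⟨_, g, hg, rfl⟩ := φ
    exact ⟨g ∘ L, analyticAt_comp_linear hg L, rfl⟩⟩
  map_one' := rfl
  map_mul' := by
    rintro ⟨_, g, hg, rfl⟩ ⟨_, h, hh, rfl⟩
    rfl
  map_zero' := rfl
  map_add' := by
    rintro ⟨_, g, hg, rfl⟩ ⟨_, h, hh, rfl⟩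
    rfl
  commutes' _ := rfl

theorem germComp_germAtZero (L : (Fin m → ℂ) →L[ℂ] (Fin k → ℂ)) {g : (Fin k → ℂ) → ℂ}
    {hg : AnalyticAt ℂ g 0} :
    germComp L (germAtZero g hg) = germAtZero (g ∘ L) (analyticAt_comp_linear hg L) := rfl

theorem isUnit_of_evalAtZero_ne_zero {φ : LocalAnalyticRing m} (h : evalAtZero m φ ≠ 0) :
    IsUnit φ := by
  obtain ⟨g, hg, rfl⟩ := φ.exists_germAtZero_eq
  rw [evalAtZero_germAtZero] at h
  refine IsUnit.of_mul_eq_one (germAtZero g⁻¹ (hg.inv h)) ?_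
  refine (germAtZero_eq_iff (hg := hg.mul (hg.inv h)) (hh := analyticAt_const)).mpr ?_
  filter_upwards [hg.continuousAt.eventually_ne h] with z hz
  exact mul_inv_cancel₀ hz

instance : Nontrivial (LocalAnalyticRing m) := (evalAtZero m).domain_nontrivial

theorem isUnit_iff_evalAtZero_ne_zero {φ : LocalAnalyticRing m} :
    IsUnit φ ↔ evalAtZero m φ ≠ 0 :=
  ⟨fun h => (h.map (evalAtZero m)).ne_zero, isUnit_of_evalAtZero_ne_zero⟩

instance : IsLocalRing (LocalAnalyticRing m) :=
  .of_nonunits_add fun a b ha hb => by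
    simp only [mem_nonunits_iff, isUnit_iff_evalAtZero_ne_zero, not_not] at ha hb ⊢
    rw [map_add, ha, hb, add_zero]

theorem mem_maximalIdeal_iff_evalAtZero {φ : LocalAnalyticRing m} :
    φ ∈ maximalIdeal (LocalAnalyticRing m) ↔ evalAtZero m φ = 0 := by
  rw [mem_maximalIdeal, mem_nonunits_iff, isUnit_iff_evalAtZero_ne_zero, not_not]

theorem originPrime_asIdeal : (originPrime m).asIdeal = maximalIdeal (LocalAnalyticRing m) := by
  ext φ
  rw [mem_maximalIdeal_iff_evalAtZero]
  rfl

theorem sub_algebraMap_mem_maximalIdeal (φ : LocalAnalyticRing m) :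
    φ - algebraMap ℂ _ (evalAtZero m φ) ∈ maximalIdeal (LocalAnalyticRing m) := by
  rw [mem_maximalIdeal_iff_evalAtZero, map_sub, sub_eq_zero]
  rfl

theorem coordGerm_mem_maximalIdeal (i : Fin m) :
    coordGerm i ∈ maximalIdeal (LocalAnalyticRing m) :=
  mem_maximalIdeal_iff_evalAtZero.mpr rfl

/-- The projection forgetting the coordinate `z_0`. -/
noncomputable def tailCLM (n : ℕ) : (Fin (n + 1) → ℂ) →L[ℂ] (Fin n → ℂ) :=
  ContinuousLinearMap.pi fun i => ContinuousLinearMap.proj i.succ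

/-- The inclusion of the hyperplane `z_0 = 0`. -/
noncomputable def consZeroCLM (n : ℕ) : (Fin n → ℂ) →L[ℂ] (Fin (n + 1) → ℂ) :=
  ContinuousLinearMap.pi (Fin.cons 0 fun i => ContinuousLinearMap.proj i)

theorem consZeroCLM_apply (w : Fin n → ℂ) : consZeroCLM n w = Fin.cons 0 w := by
  funext i
  refine Fin.cases ?_ (fun j => ?_) i <;> simp [consZeroCLM]

theorem tailCLM_consZeroCLM (w : Fin n → ℂ) : tailCLM n (consZeroCLM n w) = w := by
  funext i
  simp [tailCLM, consZeroCLM]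

/-- Weierstrass division for germs, by a germ whose Taylor series has order `d` in `z_0`. -/
theorem exists_germ_division {g : (Fin (n + 1) → ℂ) → ℂ} (hg : AnalyticAt ℂ g 0)
    {φ : MvPowerSeries (Fin (n + 1)) ℂ} (hφ : HasTaylor φ g) {d : ℕ}
    (h0 : ∀ j < d, MvPowerSeries.coeff (Finsupp.single 0 j) φ = 0)
    (hd : MvPowerSeries.coeff (Finsupp.single 0 d) φ ≠ 0) (h : LocalAnalyticRing (n + 1)) :
    ∃ (q : LocalAnalyticRing (n + 1)) (R : Fin d → LocalAnalyticRing n),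
      h = q * germAtZero g hg + ∑ j, germComp (tailCLM n) (R j) * coordGerm 0 ^ (j : ℕ) := by
  obtain ⟨h, hh, rfl⟩ := h.exists_germAtZero_eq
  obtain ⟨η, hη⟩ := exists_hasTaylor hh
  obtain ⟨q, hq, hdiv⟩ := exists_weierstrass_division h0 hd hφ.1 hη.1
  obtain ⟨Q, hQ⟩ := exists_hasTaylor_of_weightedNorm hq
  have hrem : HasTaylor (η - q * φ) (h + -(Q * g)) := by
    rw [sub_eq_add_neg]
    exact hη.add (hQ.mul hφ).neg
  obtain ⟨R, hR, hsum⟩ := hrem.exists_eq_sum hdiv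
  refine ⟨germAtZero Q hQ.analyticAt, fun j => germAtZero (R j) (hR j), ?_⟩
  have hterm : ∀ j, AnalyticAt ℂ (R j ∘ tailCLM n * (fun z : Fin (n + 1) → ℂ => z 0) ^ (j : ℕ)) 0 :=
    fun j => (analyticAt_comp_linear (hR j) (tailCLM n)).mul
      (((ContinuousLinearMap.proj (R := ℂ) (φ := fun _ : Fin (n + 1) => ℂ) 0).analyticAt 0).pow _)
  refine Subtype.ext ?_
  rw [AddMemClass.coe_add, AddSubmonoidClass.coe_finsetSum]
  have hcoe : ∀ s : Finset (Fin d), (∑ j ∈ s, ((germComp (tailCLM n) (germAtZero (R j) (hR j)) *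
      coordGerm 0 ^ (j : ℕ) : LocalAnalyticRing (n + 1)) : Germ (𝓝 (0 : Fin (n + 1) → ℂ)) ℂ)) =
      ((∑ j ∈ s, R j ∘ tailCLM n * (fun z : Fin (n + 1) → ℂ => z 0) ^ (j : ℕ) :
        (Fin (n + 1) → ℂ) → ℂ) : Germ (𝓝 (0 : Fin (n + 1) → ℂ)) ℂ) := by
    classical
    intro s
    induction s using Finset.induction_on with
    | empty => rfl
    | insert a s ha ih => rw [Finset.sum_insert ha, Finset.sum_insert ha, ih]; rfl
  rw [hcoe]
  refine Germ.coe_eq.mpr (hsum.mono fun z hz => ?_)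
  simp only [Pi.add_apply, Pi.neg_apply, Pi.mul_apply, Finset.sum_apply, Function.comp,
    Pi.pow_apply] at hz ⊢
  show h z = Q z * g z + ∑ j, R j (tailCLM n z) * z 0 ^ (j : ℕ)
  have hz' : h z + -(Q z * g z) = ∑ j, R j (tailCLM n z) * z 0 ^ (j : ℕ) := hz
  rw [← hz']
  ring

theorem monom_single_line (t : ℂ) {α : Fin (n + 1) →₀ ℕ} {i : Fin n} (hi : α i.succ ≠ 0) :
    monom (Pi.single 0 t : Fin (n + 1) → ℂ) α = 0 :=
  Finset.prod_eq_zero (Finset.mem_univ i.succ)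
    (by rw [Pi.single_eq_of_ne (Fin.succ_ne_zero i), zero_pow hi])

/-- A germ that does not vanish identically on the `z_0`-axis has finite order in `z_0`. -/
theorem HasTaylor.exists_order {g : (Fin (n + 1) → ℂ) → ℂ} {φ : MvPowerSeries (Fin (n + 1)) ℂ}
    (hφ : HasTaylor φ g) (hg : ¬ ∀ᶠ t : ℂ in 𝓝 0, g (Pi.single 0 t) = 0) :
    ∃ d, (∀ j < d, MvPowerSeries.coeff (Finsupp.single 0 j) φ = 0) ∧
      MvPowerSeries.coeff (Finsupp.single 0 d) φ ≠ 0 := by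
  classical
  have hex : ∃ d, MvPowerSeries.coeff (Finsupp.single 0 d) φ ≠ 0 := by
    by_contra! h
    refine hg ?_
    have ht : Tendsto (fun t : ℂ => (Pi.single 0 t : Fin (n + 1) → ℂ)) (𝓝 0) (𝓝 0) :=
      (continuous_single (A := fun _ : Fin (n + 1) => ℂ) 0).tendsto' _ _ (Pi.single_zero _)
    filter_upwards [ht.eventually hφ.2] with t ht
    rw [ht]
    refine (tsum_congr fun α => ?_).trans tsum_zero
    by_cases h1 : ∃ i : Fin n, α i.succ ≠ 0
    · obtain ⟨i, hi⟩ := h1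
      rw [monom_single_line t hi, mul_zero]
    · push Not at h1
      have hα : α = Finsupp.single 0 (α 0) := by
        ext i
        refine Fin.cases ?_ (fun j => ?_) i
        · simp
        · rw [h1, Finsupp.single_eq_of_ne (Fin.succ_ne_zero j)]
      rw [hα, h, zero_mul]
  exact ⟨Nat.find hex, fun j hj => not_not.mp (Nat.find_min hex hj), Nat.find_spec hex⟩

/-- A nonzero germ does not vanish identically on some line through the origin. -/
theorem exists_line_not_eventually_zero {g : (Fin (n + 1) → ℂ) → ℂ} (hg : AnalyticAt ℂ g 0)
    (h0 : ¬ ∀ᶠ z in 𝓝 0, g z = 0) : ∃ v ≠ 0, ¬ ∀ᶠ t : ℂ in 𝓝 0, g (t • v) = 0 := by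
  by_contra! h
  refine h0 ?_
  obtain ⟨r, hr, hball⟩ := Metric.eventually_nhds_iff_ball.mp hg.eventually_analyticAt
  filter_upwards [Metric.ball_mem_nhds 0 hr] with z hz
  rcases eq_or_ne z 0 with rfl | hz0
  · simpa using (h (Pi.single 0 1) (by simp)).self_of_nhds
  have hc : Convex ℝ ((fun t : ℂ => t • z) ⁻¹' Metric.ball 0 r) :=
    (convex_ball _ _).linear_preimage
      ((LinearMap.toSpanSingleton ℂ (Fin (n + 1) → ℂ) z).restrictScalars ℝ)
  have han : AnalyticOnNhd ℂ (fun t : ℂ => g (t • z)) ((fun t : ℂ => t • z) ⁻¹' Metric.ball 0 r) :=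
    fun t ht => AnalyticAt.fun_comp (hball _ ht)
      ((ContinuousLinearMap.toSpanSingleton ℂ z).analyticAt t)
  have := han.eqOn_zero_of_preconnected_of_eventuallyEq_zero hc.isPreconnected
    (z₀ := 0) (by simpa using hr) (h z hz0)
  simpa using this (x := 1) (by simpa using hz)

/-- By division, the quotient by a germ that is regular in `z_0` is a finite module over the germs in
the remaining variables. -/
theorem isNoetherianRing_quotient_of_regular [IsNoetherianRing (LocalAnalyticRing n)]
    {g : (Fin (n + 1) → ℂ) → ℂ} (hg : AnalyticAt ℂ g 0)
    (h : ¬ ∀ᶠ t : ℂ in 𝓝 0, g (Pi.single 0 t) = 0) :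
    IsNoetherianRing (LocalAnalyticRing (n + 1) ⧸ Ideal.span {germAtZero g hg}) := by
  obtain ⟨φ, hφ⟩ := exists_hasTaylor hg
  obtain ⟨d, h0, hd⟩ := hφ.exists_order h
  let J : Ideal (LocalAnalyticRing (n + 1)) := Ideal.span {germAtZero g hg}
  let : Algebra (LocalAnalyticRing n) (LocalAnalyticRing (n + 1) ⧸ J) :=
    ((Ideal.Quotient.mk J).comp (germComp (tailCLM n)).toRingHom).toAlgebra
  let T : (Fin d → LocalAnalyticRing n) →ₗ[LocalAnalyticRing n] (LocalAnalyticRing (n + 1) ⧸ J) :=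
    Fintype.linearCombination (LocalAnalyticRing n)
      fun j : Fin d => Ideal.Quotient.mk J (coordGerm 0 ^ (j : ℕ))
  have hT : Function.Surjective T := by
    intro b
    obtain ⟨b, rfl⟩ := Ideal.Quotient.mk_surjective b
    obtain ⟨q, R, hb⟩ := exists_germ_division hg hφ h0 hd b
    refine ⟨R, ?_⟩
    rw [hb, map_add, map_mul, Ideal.Quotient.eq_zero_iff_mem.mpr (Ideal.mem_span_singleton_self _),
      mul_zero, zero_add, map_sum, Fintype.linearCombination_apply]
    refine Finset.sum_congr rfl fun j _ => ?_
    rw [Algebra.smul_def, map_mul]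
    rfl
  have hN : IsNoetherian (LocalAnalyticRing n) (LocalAnalyticRing (n + 1) ⧸ J) :=
    isNoetherian_of_surjective T (LinearMap.range_eq_top.mpr hT)
  exact isNoetherian_of_tower (LocalAnalyticRing n) hN

/-- If all quotients by one nonzero element are Noetherian, so is the ring. -/
theorem isNoetherianRing_of_forall_quotient {R : Type*} [CommRing R]
    (h : ∀ g : R, g ≠ 0 → IsNoetherianRing (R ⧸ Ideal.span {g})) : IsNoetherianRing R := by
  rw [isNoetherianRing_iff_ideal_fg]
  intro J
  by_cases hJ : J = ⊥
  · rw [hJ]; exact Submodule.fg_bot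
  obtain ⟨g, hgJ, hg⟩ := Submodule.exists_mem_ne_zero_of_ne_bot hJ
  have := h g hg
  refine Submodule.fg_of_fg_map_of_fg_inf_ker (Ideal.span {g}).mkQ ?_ ?_
  · let f : (R ⧸ Ideal.span {g}) →ₛₗ[Ideal.Quotient.mk (Ideal.span {g})] (R ⧸ Ideal.span {g}) :=
      { toFun := id, map_add' := fun _ _ => rfl, map_smul' := fun _ _ => rfl }
    have h1 : IsNoetherian R (R ⧸ Ideal.span {g}) :=
      (LinearMap.isNoetherian_iff_of_bijective f Function.bijective_id).mpr this
    exact h1.noetherian _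
  · rw [Submodule.ker_mkQ, inf_eq_right.mpr ((Ideal.span_singleton_le_iff_mem _).mpr hgJ)]
    exact ⟨{g}, by simp⟩

theorem evalAtZero_injective_zero : Function.Injective (evalAtZero 0) := by
  intro φ ψ h
  obtain ⟨g, hg, rfl⟩ := φ.exists_germAtZero_eq
  obtain ⟨k, hk, rfl⟩ := ψ.exists_germAtZero_eq
  refine germAtZero_eq_iff.mpr (Eventually.of_forall fun z => ?_)
  rw [Subsingleton.elim z 0]
  exact h

theorem maximalIdeal_eq_bot_zero : maximalIdeal (LocalAnalyticRing 0) = ⊥ := by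
  rw [eq_bot_iff]
  intro φ hφ
  rw [mem_maximalIdeal_iff_evalAtZero] at hφ
  exact evalAtZero_injective_zero (hφ.trans (map_zero _).symm)

/-- Rückert's basis theorem: the ring of germs is Noetherian, by induction on the number of
variables. -/
instance instIsNoetherianRingLocalAnalyticRing : ∀ m, IsNoetherianRing (LocalAnalyticRing m)
  | 0 => isNoetherianRing_of_ringEquiv ℂ (RingEquiv.ofBijective (evalAtZero 0)
      ⟨evalAtZero_injective_zero, fun c => ⟨algebraMap ℂ _ c, rfl⟩⟩).symm
  | n + 1 => by
    have := instIsNoetherianRingLocalAnalyticRing n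
    refine isNoetherianRing_of_forall_quotient fun φ hφ => ?_
    obtain ⟨g, hg, rfl⟩ := φ.exists_germAtZero_eq
    obtain ⟨v, hv0, hv⟩ := exists_line_not_eventually_zero hg fun h =>
      hφ (germAtZero_eq_iff (hh := analyticAt_const).mpr h)
    -- a linear change of coordinates makes the germ regular in `z_0`
    obtain ⟨A, hA⟩ := SeparatingDual.exists_continuousLinearEquiv_apply_eq (R := ℂ)
      (x := (Pi.single 0 1 : Fin (n + 1) → ℂ)) (by simp) hv0
    let L : (Fin (n + 1) → ℂ) →L[ℂ] (Fin (n + 1) → ℂ) := A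
    let L' : (Fin (n + 1) → ℂ) →L[ℂ] (Fin (n + 1) → ℂ) := A.symm
    have hL : ∀ ψ, germComp L' (germComp L ψ) = ψ := fun ψ => by
      obtain ⟨h, hh, rfl⟩ := ψ.exists_germAtZero_eq
      rw [germComp_germAtZero, germComp_germAtZero, germAtZero_eq_iff]
      exact Eventually.of_forall fun z => congrArg h (A.apply_symm_apply z)
    have hreg : ¬ ∀ᶠ t : ℂ in 𝓝 0, (g ∘ L) (Pi.single 0 t) = 0 := by
      have h1 : ∀ t : ℂ, L (Pi.single 0 t) = t • v := by
        intro t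
        rw [← hA, ← map_smul A, ← Pi.single_smul, smul_eq_mul, mul_one]
        rfl
      simpa only [Function.comp, h1] using hv
    have := isNoetherianRing_quotient_of_regular (analyticAt_comp_linear hg L) hreg
    refine isNoetherianRing_of_surjective _ _ (Ideal.Quotient.lift
      (Ideal.span {germAtZero (g ∘ L) (analyticAt_comp_linear hg L)})
      ((Ideal.Quotient.mk (Ideal.span {germAtZero g hg})).comp (germComp L').toRingHom) ?_) ?_
    · intro a ha
      obtain ⟨b, rfl⟩ := Ideal.mem_span_singleton'.mp ha
      refine Ideal.Quotient.eq_zero_iff_mem.mpr ?_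
      rw [← germComp_germAtZero L (hg := hg)]
      change germComp L' (b * germComp L (germAtZero g hg)) ∈ _
      rw [map_mul, hL]
      exact Ideal.mul_mem_left _ _ (Ideal.mem_span_singleton_self _)
    · refine Ideal.Quotient.lift_surjective_of_surjective _ _ ?_
      exact Ideal.Quotient.mk_surjective.comp fun ψ => ⟨germComp L ψ, hL ψ⟩

end GermRing

/-! ### Restriction to a hyperplane, dimension and depth -/

section GermDimension

open IsLocalRing

variable {n : ℕ}

theorem hasTaylor_coord (n : ℕ) :
    HasTaylor (MvPowerSeries.X 0) (fun z : Fin (n + 1) → ℂ => z 0) := by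
  classical
  have hcoeff : ∀ α : Fin (n + 1) →₀ ℕ, α ≠ Finsupp.single 0 1 →
      MvPowerSeries.coeff α (MvPowerSeries.X 0 : MvPowerSeries (Fin (n + 1)) ℂ) = 0 :=
    fun α hα => by rw [MvPowerSeries.coeff_X, if_neg hα]
  refine ⟨⟨1, one_pos, ?_⟩, Eventually.of_forall fun z => ?_⟩
  · rw [weightedNorm, tsum_eq_single (Finsupp.single 0 1) fun α hα => by simp [hcoeff α hα]]
    exact ENNReal.coe_ne_top
  · rw [tsum_eq_single (Finsupp.single 0 1) fun α hα => by rw [hcoeff α hα, zero_mul],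
      MvPowerSeries.coeff_X, if_pos rfl, one_mul, monom_single, pow_one]

theorem analyticAt_coord (i : Fin n) : AnalyticAt ℂ (fun z : Fin n → ℂ => z i) 0 :=
  (ContinuousLinearMap.proj (R := ℂ) (φ := fun _ : Fin n => ℂ) i).analyticAt 0

theorem coordGerm_eq (i : Fin n) :
    coordGerm i = germAtZero (fun z : Fin n → ℂ => z i) (analyticAt_coord i) := rfl

/-- Restriction of germs to the hyperplane `z_0 = 0`. -/
noncomputable def germRestrict (n : ℕ) : LocalAnalyticRing (n + 1) →ₐ[ℂ] LocalAnalyticRing n :=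
  germComp (consZeroCLM n)

theorem germRestrict_germComp_tail (φ : LocalAnalyticRing n) :
    germRestrict n (germComp (tailCLM n) φ) = φ := by
  obtain ⟨g, hg, rfl⟩ := φ.exists_germAtZero_eq
  rw [germComp_germAtZero, germRestrict, germComp_germAtZero, germAtZero_eq_iff]
  exact Eventually.of_forall fun z => congrArg g (tailCLM_consZeroCLM z)

theorem germRestrict_surjective : Function.Surjective (germRestrict n) :=
  fun φ => ⟨_, germRestrict_germComp_tail φ⟩

theorem germRestrict_coordGerm_zero : germRestrict n (coordGerm 0) = 0 := by
  rw [coordGerm_eq, germRestrict, germComp_germAtZero]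
  refine (germAtZero_eq_iff (hh := analyticAt_const)).mpr (Eventually.of_forall fun z => ?_)
  simp [consZeroCLM_apply]

theorem germRestrict_coordGerm_succ (i : Fin n) :
    germRestrict n (coordGerm i.succ) = coordGerm i := by
  rw [coordGerm_eq, germRestrict, germComp_germAtZero, coordGerm_eq, germAtZero_eq_iff]
  exact Eventually.of_forall fun z => by simp [consZeroCLM_apply]

/-- A germ that vanishes on the hyperplane `z_0 = 0` is divisible by `z_0`. -/
theorem germRestrict_eq_zero_iff {φ : LocalAnalyticRing (n + 1)} :
    germRestrict n φ = 0 ↔ φ ∈ Ideal.span {(coordGerm 0 : LocalAnalyticRing (n + 1))} := by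
  constructor
  · intro h
    -- division by `z_0`: the remainder does not depend on `z_0`, and is the restriction
    obtain ⟨q, R, hφ⟩ := exists_germ_division (d := 1)
      (analyticAt_coord 0) (hasTaylor_coord n)
      (fun j hj => by
        obtain rfl : j = 0 := by omega
        rw [MvPowerSeries.coeff_X, if_neg]
        rw [Finsupp.single_zero]
        exact fun h => by simpa using (DFunLike.congr_fun h 0).symm)
      (by rw [MvPowerSeries.coeff_X, if_pos rfl]; exact one_ne_zero) φ
    simp only [Fin.sum_univ_one, Fin.val_zero, pow_zero, mul_one] at hφ
    have h1 : R 0 = 0 := by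
      rw [← germRestrict_germComp_tail (R 0), ← h, hφ, map_add, map_mul]
      rw [← coordGerm_eq, germRestrict_coordGerm_zero, mul_zero, zero_add]
    rw [hφ, h1, map_zero, add_zero]
    exact Ideal.mul_mem_left _ _ (Ideal.mem_span_singleton_self _)
  · intro h
    obtain ⟨b, rfl⟩ := Ideal.mem_span_singleton'.mp h
    rw [map_mul, germRestrict_coordGerm_zero, mul_zero]

theorem ker_germRestrict :
    RingHom.ker (germRestrict n) = Ideal.span {(coordGerm 0 : LocalAnalyticRing (n + 1))} :=
  Ideal.ext fun _ => germRestrict_eq_zero_iff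

/-- `z_0` is not a zero divisor, since the complement of the hyperplane `z_0 = 0` is dense. -/
theorem eq_zero_of_coordGerm_mul {φ : LocalAnalyticRing (n + 1)} (h : coordGerm 0 * φ = 0) :
    φ = 0 := by
  obtain ⟨g, hg, rfl⟩ := φ.exists_germAtZero_eq
  have h1 : ∀ᶠ z : Fin (n + 1) → ℂ in 𝓝 0, z 0 * g z = 0 :=
    germAtZero_eq_iff (hg := (analyticAt_coord 0).mul hg) (hh := analyticAt_const).mp h
  refine (germAtZero_eq_iff (hh := analyticAt_const)).mpr ?_
  filter_upwards [h1.eventually_nhds, hg.eventually_analyticAt] with z hz hga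
  by_cases hz0 : z 0 = 0
  · have ht : Tendsto (fun t : ℂ => z + Pi.single 0 t) (𝓝[≠] 0) (𝓝 z) := by
      have h2 : Continuous fun t : ℂ => z + Pi.single 0 t :=
        continuous_const.add (continuous_single (A := fun _ : Fin (n + 1) => ℂ) 0)
      exact (h2.tendsto' 0 z (by simp)).mono_left nhdsWithin_le_nhds
    refine tendsto_nhds_unique (hga.continuousAt.tendsto.comp ht) (tendsto_const_nhds.congr' ?_)
    filter_upwards [ht.eventually hz, self_mem_nhdsWithin] with t h3 ht0
    rw [Pi.add_apply, hz0, zero_add, Pi.single_eq_same] at h3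
    exact ((mul_eq_zero.mp h3).resolve_left ht0).symm
  · exact (mul_eq_zero.mp hz.self_of_nhds).resolve_left hz0

/-- The quotient of `𝒪_{n+1}` by an ideal containing `z_0`, computed on the hyperplane `z_0 = 0`. -/
noncomputable def quotientRestrictEquiv (J : Ideal (LocalAnalyticRing n)) :
    (LocalAnalyticRing (n + 1) ⧸ J.comap (germRestrict n)) ≃ₐ[ℂ] (LocalAnalyticRing n ⧸ J) :=
  AlgEquiv.ofBijective
    (Ideal.quotientMapₐ J (germRestrict n) le_rfl)
    ⟨Ideal.quotientMap_injective (f := (germRestrict n).toRingHom),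
      Ideal.quotientMap_surjective (f := (germRestrict n).toRingHom) (H := le_rfl)
        germRestrict_surjective⟩

theorem germDim_comap_germRestrict (J : Ideal (LocalAnalyticRing n)) :
    germDim (J.comap (germRestrict n)) = germDim J :=
  ringKrullDim_eq_of_ringEquiv (quotientRestrictEquiv J).toRingEquiv

theorem comap_germRestrict_map (J : Ideal (LocalAnalyticRing (n + 1))) :
    (J.map (germRestrict n)).comap (germRestrict n) = J ⊔ Ideal.span {coordGerm 0} := by
  rw [Ideal.comap_map_of_surjective _ germRestrict_surjective, ← ker_germRestrict]
  rfl

theorem span_coordGerm_eq_comap_bot :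
    Ideal.span {(coordGerm 0 : LocalAnalyticRing (n + 1))} =
      (⊥ : Ideal (LocalAnalyticRing n)).comap (germRestrict n) := by
  rw [← ker_germRestrict]; rfl

instance : IsLocalHom (germRestrict n) :=
  ⟨(IsLocalHom.of_surjective (germRestrict n).toRingHom germRestrict_surjective).map_nonunit⟩

/-- Depth only depends on the quotient ring: it may be computed after a surjection. -/
theorem DepthGE.comap {R S : Type} [CommRing R] [IsLocalRing R] [CommRing S] [IsLocalRing S]
    {F : Type*} [FunLike F R S] [RingHomClass F R S] (f : F) [IsLocalHom f]
    (hf : Function.Surjective f) : ∀ {d : ℕ} {J : Ideal S}, DepthGE d J → DepthGE d (J.comap f)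
  | 0, _, _ => trivial
  | d + 1, J, ⟨x, hxm, hx, hd⟩ => by
    obtain ⟨y, rfl⟩ := hf x
    refine ⟨y, ?_, fun r hr => ?_, ?_⟩
    · rw [mem_maximalIdeal, mem_nonunits_iff] at hxm ⊢
      exact fun h => hxm (h.map f)
    · rw [Ideal.mem_comap, map_mul] at hr
      exact hx _ hr
    · have := DepthGE.comap f hf hd
      convert this using 1
      ext r
      rw [Ideal.mem_comap, Ideal.mem_sup_span_singleton', Ideal.mem_sup_span_singleton']
      simp only [Ideal.mem_comap, map_sub, map_mul, hf.exists]

/-- The coordinates form a regular sequence. -/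
theorem depthGE_localAnalyticRing : ∀ m : ℕ, DepthGE m (⊥ : Ideal (LocalAnalyticRing m))
  | 0 => trivial
  | n + 1 => by
    refine ⟨coordGerm 0, coordGerm_mem_maximalIdeal 0, fun r hr => ?_, ?_⟩
    · exact eq_zero_of_coordGerm_mul hr
    · rw [bot_sup_eq, span_coordGerm_eq_comap_bot]
      exact (depthGE_localAnalyticRing n).comap (germRestrict n) germRestrict_surjective

/-- `dim 𝒪_m = m`, as each coordinate lowers the dimension by one. -/
theorem germDim_bot : ∀ m : ℕ, germDim (⊥ : Ideal (LocalAnalyticRing m)) = m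
  | 0 => by
    have h := maximalIdeal_eq_bot_zero
    have : (⊥ : Ideal (LocalAnalyticRing 0)).IsMaximal := h ▸ inferInstance
    let := Ideal.Quotient.field (⊥ : Ideal (LocalAnalyticRing 0))
    exact ringKrullDim_eq_zero_of_field _
  | n + 1 => by
    have h1 := ringKrullDim_quotient_span_singleton_succ_eq_ringKrullDim
      (x := (coordGerm 0 : LocalAnalyticRing (n + 1)))
      (fun a b hab => sub_eq_zero.mp (eq_zero_of_coordGerm_mul (by
        rw [mul_sub, sub_eq_zero]; exact hab))) (coordGerm_mem_maximalIdeal 0)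
    have h2 : ringKrullDim (LocalAnalyticRing (n + 1) ⧸ Ideal.span {(coordGerm 0 : LocalAnalyticRing (n + 1))})
        = n := by
      rw [span_coordGerm_eq_comap_bot]
      exact (germDim_comap_germRestrict _).trans (germDim_bot n)
    rw [germDim, ringKrullDim_eq_of_ringEquiv (RingEquiv.quotientBot _), ← h1, h2]
    push_cast
    rfl

theorem germDim_span_coordGerm_zero :
    germDim (Ideal.span {(coordGerm 0 : LocalAnalyticRing (n + 1))}) = n := by
  rw [span_coordGerm_eq_comap_bot, germDim_comap_germRestrict, germDim_bot]

theorem span_coordGerm_pair :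
    Ideal.span {(coordGerm 0 : LocalAnalyticRing (n + 2)), coordGerm 1} =
      (Ideal.span {(coordGerm 0 : LocalAnalyticRing (n + 1))}).comap (germRestrict (n + 1)) := by
  have h : (coordGerm 0 : LocalAnalyticRing (n + 1)) = germRestrict (n + 1) (coordGerm 1) :=
    (germRestrict_coordGerm_succ 0).symm
  have h2 : Ideal.span {(coordGerm 0 : LocalAnalyticRing (n + 1))} =
      (Ideal.span {(coordGerm 1 : LocalAnalyticRing (n + 2))}).map (germRestrict (n + 1)) := by
    rw [Ideal.map_span, Set.image_singleton, h]
  rw [h2, comap_germRestrict_map, sup_comm, ← Ideal.span_union]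
  rfl

theorem germDim_span_coordGerm_pair :
    germDim (Ideal.span {(coordGerm 0 : LocalAnalyticRing (n + 2)), coordGerm 1}) = n := by
  rw [span_coordGerm_pair, germDim_comap_germRestrict, germDim_span_coordGerm_zero]

/-- The maximal ideal of `𝒪_m` is generated by the coordinates. -/
theorem maximalIdeal_eq_span_coordGerm : ∀ m : ℕ,
    maximalIdeal (LocalAnalyticRing m) = Ideal.span (Set.range coordGerm)
  | 0 => by
    rw [maximalIdeal_eq_bot_zero, Set.range_eq_empty, Ideal.span_empty]
  | n + 1 => by
    refine le_antisymm (fun φ hφ => ?_) ?_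
    · have h1 : germRestrict n φ ∈ maximalIdeal (LocalAnalyticRing n) := by
        rw [mem_maximalIdeal, mem_nonunits_iff] at hφ ⊢
        exact fun h => hφ (isUnit_of_map_unit (germRestrict n) φ h)
      rw [maximalIdeal_eq_span_coordGerm n] at h1
      have h2 : Set.range (coordGerm : Fin n → LocalAnalyticRing n) =
          germRestrict n '' Set.range fun i : Fin n => coordGerm i.succ := by
        rw [← Set.range_comp]
        exact congrArg Set.range (funext fun i => (germRestrict_coordGerm_succ i).symm)
      rw [h2, ← Ideal.map_span, ← Ideal.mem_comap, comap_germRestrict_map] at h1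
      refine (sup_le ?_ ?_ : _ ≤ Ideal.span (Set.range coordGerm)) h1
      · refine Ideal.span_mono ?_
        rintro _ ⟨i, rfl⟩
        exact ⟨_, rfl⟩
      · exact Ideal.span_mono (Set.singleton_subset_iff.mpr ⟨0, rfl⟩)
    · rw [Ideal.span_le]
      rintro _ ⟨i, rfl⟩
      exact coordGerm_mem_maximalIdeal i

end GermDimension

/-! ### Partial derivatives and the chain rule along arcs -/

section Derivations

open IsLocalRing

variable {m : ℕ}

theorem partialDeriv_congr {g h : (Fin m → ℂ) → ℂ} (hgh : g =ᶠ[𝓝 0] h) (i : Fin m) :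
    partialDeriv g i =ᶠ[𝓝 0] partialDeriv h i :=
  hgh.fderiv.mono fun _ hz => congrArg (fun L : (Fin m → ℂ) →L[ℂ] ℂ => L (Pi.single i 1)) hz

/-- The partial derivative `∂/∂z_i` of germs. -/
noncomputable def germDeriv (i : Fin m) (φ : LocalAnalyticRing m) : LocalAnalyticRing m :=
  germAtZero (partialDeriv φ.exists_germAtZero_eq.choose i)
    (analyticAt_partialDeriv φ.exists_germAtZero_eq.choose_spec.choose i)

theorem germDeriv_germAtZero (i : Fin m) {g : (Fin m → ℂ) → ℂ} (hg : AnalyticAt ℂ g 0) :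
    germDeriv i (germAtZero g hg) = germAtZero (partialDeriv g i) (analyticAt_partialDeriv hg i) :=
  germAtZero_eq_iff.mpr (partialDeriv_congr (germAtZero_eq_iff.mp
    (germAtZero g hg).exists_germAtZero_eq.choose_spec.choose_spec) i)

theorem germDeriv_add (i : Fin m) (φ ψ : LocalAnalyticRing m) :
    germDeriv i (φ + ψ) = germDeriv i φ + germDeriv i ψ := by
  obtain ⟨g, hg, rfl⟩ := φ.exists_germAtZero_eq
  obtain ⟨h, hh, rfl⟩ := ψ.exists_germAtZero_eq
  rw [germDeriv_germAtZero, germDeriv_germAtZero]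
  refine (germDeriv_germAtZero i (hg.add hh)).trans (germAtZero_eq_iff (hh :=
    (analyticAt_partialDeriv hg i).add (analyticAt_partialDeriv hh i)).mpr ?_)
  filter_upwards [hg.eventually_analyticAt, hh.eventually_analyticAt] with z h1 h2
  rw [partialDeriv, fderiv_add h1.differentiableAt h2.differentiableAt]
  rfl

theorem germDeriv_mul (i : Fin m) (φ ψ : LocalAnalyticRing m) :
    germDeriv i (φ * ψ) = φ * germDeriv i ψ + ψ * germDeriv i φ := by
  obtain ⟨g, hg, rfl⟩ := φ.exists_germAtZero_eq
  obtain ⟨h, hh, rfl⟩ := ψ.exists_germAtZero_eq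
  rw [germDeriv_germAtZero, germDeriv_germAtZero]
  refine (germDeriv_germAtZero i (hg.mul hh)).trans (germAtZero_eq_iff (hh :=
    (hg.mul (analyticAt_partialDeriv hh i)).add (hh.mul (analyticAt_partialDeriv hg i))).mpr ?_)
  filter_upwards [hg.eventually_analyticAt, hh.eventually_analyticAt] with z h1 h2
  rw [partialDeriv, fderiv_mul h1.differentiableAt h2.differentiableAt]
  rfl

theorem germDeriv_algebraMap (i : Fin m) (c : ℂ) :
    germDeriv i (algebraMap ℂ (LocalAnalyticRing m) c) = 0 := by
  refine (germDeriv_germAtZero i analyticAt_const).trans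
    ((germAtZero_eq_iff (hh := analyticAt_const)).mpr (Eventually.of_forall fun z => ?_))
  simp [partialDeriv]

theorem germDeriv_coordGerm (i j : Fin m) :
    germDeriv i (coordGerm j) = if i = j then 1 else 0 := by
  have h : ∀ z, partialDeriv (fun z : Fin m → ℂ => z j) i z = if i = j then 1 else 0 := by
    intro z
    have h1 : HasFDerivAt (fun z : Fin m → ℂ => z j)
      (ContinuousLinearMap.proj (R := ℂ) (φ := fun _ : Fin m => ℂ) j) z :=
      (ContinuousLinearMap.proj (R := ℂ) (φ := fun _ : Fin m => ℂ) j).hasFDerivAt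
    rw [partialDeriv, h1.fderiv]
    show (Pi.single i 1 : Fin m → ℂ) j = _
    rw [Pi.single_apply]
    simp only [eq_comm]
  rw [coordGerm_eq, germDeriv_germAtZero]
  split_ifs with hij
  · exact (germAtZero_eq_iff (hh := analyticAt_const)).mpr
      (Eventually.of_forall fun z => by rw [h, if_pos hij])
  · exact (germAtZero_eq_iff (hh := analyticAt_const)).mpr
      (Eventually.of_forall fun z => by rw [h, if_neg hij])

theorem powerSeries_eq_zero_of_forall_X_pow_dvd {φ : PowerSeries ℂ}
    (h : ∀ k : ℕ, PowerSeries.X ^ k ∣ φ) : φ = 0 := by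
  ext k
  exact PowerSeries.X_pow_dvd_iff.mp (h (k + 1)) k k.lt_succ_self

/-- The chain rule along a formal arc. The difference of the two sides is a derivation that kills
the coordinates, hence is divisible by all powers of the parameter. -/
theorem derivative_arc (φ : LocalAnalyticRing m →+* PowerSeries ℂ)
    (hX : ∀ h ∈ maximalIdeal (LocalAnalyticRing m), PowerSeries.X ∣ φ h)
    (hC : ∀ c, φ (algebraMap ℂ _ c) = PowerSeries.C c) (h : LocalAnalyticRing m) :
    PowerSeries.derivative ℂ (φ h) =
      ∑ i, φ (germDeriv i h) * PowerSeries.derivative ℂ (φ (coordGerm i)) := by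
  let E : LocalAnalyticRing m → PowerSeries ℂ := fun h => PowerSeries.derivative ℂ (φ h) -
    ∑ i, φ (germDeriv i h) * PowerSeries.derivative ℂ (φ (coordGerm i))
  have hadd : ∀ g h, E (g + h) = E g + E h := by
    intro g h
    simp only [E, map_add, germDeriv_add, add_mul, Finset.sum_add_distrib]
    ring
  -- `E` is a derivation along `φ`
  have hmul : ∀ g h, E (g * h) = φ g * E h + φ h * E g := by
    intro g h
    simp only [E, map_mul, germDeriv_mul, map_add, add_mul, Finset.sum_add_distrib, mul_sub,
      Finset.mul_sum, Derivation.leibniz, smul_eq_mul, mul_assoc]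
    ring
  have hconst : ∀ c : ℂ, E (algebraMap ℂ _ c) = 0 := by
    intro c
    simp only [E, germDeriv_algebraMap, hC, map_zero, zero_mul, Finset.sum_const_zero, sub_zero]
    exact PowerSeries.derivative_C
  have hcoord : ∀ j, E (coordGerm j) = 0 := by
    intro j
    simp only [E, germDeriv_coordGerm]
    rw [Finset.sum_eq_single j]
    · simp
    · intro i _ hij; simp [hij]
    · simp
  -- a derivation that kills constants and coordinates gains one power of the parameter at a time
  have hdvd : ∀ k : ℕ, ∀ h, PowerSeries.X ^ k ∣ E h := by
    intro k
    induction k with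
    | zero => simp
    | succ k ih =>
      have hm : ∀ h ∈ Ideal.span (Set.range (coordGerm (m := m))), PowerSeries.X ^ (k + 1) ∣ E h := by
        intro h hh
        refine Submodule.span_induction ?_ ?_ ?_ ?_ hh
        · rintro _ ⟨j, rfl⟩
          rw [hcoord]; exact dvd_zero _
        · have := hconst 0
          rw [map_zero] at this
          rw [this]; exact dvd_zero _
        · intro a b _ _ ha hb
          rw [hadd]; exact dvd_add ha hb
        · intro a b hb hdb
          rw [smul_eq_mul, hmul]
          refine dvd_add (hdb.mul_left _) ?_
          rw [pow_succ']
          refine mul_dvd_mul (hX b ?_) (ih a)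
          rwa [maximalIdeal_eq_span_coordGerm]
      intro h
      rw [← sub_add_cancel h (algebraMap ℂ _ (evalAtZero m h)), hadd, hconst, add_zero]
      refine hm _ ?_
      rw [← maximalIdeal_eq_span_coordGerm]
      exact sub_algebraMap_mem_maximalIdeal h
  exact sub_eq_zero.mp (powerSeries_eq_zero_of_forall_X_pow_dvd fun k => hdvd k h)

/-- In characteristic zero, differentiation lowers the order of a series without constant term by
exactly one (including `⊤ + 1 = ⊤`). -/
theorem order_derivative_add_one {φ : PowerSeries ℂ} (h : PowerSeries.X ∣ φ) :
    (PowerSeries.derivative ℂ φ).order + 1 = φ.order := by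
  by_cases h0 : φ = 0
  · simp [h0]
  obtain ⟨k, hk⟩ := ENat.ne_top_iff_exists.mp (fun h1 => h0 (PowerSeries.order_eq_top.mp h1))
  obtain ⟨h1, h2⟩ := PowerSeries.order_eq.mp hk.symm
  have hk0 : k ≠ 0 := by
    rintro rfl
    exact h1 0 rfl (by simpa using PowerSeries.X_dvd_iff.mp h)
  obtain ⟨k, rfl⟩ := Nat.exists_eq_succ_of_ne_zero hk0
  have : (PowerSeries.derivative ℂ φ).order = (k : ℕ∞) := by
    refine PowerSeries.order_eq.mpr ⟨fun i hi => ?_, fun i hi => ?_⟩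
    · rw [Nat.cast_inj] at hi
      subst hi
      rw [PowerSeries.coeff_derivative]
      exact mul_ne_zero (h1 _ rfl) (Nat.cast_add_one_ne_zero i)
    · rw [Nat.cast_lt] at hi
      rw [PowerSeries.coeff_derivative, h2 _ (by exact_mod_cast Nat.succ_lt_succ hi), zero_mul]
  rw [this, ← hk]
  rfl

theorem eq_zero_of_derivative_eq_zero {φ : PowerSeries ℂ} (h : PowerSeries.X ∣ φ)
    (hd : PowerSeries.derivative ℂ φ = 0) : φ = 0 := by
  rw [← PowerSeries.order_eq_top, ← order_derivative_add_one h, hd, PowerSeries.order_zero]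
  rfl

theorem length_quotient_sup_span {R : Type} [CommRing R] (q : Ideal R) (a : R) :
    Module.length R (R ⧸ (q ⊔ Ideal.span {a})) =
      Module.length (R ⧸ q) ((R ⧸ q) ⧸ Ideal.span {Ideal.Quotient.mk q a}) := by
  rw [← Module.length_eq_of_surjective (S := R) (R := R ⧸ q) Ideal.Quotient.mk_surjective]
  have h : Ideal.span {Ideal.Quotient.mk q a} = (Ideal.span {a}).map (Ideal.Quotient.mk q) := by
    rw [Ideal.map_span, Set.image_singleton]
  rw [h]
  exact (DoubleQuot.quotQuotEquivQuotSupₐ R q (Ideal.span {a})).toLinearEquiv.length_eq.symm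

end Derivations

/-! ### Branches of the curve cut out on the polar surface by `z_0` -/

section CurveLemma

open IsLocalRing

variable {n : ℕ}

instance {R : Type*} [CommRing R] [IsLocalRing R] (q : Ideal R) [q.IsPrime] : IsLocalRing (R ⧸ q) :=
  .of_surjective' (Ideal.Quotient.mk q) Ideal.Quotient.mk_surjective

theorem mk_mem_maximalIdeal {R : Type*} [CommRing R] [IsLocalRing R] (q : Ideal R) [q.IsPrime]
    {h : R} (hh : h ∈ maximalIdeal R) : Ideal.Quotient.mk q h ∈ maximalIdeal (R ⧸ q) := by
  have : IsLocalHom (Ideal.Quotient.mk q) :=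
    IsLocalHom.of_surjective _ Ideal.Quotient.mk_surjective
  rw [mem_maximalIdeal, mem_nonunits_iff] at hh ⊢
  exact fun hu => hh (isUnit_of_map_unit (Ideal.Quotient.mk q) _ hu)

theorem exists_sub_algebraMap_mem {m : ℕ} (q : Ideal (LocalAnalyticRing m)) [q.IsPrime]
    (b : LocalAnalyticRing m ⧸ q) :
    ∃ c : ℂ, b - algebraMap ℂ _ c ∈ maximalIdeal (LocalAnalyticRing m ⧸ q) := by
  obtain ⟨b, rfl⟩ := Ideal.Quotient.mk_surjective b
  exact ⟨evalAtZero m b, mk_mem_maximalIdeal q (sub_algebraMap_mem_maximalIdeal b)⟩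

theorem IsArc.X_dvd_mk {m : ℕ} {q : Ideal (LocalAnalyticRing m)} [q.IsPrime]
    {ψ : LocalAnalyticRing m ⧸ q →+* PowerSeries ℂ} (hψ : IsArc ψ) {h : LocalAnalyticRing m}
    (hh : h ∈ maximalIdeal (LocalAnalyticRing m)) : PowerSeries.X ∣ ψ (Ideal.Quotient.mk q h) :=
  hψ.X_dvd _ (mk_mem_maximalIdeal q hh)

/-- Along an arc in the hyperplane `z_0 = 0` on which `∂f/∂z_i = 0` for `i ≥ 2`, the chain rule
reads `d f = (∂f/∂z_1) d z_1`. -/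
theorem derivative_arc_polar {f : (Fin (n + 2) → ℂ) → ℂ} (hf : AnalyticAt ℂ f 0)
    {q : Ideal (LocalAnalyticRing (n + 2))} [q.IsPrime] (hI : polarIdeal f hf ≤ q)
    (hx : coordGerm 0 ∈ q) {ψ : LocalAnalyticRing (n + 2) ⧸ q →+* PowerSeries ℂ} (hψ : IsArc ψ) :
    PowerSeries.derivative ℂ (ψ (Ideal.Quotient.mk q (germAtZero f hf))) =
      ψ (Ideal.Quotient.mk q (germAtZero (partialDeriv f 1) (analyticAt_partialDeriv hf 1))) *
        PowerSeries.derivative ℂ (ψ (Ideal.Quotient.mk q (coordGerm 1))) := by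
  have h := derivative_arc (ψ.comp (Ideal.Quotient.mk q))
    (fun h hh => hψ.X_dvd_mk hh)
    (fun c => hψ.algebraMap c) (germAtZero f hf)
  simp only [RingHom.comp_apply] at h
  rw [h, Fin.sum_univ_succ, Fin.sum_univ_succ, Finset.sum_eq_zero, add_zero]
  · rw [Ideal.Quotient.eq_zero_iff_mem.mpr hx, map_zero, map_zero, mul_zero, zero_add,
      germDeriv_germAtZero]
    rfl
  · intro i _
    have h1 : germDeriv i.succ.succ (germAtZero f hf) ∈ q := by
      refine hI (Ideal.subset_span ⟨i.succ.succ, ?_, germDeriv_germAtZero _ hf⟩)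
      simp
    rw [Ideal.Quotient.eq_zero_iff_mem.mpr h1, map_zero, zero_mul]

/-- A curve in `V(z_0, ∂f/∂z_2, …, ∂f/∂z_n)` not in `V(∂f/∂z_1)` lies in `V(f)` exactly when it lies
in `V(z_1)`. -/
theorem germ_mem_iff_coordGerm_mem {f : (Fin (n + 2) → ℂ) → ℂ} (hf : AnalyticAt ℂ f 0)
    (hf0 : f 0 = 0) {q : Ideal (LocalAnalyticRing (n + 2))} [q.IsPrime]
    [Ring.KrullDimLE 1 (LocalAnalyticRing (n + 2) ⧸ q)] (hq : q ≠ maximalIdeal _)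
    (hI : polarIdeal f hf ≤ q) (hx : coordGerm 0 ∈ q)
    (hfy : germAtZero (partialDeriv f 1) (analyticAt_partialDeriv hf 1) ∉ q) :
    germAtZero f hf ∈ q ↔ coordGerm 1 ∈ q := by
  have hfield : ¬ IsField (LocalAnalyticRing (n + 2) ⧸ q) := fun h =>
    hq (IsLocalRing.eq_maximalIdeal (Ideal.Quotient.maximal_of_isField q h))
  obtain ⟨ψ, hψ⟩ := exists_isArc (exists_sub_algebraMap_mem q) hfield
  have hd := derivative_arc_polar hf hI hx hψ
  have hinj : ∀ a, ψ (Ideal.Quotient.mk q a) = 0 ↔ a ∈ q := fun a => by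
    rw [map_eq_zero_iff ψ hψ.injective, Ideal.Quotient.eq_zero_iff_mem]
  rw [← hinj, ← hinj]
  constructor
  · intro h
    rw [h, map_zero] at hd
    exact eq_zero_of_derivative_eq_zero (IsArc.X_dvd_mk hψ (coordGerm_mem_maximalIdeal 1))
      ((mul_eq_zero.mp hd.symm).resolve_left fun h1 => hfy ((hinj _).mp h1))
  · intro h
    rw [h, map_zero, mul_zero] at hd
    exact eq_zero_of_derivative_eq_zero (IsArc.X_dvd_mk hψ
      (mem_maximalIdeal_iff_evalAtZero.mpr hf0)) hd

/-- On a curve in `V(z_0, ∂f/∂z_2, …, ∂f/∂z_n)` outside of `V(∂f/∂z_1)` and `V(z_1)`, the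
intersection number with `V(f)` is the sum of those with `V(∂f/∂z_1)` and `V(z_1)`. -/
theorem lengthInt_quotient_germ_eq_add {f : (Fin (n + 2) → ℂ) → ℂ} (hf : AnalyticAt ℂ f 0)
    (hf0 : f 0 = 0) {q : Ideal (LocalAnalyticRing (n + 2))} [q.IsPrime]
    [Ring.KrullDimLE 1 (LocalAnalyticRing (n + 2) ⧸ q)] (hq : q ≠ maximalIdeal _)
    (hI : polarIdeal f hf ≤ q) (hx : coordGerm 0 ∈ q)
    (hfy : germAtZero (partialDeriv f 1) (analyticAt_partialDeriv hf 1) ∉ q)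
    (hy : coordGerm 1 ∉ q) :
    lengthInt (LocalAnalyticRing (n + 2))
        (LocalAnalyticRing (n + 2) ⧸ (q ⊔ Ideal.span {germAtZero f hf})) =
      lengthInt (LocalAnalyticRing (n + 2)) (LocalAnalyticRing (n + 2) ⧸
          (q ⊔ Ideal.span {germAtZero (partialDeriv f 1) (analyticAt_partialDeriv hf 1)})) +
        lengthInt (LocalAnalyticRing (n + 2))
          (LocalAnalyticRing (n + 2) ⧸ (q ⊔ Ideal.span {coordGerm 1})) := by
  let B := LocalAnalyticRing (n + 2) ⧸ q
  have hfq := (germ_mem_iff_coordGerm_mem hf hf0 hq hI hx hfy).not.mpr hy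
  have hne : ∀ {a}, a ∉ q → Ideal.Quotient.mk q a ≠ 0 :=
    fun ha h => ha (Ideal.Quotient.eq_zero_iff_mem.mp h)
  have hfin : ∀ {a}, a ∉ q → Module.length B (B ⧸ Ideal.span {Ideal.Quotient.mk q a}) ≠ ⊤ :=
    fun ha => Module.length_ne_top_iff.mpr
      (isFiniteLength_quotient_span_singleton B (mem_nonZeroDivisors_of_ne_zero (hne ha)))
  -- along each arc `ord f - 1 = ord (∂f/∂z_1) + (ord z_1 - 1)`, by the chain rule
  have h1 := length_quotient_eq_of_order_eq (exists_sub_algebraMap_mem q) (hne hfq)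
    (mul_ne_zero (hne hfy) (hne hy)) fun ψ hψ => by
      rw [map_mul, PowerSeries.order_mul,
        ← order_derivative_add_one (IsArc.X_dvd_mk hψ (mem_maximalIdeal_iff_evalAtZero.mpr hf0)),
        derivative_arc_polar hf hI hx hψ, PowerSeries.order_mul, add_assoc,
        order_derivative_add_one (IsArc.X_dvd_mk hψ (coordGerm_mem_maximalIdeal 1))]
  have h2 := Ring.ord_mul B (a := Ideal.Quotient.mk q
    (germAtZero (partialDeriv f 1) (analyticAt_partialDeriv hf 1)))
    (mem_nonZeroDivisors_of_ne_zero (hne hy))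
  rw [lengthInt, lengthInt, lengthInt, length_quotient_sup_span, length_quotient_sup_span,
    length_quotient_sup_span, ← Nat.cast_add, ← ENat.toNat_add (hfin hfy) (hfin hy), h1]
  exact congrArg (fun l : ℕ∞ => (l.toNat : ℤ)) h2

end CurveLemma

/-! ### Proper intersections in Noetherian local rings -/

section LocalDimension

open IsLocalRing

variable {R : Type} [CommRing R] [IsLocalRing R] [IsNoetherianRing R]

/-- The maximal ideal is the only prime containing `J`; the zero locus of `J` is at most the closed
point. -/
def OnlyOrigin (J : Ideal R) : Prop := ∀ q : Ideal R, q.IsPrime → J ≤ q → q = maximalIdeal R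

omit [IsNoetherianRing R] in
theorem OnlyOrigin.mono {J K : Ideal R} (h : OnlyOrigin J) (hJK : J ≤ K) : OnlyOrigin K :=
  fun q hq hK => h q hq (hJK.trans hK)

theorem OnlyOrigin.isArtinianRing {J : Ideal R} (h : OnlyOrigin J) : IsArtinianRing (R ⧸ J) :=
  isArtinianRing_quotient_of_forall_prime fun q hq hJ => by rw [h q hq hJ]; infer_instance

/-- `dim R/J = 0` means that the zero locus of `J` is the closed point; it is not empty because the
zero ring has dimension `⊥`. -/
theorem ringKrullDim_quotient_eq_zero_iff {J : Ideal R} :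
    ringKrullDim (R ⧸ J) = 0 ↔ J ≠ ⊤ ∧ OnlyOrigin J := by
  constructor
  · intro h
    have hne : J ≠ ⊤ := by
      rintro rfl
      have : Subsingleton (R ⧸ (⊤ : Ideal R)) := Ideal.Quotient.subsingleton_iff.mpr rfl
      rw [ringKrullDim_eq_bot_of_subsingleton] at h
      exact absurd h (by decide)
    refine ⟨hne, fun q hq hJ => ?_⟩
    have h0 : Ring.KrullDimLE 0 (R ⧸ J) := Ring.krullDimLE_iff.mpr (by rw [h]; rfl)
    have hsurj := Ideal.Quotient.mk_surjective (I := J)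
    have hker : RingHom.ker (Ideal.Quotient.mk J) ≤ q := by rwa [Ideal.mk_ker]
    have hq' : (q.map (Ideal.Quotient.mk J)).IsPrime := Ideal.map_isPrime_of_surjective hsurj hker
    have hmax := Ring.krullDimLE_zero_iff.mp h0 _ hq'
    have hcomap : (q.map (Ideal.Quotient.mk J)).comap (Ideal.Quotient.mk J) = q := by
      rw [Ideal.comap_map_of_surjective' _ hsurj, sup_eq_left]
      exact hker
    have := Ideal.comap_isMaximal_of_surjective (Ideal.Quotient.mk J) hsurj
      (K := q.map (Ideal.Quotient.mk J))
    rw [hcomap] at this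
    exact IsLocalRing.eq_maximalIdeal this
  · rintro ⟨hne, h⟩
    have := h.isArtinianRing
    have : Nontrivial (R ⧸ J) := Ideal.Quotient.nontrivial_iff.mpr hne
    have h0 : Ring.KrullDimLE 0 (R ⧸ J) := isArtinianRing_iff_krullDimLE_zero.mp inferInstance
    exact le_antisymm (Ring.krullDimLE_iff.mp h0) ringKrullDim_nonneg_of_nontrivial

omit [IsLocalRing R] [IsNoetherianRing R] in
theorem ringKrullDim_quotient_add_one_le {p q : Ideal R} [p.IsPrime] (h : p < q) :
    ringKrullDim (R ⧸ q) + 1 ≤ ringKrullDim (R ⧸ p) := by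
  obtain ⟨a, haq, hap⟩ := SetLike.exists_of_lt h
  exact ringKrullDim_succ_le_of_surjective (Ideal.Quotient.factor h.le)
    (Ideal.Quotient.factor_surjective h.le) (r := Ideal.Quotient.mk p a)
    (mem_nonZeroDivisors_of_ne_zero (by rwa [Ne, Ideal.Quotient.eq_zero_iff_mem]))
    (by rw [Ideal.Quotient.factor_mk]; exact Ideal.Quotient.eq_zero_iff_mem.mpr haq)

/-- A nonminimal prime over `J` has dimension at most `d` when `V(J)` is cut down to the origin by
`d + 1` elements. -/
theorem ringKrullDim_le_of_not_minimal {J q : Ideal R} [q.IsPrime] (hJ : J ≤ q)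
    (hq : q ∉ J.minimalPrimes) {d : ℕ} (S : Finset R) (hcard : S.card ≤ d + 1)
    (hS : ∀ s ∈ S, s ∈ maximalIdeal R) (h : OnlyOrigin (J ⊔ Ideal.span S)) :
    ringKrullDim (R ⧸ q) ≤ d := by
  obtain ⟨p, hp, hpq⟩ := Ideal.exists_minimalPrimes_le hJ
  have hpp : p.IsPrime := hp.1.1
  have h1 := ringKrullDim_quotient_add_one_le (hpq.lt_of_ne fun h => hq (h ▸ hp))
  have h2 := ringKrullDim_quotient_le_card (p := p) S hS fun r hr hpr hSr =>
    h r hr (sup_le (hp.1.2.trans hpr) (Ideal.span_le.mpr hSr))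
  have h3 : ringKrullDim (R ⧸ q) + 1 ≤ (d : WithBot ℕ∞) + 1 :=
    h1.trans (h2.trans (by exact_mod_cast hcard))
  exact ENat.WithBot.add_le_add_one_right_iff.mp h3

omit [IsLocalRing R] in
/-- Minimal primes over `J` are associated primes of `R/J`. -/
theorem isAssociatedTo_of_mem_minimalPrimes {J p : Ideal R} (hp : p ∈ J.minimalPrimes) :
    IsAssociatedTo J p := by
  rw [isAssociatedTo_iff]
  refine Module.associatedPrimes.minimalPrimes_annihilator_subset_associatedPrimes R (R ⧸ J) ?_
  rwa [Ideal.annihilator_quotient]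

omit [IsLocalRing R] in
/-- The index vanishes on components inside the hypersurface `V(a)`. This matches the convention that
the product with such a component is zero. -/
theorem herbrandIndex_quotient_of_mem {lam : (M : Type) → [AddCommGroup M] → [Module R M] → ℤ}
    {J q : Ideal R} {a : R} (ha : a ∈ q) (hJ : J ≤ q)
    (h : IsAdditiveOn (J ⊔ Ideal.span {a}) lam) : herbrandIndex lam a (R ⧸ q) = 0 :=
  (h.mono (sup_le hJ ((Ideal.span_singleton_le_iff_mem _).mpr ha))).herbrand_eq_zero a _
    (by rw [Ideal.annihilator_quotient])

theorem OnlyOrigin.isAdditiveOn {J : Ideal R} (h : OnlyOrigin J) : IsAdditiveOn J (lengthInt R) :=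
  have := h.isArtinianRing
  isAdditiveOn_lengthInt J

/-- The points of a curve do not contribute to the index of a hypersurface that meets it properly. -/
theorem herbrandIndex_quotient_eq_zero {J q : Ideal R} [q.IsPrime] {b : R}
    (hb : b ∈ maximalIdeal R) (h : OnlyOrigin (J ⊔ Ideal.span {b})) (hJ : J ≤ q)
    (hq : q ∉ J.minimalPrimes) : herbrandIndex (lengthInt R) b (R ⧸ q) = 0 := by
  have h1 := ringKrullDim_le_of_not_minimal (d := 0) hJ hq {b} (by simp) (by simpa)
    (by simpa using h)
  have h2 := ringKrullDim_quotient_eq_zero_iff.mp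
    (le_antisymm h1 ringKrullDim_nonneg_of_nontrivial)
  refine herbrandIndex_quotient_of_mem ?_ hJ h.isAdditiveOn
  rw [h2.2 q inferInstance le_rfl]
  exact hb

/-- The curves and points of a surface do not contribute to the iterated index of two hypersurfaces
that meet it properly. -/
theorem herbrandIndex_herbrandIndex_quotient_eq_zero {I q : Ideal R} [q.IsPrime] {a b : R}
    (ha : a ∈ maximalIdeal R) (hb : b ∈ maximalIdeal R)
    (h : OnlyOrigin (I ⊔ Ideal.span {a} ⊔ Ideal.span {b})) (hI : I ≤ q)
    (hq : q ∉ I.minimalPrimes) :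
    herbrandIndex (herbrandIndex (lengthInt R) b) a (R ⧸ q) = 0 := by
  classical
  by_cases haq : a ∈ q
  · exact herbrandIndex_quotient_of_mem haq hI h.isAdditiveOn.herbrand
  have h1 := ringKrullDim_le_of_not_minimal (d := 1) hI hq {a, b} Finset.card_le_two
    (by rintro s hs; rcases Finset.mem_insert.mp hs with rfl | hs
        · exact ha
        · rwa [Finset.mem_singleton.mp hs]) (by
      convert h using 1
      rw [sup_assoc, ← Ideal.span_union, Finset.coe_pair]
      rfl)
  -- `V(q)` is at most a curve, so `V(q, a)` is at most a point, and the index of `b` there is zero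
  have h2 : OnlyOrigin (q ⊔ Ideal.span {a}) := by
    intro r hr hqr
    have hlt : q < r := (le_sup_left.trans hqr).lt_of_ne fun h3 => haq (h3 ▸ hqr
      (Ideal.mem_sup_right (Ideal.mem_span_singleton_self a)))
    have h4 : ringKrullDim (R ⧸ r) + 1 ≤ (0 : WithBot ℕ∞) + 1 :=
      (ringKrullDim_quotient_add_one_le hlt).trans (by simpa using h1)
    exact (ringKrullDim_quotient_eq_zero_iff.mp (le_antisymm
      (ENat.WithBot.add_le_add_one_right_iff.mp h4) ringKrullDim_nonneg_of_nontrivial)).2 r hr le_rfl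
  rw [(h.isAdditiveOn.herbrand.mono (sup_le_sup_right hI _)).herbrand_quotient]
  · exact h2.isAdditiveOn.herbrand_eq_zero b _ (by rw [Ideal.annihilator_quotient])
  · exact fun r hr => ((‹q.IsPrime›.mem_or_mem hr).resolve_left haq)

omit [IsLocalRing R] in
theorem finite_minimalPrimes_primeSpectrum (J : Ideal R) :
    {p : PrimeSpectrum R | p.asIdeal ∈ J.minimalPrimes}.Finite :=
  (Ideal.finite_minimalPrimes_of_isNoetherianRing R J).preimage fun _ _ _ _ h => PrimeSpectrum.ext h

/-- The minimal primes over `J`, as points of the spectrum. -/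
noncomputable def minimalPrimesFinset (R : Type) [CommRing R] [IsNoetherianRing R] (J : Ideal R) :
    Finset (PrimeSpectrum R) :=
  (finite_minimalPrimes_primeSpectrum J).toFinset

omit [IsLocalRing R] in
theorem mem_minimalPrimesFinset {J : Ideal R} {p : PrimeSpectrum R} :
    p ∈ minimalPrimesFinset R J ↔ p.asIdeal ∈ J.minimalPrimes :=
  (finite_minimalPrimes_primeSpectrum J).mem_toFinset

/-- The index of `V(J)` is the sum over its components, with multiplicities. -/
theorem herbrandIndex_eq_sum {J : Ideal R} {b : R} (hb : b ∈ maximalIdeal R)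
    (h : OnlyOrigin (J ⊔ Ideal.span {b})) :
    herbrandIndex (lengthInt R) b (R ⧸ J) = ∑ p ∈ minimalPrimesFinset R J,
      (multAt p (R ⧸ J) : ℤ) * herbrandIndex (lengthInt R) b (R ⧸ p.asIdeal) :=
  h.isAdditiveOn.herbrand.eq_sum_minimalPrimes _ (fun _ => mem_minimalPrimesFinset)
    (fun _ hJ hq => herbrandIndex_quotient_eq_zero hb h hJ (mem_minimalPrimesFinset.not.mp hq)) _
    (by rw [Ideal.annihilator_quotient])

theorem herbrandIndex_herbrandIndex_eq_sum {I : Ideal R} {a b : R} (ha : a ∈ maximalIdeal R)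
    (hb : b ∈ maximalIdeal R) (h : OnlyOrigin (I ⊔ Ideal.span {a} ⊔ Ideal.span {b})) :
    herbrandIndex (herbrandIndex (lengthInt R) b) a (R ⧸ I) = ∑ p ∈ minimalPrimesFinset R I,
      (multAt p (R ⧸ I) : ℤ) *
        herbrandIndex (herbrandIndex (lengthInt R) b) a (R ⧸ p.asIdeal) :=
  h.isAdditiveOn.herbrand.herbrand.eq_sum_minimalPrimes _ (fun _ => mem_minimalPrimesFinset)
    (fun _ hJ hq => herbrandIndex_herbrandIndex_quotient_eq_zero ha hb h hJ
      (mem_minimalPrimesFinset.not.mp hq)) _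
    (by rw [Ideal.annihilator_quotient])

omit [IsLocalRing R] in
/-- The components of `V(J)` have nonzero multiplicity. -/
theorem multAt_ne_zero {J : Ideal R} {p : PrimeSpectrum R} (hp : p.asIdeal ∈ J.minimalPrimes) :
    multAt p (R ⧸ J) ≠ 0 := by
  let A := Localization.AtPrime p.asIdeal
  let N := LocalizedModule p.asIdeal.primeCompl (R ⧸ J)
  -- localizing at a minimal prime leaves one point, so the local ring is Artinian
  have hlocal : OnlyOrigin (J.map (algebraMap R A)) := by
    intro q hq hJq
    have h1 : J ≤ q.comap (algebraMap R A) := Ideal.map_le_iff_le_comap.mp hJq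
    have h2 : q.comap (algebraMap R A) ≤ p.asIdeal := by
      refine (Ideal.comap_mono (IsLocalRing.le_maximalIdeal hq.ne_top)).trans ?_
      exact (IsLocalization.AtPrime.under_maximalIdeal A p.asIdeal).le
    have h3 : q.comap (algebraMap R A) = p.asIdeal :=
      le_antisymm h2 (hp.2 ⟨inferInstance, h1⟩ h2)
    rw [← IsLocalization.map_under p.asIdeal.primeCompl A q]
    refine (congrArg (Ideal.map (algebraMap R A)) h3).trans ?_
    exact IsLocalization.AtPrime.map_eq_maximalIdeal p.asIdeal A
  have hart := hlocal.isArtinianRing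
  have hann : J.map (algebraMap R A) ≤ Module.annihilator A N := by
    rw [Ideal.map_le_iff_le_comap]
    intro r hr
    rw [Ideal.mem_comap, Module.mem_annihilator]
    intro x
    induction x using LocalizedModule.induction_on with
    | _ m s =>
      rw [algebraMap_smul, LocalizedModule.smul'_mk]
      obtain ⟨m, rfl⟩ := Ideal.Quotient.mk_surjective m
      have : r • Ideal.Quotient.mk J m = 0 :=
        Ideal.Quotient.eq_zero_iff_mem.mpr (J.mul_mem_right m hr)
      rw [this, LocalizedModule.zero_mk]
  have hfin := length_ne_top_of_annihilator N hann
  have hnt : Nontrivial N := by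
    have : p ∈ Module.support R (R ⧸ J) := by
      rw [Module.mem_support_iff_of_finite, Ideal.annihilator_quotient]
      exact hp.1.2
    exact Module.mem_support_iff.mp this
  intro h0
  rcases ENat.toNat_eq_zero.mp h0 with h | h
  · exact not_subsingleton N (Module.length_eq_zero_iff.mp h)
  · exact hfin h

end LocalDimension

/-! ### Intersection numbers of analytic cycles -/

section Cycles

open IsLocalRing

variable {m : ℕ}

theorem cycleOf_eq_sum (J : Ideal (LocalAnalyticRing m)) :
    cycleOf J = ∑ p ∈ minimalPrimesFinset _ J,
      Finsupp.single p (multAt p (LocalAnalyticRing m ⧸ J) : ℤ) :=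
  finsum_mem_eq_finite_toFinset_sum _ (finite_minimalPrimes_primeSpectrum J)

/-- The components of the cycle `[V(J)]` are those of `V(J)`: no multiplicity vanishes. -/
theorem mem_support_cycleOf {J : Ideal (LocalAnalyticRing m)}
    {p : PrimeSpectrum (LocalAnalyticRing m)} :
    p ∈ (cycleOf J).support ↔ p.asIdeal ∈ J.minimalPrimes := by
  classical
  rw [Finsupp.mem_support_iff, cycleOf_eq_sum, Finsupp.finsetSum_apply]
  simp only [Finsupp.single_apply, Finset.sum_ite_eq']
  rw [← mem_minimalPrimesFinset]
  constructor
  · intro h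
    by_contra h1
    exact h (if_neg h1)
  · intro h
    rw [if_pos h]
    exact_mod_cast multAt_ne_zero (mem_minimalPrimesFinset.mp h)

/-- Intersection with a hypersurface, as an additive map. -/
noncomputable def interHom (g : LocalAnalyticRing m) : AnalyticCycle m →+ AnalyticCycle m where
  toFun Z := Z.inter g
  map_zero' := Finsupp.sum_zero_index
  map_add' Z W := by
    refine Finsupp.sum_add_index' (fun p => ?_) fun p k l => ?_
    · split_ifs <;> simp
    · split_ifs
      · simp
      · rw [add_smul]

open Classical in
theorem interHom_cycleOf (g : LocalAnalyticRing m) (J : Ideal (LocalAnalyticRing m)) :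
    interHom g (cycleOf J) = ∑ p ∈ minimalPrimesFinset _ J, if g ∈ p.asIdeal then 0 else
      (multAt p (LocalAnalyticRing m ⧸ J) : ℤ) • cycleOf (p.asIdeal ⊔ Ideal.span {g}) := by
  rw [cycleOf_eq_sum, map_sum]
  refine Finset.sum_congr rfl fun p _ => ?_
  refine Finsupp.sum_single_index (h := fun (p : PrimeSpectrum (LocalAnalyticRing m)) (k : ℤ) =>
    if g ∈ p.asIdeal then 0 else k • cycleOf (p.asIdeal ⊔ Ideal.span {g})) ?_
  split_ifs <;> simp

/-- The coefficient of the origin, as an additive map. -/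
noncomputable def numberHom (m : ℕ) : AnalyticCycle m →+ ℤ := Finsupp.applyAddHom (originPrime m)

theorem lengthInt_quotient_maximalIdeal {R : Type} [CommRing R] [IsLocalRing R] :
    lengthInt R (R ⧸ maximalIdeal R) = 1 := by
  have : IsSimpleModule R (R ⧸ maximalIdeal R) :=
    isSimpleModule_iff_isCoatom.mpr (maximalIdeal.isMaximal R).out
  rw [lengthInt, Module.length_eq_one]
  rfl

/-- The multiplicity of the origin in `[V(J)]`, when `V(J)` is the origin, is the length of `R/J`. -/
theorem numberHom_cycleOf {J : Ideal (LocalAnalyticRing m)} (h : OnlyOrigin J) :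
    numberHom m (cycleOf J) = lengthInt (LocalAnalyticRing m) (LocalAnalyticRing m ⧸ J) := by
  have horigin : ∀ p ∈ minimalPrimesFinset _ J, p = originPrime m := fun p hp =>
    PrimeSpectrum.ext ((h _ p.2 (mem_minimalPrimesFinset.mp hp).1.2).trans
      originPrime_asIdeal.symm)
  rw [h.isAdditiveOn.eq_sum_minimalPrimes (minimalPrimesFinset _ J)
    (fun _ => mem_minimalPrimesFinset) (fun q hJ hq => ?_) (LocalAnalyticRing m ⧸ J)
    (by rw [Ideal.annihilator_quotient]), cycleOf_eq_sum, map_sum]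
  · refine Finset.sum_congr rfl fun p hp => ?_
    have h1 := horigin p hp
    have h2 : lengthInt (LocalAnalyticRing m) (LocalAnalyticRing m ⧸ p.asIdeal) = 1 := by
      rw [h1, originPrime_asIdeal, lengthInt_quotient_maximalIdeal]
    rw [h2, mul_one]
    show Finsupp.single p _ (originPrime m) = _
    rw [← h1, Finsupp.single_eq_same]
  · refine absurd (mem_minimalPrimesFinset.mpr ⟨⟨q.2, hJ⟩, fun r hr _ => ?_⟩) hq
    rw [h _ q.2 hJ, h r hr.1 hr.2]

/-- The intersection number of a curve with a hypersurface is a Herbrand index. -/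
theorem numberHom_interHom {J : Ideal (LocalAnalyticRing m)} {b : LocalAnalyticRing m}
    (hb : b ∈ maximalIdeal (LocalAnalyticRing m)) (h : OnlyOrigin (J ⊔ Ideal.span {b})) :
    numberHom m (interHom b (cycleOf J)) =
      herbrandIndex (lengthInt (LocalAnalyticRing m)) b (LocalAnalyticRing m ⧸ J) := by
  classical
  rw [interHom_cycleOf, map_sum, herbrandIndex_eq_sum hb h]
  refine Finset.sum_congr rfl fun p hp => ?_
  have hJp := (mem_minimalPrimesFinset.mp hp).1.2
  split_ifs with hbp
  · rw [map_zero, herbrandIndex_quotient_of_mem hbp hJp h.isAdditiveOn, mul_zero]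
  · have h1 : OnlyOrigin (p.asIdeal ⊔ Ideal.span {b}) := h.mono (sup_le_sup_right hJp _)
    rw [map_zsmul, numberHom_cycleOf h1, h1.isAdditiveOn.herbrand_quotient
      (fun r hr => (p.2.mem_or_mem hr).resolve_left hbp), smul_eq_mul]

/-- The intersection number of a surface with two hypersurfaces is an iterated Herbrand index. -/
theorem numberHom_interHom_interHom {I : Ideal (LocalAnalyticRing m)} {a b : LocalAnalyticRing m}
    (ha : a ∈ maximalIdeal (LocalAnalyticRing m)) (hb : b ∈ maximalIdeal (LocalAnalyticRing m))
    (h : OnlyOrigin (I ⊔ Ideal.span {a} ⊔ Ideal.span {b})) :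
    numberHom m (interHom b (interHom a (cycleOf I))) =
      herbrandIndex (herbrandIndex (lengthInt (LocalAnalyticRing m)) b) a
        (LocalAnalyticRing m ⧸ I) := by
  classical
  rw [interHom_cycleOf, map_sum, map_sum, herbrandIndex_herbrandIndex_eq_sum ha hb h]
  refine Finset.sum_congr rfl fun p hp => ?_
  have hIp := (mem_minimalPrimesFinset.mp hp).1.2
  split_ifs with hap
  · rw [map_zero, map_zero, herbrandIndex_quotient_of_mem hap hIp h.isAdditiveOn.herbrand, mul_zero]
  · have h1 : OnlyOrigin (p.asIdeal ⊔ Ideal.span {a} ⊔ Ideal.span {b}) :=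
      h.mono (sup_le_sup_right (sup_le_sup_right hIp _) _)
    rw [map_zsmul, map_zsmul, numberHom_interHom hb h1, h1.isAdditiveOn.herbrand.herbrand_quotient
      (fun r hr => (p.2.mem_or_mem hr).resolve_left hap), smul_eq_mul]

end Cycles

/-! ### Surfaces and their hyperplane sections -/

section SurfaceIndices

open IsLocalRing

variable {R : Type} [CommRing R] [IsLocalRing R] [IsNoetherianRing R] {I : Ideal R} {x y φ ψ : R}

omit [IsLocalRing R] [IsNoetherianRing R] in
theorem mem_of_sup_span_le {J q : Ideal R} {a : R} (h : J ⊔ Ideal.span {a} ≤ q) : J ≤ q ∧ a ∈ q :=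
  ⟨le_sup_left.trans h, h (Ideal.mem_sup_right (Ideal.mem_span_singleton_self a))⟩

omit [IsLocalRing R] [IsNoetherianRing R] in
theorem sup_span_le {J q : Ideal R} {a : R} (h : J ≤ q) (ha : a ∈ q) : J ⊔ Ideal.span {a} ≤ q :=
  sup_le h ((Ideal.span_singleton_le_iff_mem _).mpr ha)

theorem krullDimLE_one_of_onlyOrigin {q : Ideal R} {a : R} (ha : a ∈ maximalIdeal R)
    (h : OnlyOrigin (q ⊔ Ideal.span {a})) : ringKrullDim (R ⧸ q) ≤ 1 := by
  simpa using ringKrullDim_quotient_le_card (p := q) {a} (by simpa) fun r hr hqr har =>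
    h r hr (sup_span_le hqr (har a (by simp)))

/-- A regular parameter modulo `J`, for `J` of depth at least `d + 1`. -/
theorem DepthGE.regular {d : ℕ} {J : Ideal R} (hd : DepthGE (d + 1) J) {a b : R}
    (hb : b ∈ maximalIdeal R) (h : OnlyOrigin (J ⊔ Ideal.span {a} ⊔ Ideal.span {b})) (h1 : 1 ≤ d) :
    ∀ r, a * r ∈ J → r ∈ J :=
  hd.regular_of_parameter {b} (by simpa) (by simpa) fun q hq hJ haq hbq =>
    h q hq (sup_span_le (sup_span_le hJ haq) (hbq b (by simp)))

/-- `V(φ)` meets `V(I, x)` only at the origin exactly when `V(y)` does, provided that they contain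
the same curves in `V(I, x)`. -/
theorem onlyOrigin_iff_of_curves (hψ : ψ ∈ maximalIdeal R)
    (hK : OnlyOrigin (I ⊔ Ideal.span {ψ} ⊔ Ideal.span {x}))
    (hcurve : ∀ q : Ideal R, q.IsPrime → Ring.KrullDimLE 1 (R ⧸ q) → q ≠ maximalIdeal R → I ≤ q →
      x ∈ q → ψ ∉ q → (φ ∈ q ↔ y ∈ q)) :
    OnlyOrigin (I ⊔ Ideal.span {φ} ⊔ Ideal.span {x}) ↔
      OnlyOrigin (I ⊔ Ideal.span {x} ⊔ Ideal.span {y}) := by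
  -- `V(I, x)` is a curve that `V(ψ)` meets only at the origin, so its branches are not in `V(ψ)`
  have key : ∀ q : Ideal R, q.IsPrime → I ≤ q → x ∈ q → q ≠ maximalIdeal R → (φ ∈ q ↔ y ∈ q) := by
    intro q hq hI hx hqm
    refine hcurve q hq ?_ hqm hI hx fun hψq => hqm (hK q hq (sup_span_le (sup_span_le hI hψq) hx))
    refine Ring.krullDimLE_iff.mpr (krullDimLE_one_of_onlyOrigin hψ (hK.mono ?_))
    refine sup_span_le (sup_le (hI.trans le_sup_left) le_sup_right) (Ideal.mem_sup_left hx)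
  constructor
  · intro h q hq hle
    obtain ⟨hle, hy⟩ := mem_of_sup_span_le hle
    obtain ⟨hI, hx⟩ := mem_of_sup_span_le hle
    by_contra hqm
    exact hqm (h q hq (sup_span_le (sup_span_le hI ((key q hq hI hx hqm).mpr hy)) hx))
  · intro h q hq hle
    obtain ⟨hle, hx⟩ := mem_of_sup_span_le hle
    obtain ⟨hI, hφ⟩ := mem_of_sup_span_le hle
    by_contra hqm
    exact hqm (h q hq (sup_span_le (sup_span_le hI hx) ((key q hq hI hx hqm).mp hφ)))

/-- Components of `V(J)` have dimension at least the depth. -/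
theorem DepthGE.le_ringKrullDim_of_minimal {d : ℕ} {J : Ideal R} (hd : DepthGE d J) {C : Ideal R}
    (hC : C ∈ J.minimalPrimes) : (d : WithBot ℕ∞) ≤ ringKrullDim (R ⧸ C) :=
  hd.le_ringKrullDim (isAssociatedTo_of_mem_minimalPrimes hC)

/-- `V(J)` meets `V(x)` only at the origin exactly when its components are curves that `V(x)` meets
properly; positive depth excludes the origin as a component. -/
theorem onlyOrigin_iff_forall_minimalPrimes {J : Ideal R} {x : R}
    (hx : x ∈ maximalIdeal R) (hd : OnlyOrigin (J ⊔ Ideal.span {x}) → DepthGE 1 J) :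
    OnlyOrigin (J ⊔ Ideal.span {x}) ↔ ∀ C ∈ J.minimalPrimes,
      ringKrullDim (R ⧸ C) = 1 ∧ ringKrullDim (R ⧸ (C ⊔ Ideal.span {x})) = 0 := by
  constructor
  · intro h C hC
    have hCx : OnlyOrigin (C ⊔ Ideal.span {x}) := h.mono (sup_le_sup_right hC.1.2 _)
    refine ⟨le_antisymm (krullDimLE_one_of_onlyOrigin hx hCx)
      (by simpa using (hd h).le_ringKrullDim_of_minimal hC),
      ringKrullDim_quotient_eq_zero_iff.mpr ⟨fun htop => ?_, hCx⟩⟩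
    have := sup_span_le (IsLocalRing.le_maximalIdeal hC.1.1.ne_top) hx
    rw [htop] at this
    exact (maximalIdeal.isMaximal R).ne_top (top_le_iff.mp this)
  · intro h q hq hle
    obtain ⟨hJq, hxq⟩ := mem_of_sup_span_le hle
    obtain ⟨C, hC, hCq⟩ := Ideal.exists_minimalPrimes_le hJq
    exact (ringKrullDim_quotient_eq_zero_iff.mp (h C hC).2).2 q hq (sup_span_le hCq hxq)

/-- The components of `V(I)` are surfaces: the depth bounds their dimension from below, the two
parameters `x` and `ψ` from above. -/
theorem ringKrullDim_eq_two (hd : DepthGE 2 I) (hx : x ∈ maximalIdeal R)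
    (hψ : ψ ∈ maximalIdeal R) (hK : OnlyOrigin (I ⊔ Ideal.span {ψ} ⊔ Ideal.span {x}))
    {C : Ideal R} (hC : C ∈ I.minimalPrimes) : ringKrullDim (R ⧸ C) = 2 := by
  classical
  refine le_antisymm ?_ (by simpa using hd.le_ringKrullDim_of_minimal hC)
  refine (ringKrullDim_quotient_le_card {x, ψ} ?_ fun q hq hCq hS => ?_).trans
    (by exact_mod_cast Finset.card_le_two)
  · intro s hs
    rcases Finset.mem_insert.mp hs with rfl | hs
    · exact hx
    · rwa [Finset.mem_singleton.mp hs]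
  · exact hK q hq (sup_span_le (sup_span_le (hC.1.2.trans hCq) (hS ψ (by simp))) (hS x (by simp)))

theorem onlyOrigin_iff_forall_minimalPrimes_pair (hx : x ∈ maximalIdeal R)
    (hy : y ∈ maximalIdeal R) :
    OnlyOrigin (I ⊔ Ideal.span {x} ⊔ Ideal.span {y}) ↔ ∀ C ∈ I.minimalPrimes,
      ringKrullDim (R ⧸ (C ⊔ Ideal.span {x, y})) = 0 := by
  have hspan : ∀ C : Ideal R, C ⊔ Ideal.span {x, y} = C ⊔ Ideal.span {x} ⊔ Ideal.span {y} := by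
    intro C
    rw [sup_assoc, ← Ideal.span_union]
    rfl
  constructor
  · intro h C hC
    rw [hspan]
    refine ringKrullDim_quotient_eq_zero_iff.mpr ⟨fun htop => ?_,
      h.mono (sup_le_sup_right (sup_le_sup_right hC.1.2 _) _)⟩
    have := sup_span_le (sup_span_le (IsLocalRing.le_maximalIdeal hC.1.1.ne_top) hx) hy
    rw [htop] at this
    exact (maximalIdeal.isMaximal R).ne_top (top_le_iff.mp this)
  · intro h q hq hle
    obtain ⟨hle, hyq⟩ := mem_of_sup_span_le hle
    obtain ⟨hIq, hxq⟩ := mem_of_sup_span_le hle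
    obtain ⟨C, hC, hCq⟩ := Ideal.exists_minimalPrimes_le hIq
    have := h C hC
    rw [hspan] at this
    exact (ringKrullDim_quotient_eq_zero_iff.mp this).2 q hq
      (sup_span_le (sup_span_le hCq hxq) hyq)

/-- Additivity of intersection numbers on the curve `V(I, x)`, from additivity on its branches. -/
theorem herbrandIndex_curve_eq_add {J : Ideal R} (hd : DepthGE 1 J) (hφ : φ ∈ maximalIdeal R)
    (hψ : ψ ∈ maximalIdeal R) (hy : y ∈ maximalIdeal R)
    (hφJ : OnlyOrigin (J ⊔ Ideal.span {φ})) (hψJ : OnlyOrigin (J ⊔ Ideal.span {ψ}))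
    (hyJ : OnlyOrigin (J ⊔ Ideal.span {y}))
    (hcurve : ∀ q : Ideal R, q.IsPrime → Ring.KrullDimLE 1 (R ⧸ q) → q ≠ maximalIdeal R → J ≤ q →
      ψ ∉ q → y ∉ q → lengthInt R (R ⧸ (q ⊔ Ideal.span {φ})) =
        lengthInt R (R ⧸ (q ⊔ Ideal.span {ψ})) + lengthInt R (R ⧸ (q ⊔ Ideal.span {y}))) :
    herbrandIndex (lengthInt R) φ (R ⧸ J) =
      herbrandIndex (lengthInt R) ψ (R ⧸ J) + herbrandIndex (lengthInt R) y (R ⧸ J) := by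
  rw [herbrandIndex_eq_sum hφ hφJ, herbrandIndex_eq_sum hψ hψJ, herbrandIndex_eq_sum hy hyJ,
    ← Finset.sum_add_distrib]
  refine Finset.sum_congr rfl fun p hp => ?_
  have hpmin := mem_minimalPrimesFinset.mp hp
  -- positive depth excludes the origin as a component
  have hp1 : p.asIdeal ≠ maximalIdeal R := by
    intro h
    have h1 := hd.le_ringKrullDim_of_minimal hpmin
    rw [h, (ringKrullDim_quotient_eq_zero_iff (J := maximalIdeal R)).mpr
      ⟨(maximalIdeal.isMaximal R).ne_top, fun q hq hle =>
        ((maximalIdeal.isMaximal R).eq_of_le hq.ne_top hle).symm⟩] at h1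
    exact absurd h1 (by norm_num)
  have hnot : ∀ {a : R}, OnlyOrigin (J ⊔ Ideal.span {a}) → a ∉ p.asIdeal := fun h ha =>
    hp1 (h _ p.2 (sup_span_le hpmin.1.2 ha))
  have hindex : ∀ {a : R}, OnlyOrigin (J ⊔ Ideal.span {a}) →
      herbrandIndex (lengthInt R) a (R ⧸ p.asIdeal) =
        lengthInt R (R ⧸ (p.asIdeal ⊔ Ideal.span {a})) := fun h =>
    (h.mono (sup_le_sup_right hpmin.1.2 _)).isAdditiveOn.herbrand_quotient
      fun r hr => (p.2.mem_or_mem hr).resolve_left (hnot h)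
  rw [hindex hφJ, hindex hψJ, hindex hyJ, ← mul_add, hcurve p.asIdeal p.2
    (Ring.krullDimLE_iff.mpr (krullDimLE_one_of_onlyOrigin hψ
      (hψJ.mono (sup_le_sup_right hpmin.1.2 _)))) hp1 hpmin.1.2 (hnot hψJ) (hnot hyJ)]

omit [IsLocalRing R] [IsNoetherianRing R] in
theorem smul_quotient_regular {J : Ideal R} {a : R} (h : ∀ r, a * r ∈ J → r ∈ J) (m : R ⧸ J)
    (hm : a • m = 0) : m = 0 := by
  obtain ⟨r, rfl⟩ := Ideal.Quotient.mk_surjective m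
  have hm' : Ideal.Quotient.mk J (a * r) = 0 := hm
  rw [Ideal.Quotient.eq_zero_iff_mem] at hm' ⊢
  exact h r hm'

/-- Additivity of intersection numbers on the surface `V(I)`: after exchanging `φ` and `x`, both sides
are computed on the hyperplane section `V(I, x)`, where `herbrandIndex_curve_eq_add` applies. -/
theorem herbrandIndex_surface_eq_add (hd : DepthGE 2 I) (hx : x ∈ maximalIdeal R)
    (hφ : φ ∈ maximalIdeal R) (hψ : ψ ∈ maximalIdeal R) (hy : y ∈ maximalIdeal R)
    (hφx : OnlyOrigin (I ⊔ Ideal.span {φ} ⊔ Ideal.span {x}))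
    (hψx : OnlyOrigin (I ⊔ Ideal.span {ψ} ⊔ Ideal.span {x}))
    (hxy : OnlyOrigin (I ⊔ Ideal.span {x} ⊔ Ideal.span {y}))
    (hcurve : ∀ q : Ideal R, q.IsPrime → Ring.KrullDimLE 1 (R ⧸ q) → q ≠ maximalIdeal R → I ≤ q →
      x ∈ q → ψ ∉ q → y ∉ q → lengthInt R (R ⧸ (q ⊔ Ideal.span {φ})) =
        lengthInt R (R ⧸ (q ⊔ Ideal.span {ψ})) + lengthInt R (R ⧸ (q ⊔ Ideal.span {y}))) :
    herbrandIndex (herbrandIndex (lengthInt R) x) φ (R ⧸ I) =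
      lengthInt R (R ⧸ (I ⊔ Ideal.span {ψ} ⊔ Ideal.span {x})) +
        herbrandIndex (herbrandIndex (lengthInt R) y) x (R ⧸ I) := by
  have hxφ := hφx
  rw [sup_right_comm] at hxφ
  have hxψ := hψx
  rw [sup_right_comm] at hxψ
  have hregφ := hd.regular hx hφx le_rfl
  have hregx := hd.regular hφ hxφ le_rfl
  have hd1 : DepthGE 1 (I ⊔ Ideal.span {x}) := hd.sup_span_singleton hx hregx
  have hregψ : ∀ r, ψ * r ∈ I ⊔ Ideal.span {x} → r ∈ I ⊔ Ideal.span {x} :=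
    hd1.regular_of_parameter (d := 0) ∅ (by simp) (by simp) fun q hq hJ hψq _ =>
      hxψ q hq (sup_span_le hJ hψq)
  rw [hφx.isAdditiveOn.herbrand_comm (by rw [Ideal.annihilator_quotient])
    (smul_quotient_regular hregφ) (smul_quotient_regular hregx),
    hxφ.isAdditiveOn.herbrand.herbrand_quotient hregx,
    hxy.isAdditiveOn.herbrand.herbrand_quotient hregx,
    herbrandIndex_curve_eq_add hd1 hφ hψ hy hxφ hxψ hxy fun q hq hdim hqm hJ =>
      hcurve q hq hdim hqm (mem_of_sup_span_le hJ).1 (mem_of_sup_span_le hJ).2,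
    hxψ.isAdditiveOn.herbrand_quotient hregψ, sup_right_comm]

end SurfaceIndices

/-! ### The Milnor number and the polar surface -/

section Milnor

open IsLocalRing

variable {n : ℕ}

/-- The residue field of `𝒪_m` is `ℂ`, so the length is the dimension over `ℂ`. -/
theorem finrank_eq_lengthInt {m : ℕ} (M : Type) [AddCommGroup M] [Module ℂ M]
    [Module (LocalAnalyticRing m) M] [IsScalarTower ℂ (LocalAnalyticRing m) M]
    (h : Module.length (LocalAnalyticRing m) M ≠ ⊤) :
    (Module.finrank ℂ M : ℤ) = lengthInt (LocalAnalyticRing m) M := by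
  have : IsLocalHom (algebraMap ℂ (LocalAnalyticRing m)) :=
    ⟨fun c hc => isUnit_iff_ne_zero.mpr fun h0 => hc.ne_zero (by rw [h0, map_zero])⟩
  have h1 := IsLocalRing.length_restrictScalars ℂ (LocalAnalyticRing m) M
  have hsurj : Function.Surjective
      (algebraMap (ResidueField ℂ) (ResidueField (LocalAnalyticRing m))) := by
    intro b
    obtain ⟨b, rfl⟩ := IsLocalRing.residue_surjective b
    refine ⟨residue ℂ (evalAtZero m b), ?_⟩
    rw [← sub_eq_zero, ← neg_eq_zero, neg_sub]
    exact Ideal.Quotient.eq_zero_iff_mem.mpr (sub_algebraMap_mem_maximalIdeal b)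
  rw [Module.length_eq_of_surjective hsurj,
    Module.length_eq_one (ResidueField (LocalAnalyticRing m)), mul_one] at h1
  have h2 : IsFiniteLength ℂ M := Module.length_ne_top_iff.mp (h1 ▸ h)
  have : IsNoetherian ℂ M := (isFiniteLength_iff_isNoetherian_isArtinian.mp h2).1
  rw [lengthInt, ← h1, Module.length_eq_finrank]
  rfl

theorem restrictHyperplane_eq (f : (Fin (n + 1) → ℂ) → ℂ) :
    restrictHyperplane f = f ∘ consZeroCLM n :=
  funext fun w => congrArg f (consZeroCLM_apply w).symm

theorem germRestrict_partialDeriv {f : (Fin (n + 1) → ℂ) → ℂ} (hf : AnalyticAt ℂ f 0) (i : Fin n) :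
    germRestrict n (germAtZero (partialDeriv f i.succ) (analyticAt_partialDeriv hf i.succ)) =
      germAtZero (partialDeriv (restrictHyperplane f) i)
        (analyticAt_partialDeriv (analyticAt_restrictHyperplane hf) i) := by
  rw [germRestrict, germComp_germAtZero, germAtZero_eq_iff]
  have ht : Tendsto (consZeroCLM n) (𝓝 0) (𝓝 0) := (consZeroCLM n).continuous.tendsto' _ _ (map_zero _)
  filter_upwards [ht.eventually hf.eventually_analyticAt] with w hw
  rw [Function.comp, partialDeriv, partialDeriv, restrictHyperplane_eq,
    fderiv_comp w hw.differentiableAt (consZeroCLM n).differentiableAt,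
    ContinuousLinearMap.fderiv, ContinuousLinearMap.comp_apply, consZeroCLM_apply]
  congr 1
  rw [consZeroCLM_apply]
  funext j
  refine Fin.cases ?_ (fun j => ?_) j
  · simp [(Fin.succ_ne_zero i).symm]
  · simp [Pi.single_apply]

/-- The Jacobian ideal of `f|V(z_0)` corresponds to `⟨∂f/∂z_1, …, ∂f/∂z_n, z_0⟩`. -/
theorem comap_jacobianIdeal_restrictHyperplane {f : (Fin (n + 2) → ℂ) → ℂ}
    (hf : AnalyticAt ℂ f 0) :
    (jacobianIdeal (restrictHyperplane f) (analyticAt_restrictHyperplane hf)).comap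
      (germRestrict (n + 1)) = polarIdeal f hf ⊔
        Ideal.span {germAtZero (partialDeriv f 1) (analyticAt_partialDeriv hf 1)} ⊔
          Ideal.span {coordGerm 0} := by
  rw [← comap_germRestrict_map]
  congr 1
  refine le_antisymm (Ideal.span_le.mpr ?_) (Ideal.map_le_iff_le_comap.mpr (sup_le ?_ ?_))
  · rintro _ ⟨i, rfl⟩
    beta_reduce
    rw [SetLike.mem_coe, ← germRestrict_partialDeriv hf i]
    refine Ideal.mem_map_of_mem _ ?_
    refine Fin.cases ?_ (fun j => ?_) i
    · exact Ideal.mem_sup_right (Ideal.mem_span_singleton_self _)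
    · refine Ideal.mem_sup_left (Ideal.subset_span ⟨j.succ.succ, ?_, rfl⟩)
      simp
  · refine Ideal.span_le.mpr ?_
    rintro _ ⟨i, hi, rfl⟩
    obtain ⟨j, rfl⟩ := Fin.exists_succ_eq_of_ne_zero (x := i) (by rintro rfl; simp at hi)
    rw [SetLike.mem_coe, Ideal.mem_comap, germRestrict_partialDeriv hf]
    exact Ideal.subset_span ⟨j, rfl⟩
  · rw [Ideal.span_singleton_le_iff_mem]
    rw [Ideal.mem_comap, ← Fin.succ_zero_eq_one, germRestrict_partialDeriv hf]
    exact Ideal.subset_span ⟨0, rfl⟩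

/-- The Milnor number of `f|V(z_0)` is the length of `𝒪/⟨∂f/∂z_1, …, ∂f/∂z_n, z_0⟩`. -/
theorem milnorNumber_restrictHyperplane {f : (Fin (n + 2) → ℂ) → ℂ} (hf : AnalyticAt ℂ f 0)
    (h : OnlyOrigin (polarIdeal f hf ⊔
      Ideal.span {germAtZero (partialDeriv f 1) (analyticAt_partialDeriv hf 1)} ⊔
        Ideal.span {coordGerm 0})) :
    (milnorNumber (restrictHyperplane f) (analyticAt_restrictHyperplane hf) : ℤ) =
      lengthInt (LocalAnalyticRing (n + 2)) (LocalAnalyticRing (n + 2) ⧸ (polarIdeal f hf ⊔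
        Ideal.span {germAtZero (partialDeriv f 1) (analyticAt_partialDeriv hf 1)} ⊔
          Ideal.span {coordGerm 0})) := by
  rw [← comap_jacobianIdeal_restrictHyperplane] at h ⊢
  have := h.isArtinianRing
  rw [← finrank_eq_lengthInt _ (length_ne_top_of_annihilator _
    (by rw [Ideal.annihilator_quotient])), milnorNumber]
  exact_mod_cast (quotientRestrictEquiv _).toLinearEquiv.finrank_eq.symm

/-- The derivatives that cut out the polar surface form a regular sequence, being part of the system
of parameters `∂f/∂z_2, …, ∂f/∂z_{n+1}, ∂f/∂z_1, z_0` of a ring of depth equal to its dimension. -/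
theorem depthGE_two_polarIdeal {f : (Fin (n + 2) → ℂ) → ℂ} (hf : AnalyticAt ℂ f 0)
    (hI : polarIdeal f hf ≤ maximalIdeal _)
    (hψ : germAtZero (partialDeriv f 1) (analyticAt_partialDeriv hf 1) ∈ maximalIdeal _)
    (h : OnlyOrigin (polarIdeal f hf ⊔
      Ideal.span {germAtZero (partialDeriv f 1) (analyticAt_partialDeriv hf 1)} ⊔
        Ideal.span {coordGerm 0})) : DepthGE 2 (polarIdeal f hf) := by
  classical
  let d : Fin n → LocalAnalyticRing (n + 2) := fun i =>
    germAtZero (partialDeriv f i.succ.succ) (analyticAt_partialDeriv hf i.succ.succ)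
  have hspan : polarIdeal f hf = ⊥ ⊔ Ideal.span {a | a ∈ List.ofFn d} := by
    rw [bot_sup_eq, polarIdeal]
    congr 1
    ext a
    simp only [Set.mem_ofPred_eq, List.mem_ofFn]
    constructor
    · rintro ⟨i, hi, rfl⟩
      obtain ⟨j, rfl⟩ := Fin.exists_succ_eq_of_ne_zero (x := i) (by rintro rfl; simp at hi)
      obtain ⟨k, rfl⟩ := Fin.exists_succ_eq_of_ne_zero (x := j) (by rintro rfl; simp at hi)
      exact ⟨k, rfl⟩
    · rintro ⟨k, rfl⟩
      exact ⟨k.succ.succ, by simp, rfl⟩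
  have hmem : ∀ a ∈ List.ofFn d, a ∈ polarIdeal f hf := fun a ha => by
    rw [hspan, bot_sup_eq]
    exact Ideal.subset_span ha
  rw [hspan]
  refine DepthGE.sup_span_list {coordGerm 0,
    germAtZero (partialDeriv f 1) (analyticAt_partialDeriv hf 1)} Finset.card_le_two ?_ _ ?_
    (fun a ha => hI (hmem a ha)) fun q hq _ hl hS => ?_
  · intro s hs
    rcases Finset.mem_insert.mp hs with rfl | hs
    · exact coordGerm_mem_maximalIdeal 0
    · rwa [Finset.mem_singleton.mp hs]
  · rw [List.length_ofFn, add_comm 2 n]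
    exact depthGE_localAnalyticRing (n + 2)
  · refine h q hq (sup_span_le (sup_span_le ?_ (hS _ (by simp))) (hS _ (by simp)))
    rw [hspan, bot_sup_eq]
    exact Ideal.span_le.mpr hl

end Milnor

/-! ### The polar surface and the Milnor number of a hyperplane section -/

theorem mainTheorem6 (n : ℕ) (hn : 1 ≤ n) (U : Set (Fin (n + 1) → ℂ)) (hU : IsOpen U)
    (h0U : (0 : Fin (n + 1) → ℂ) ∈ U) (f : (Fin (n + 1) → ℂ) → ℂ)
    (hfU : AnalyticOnNhd ℂ f U) (hf0 : f 0 = 0)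
    -- the critical locus of `f` has dimension one at the origin
    (hcrit : germDim (jacobianIdeal f (hfU 0 h0U)) = 1)
    -- the restriction of `f` to `V(z_0)` has an isolated critical point at the origin
    (hcrit0 : germDim (jacobianIdeal (restrictHyperplane f)
      (analyticAt_restrictHyperplane (hfU 0 h0U))) = 0) :
    [ -- `dim_0 (Γ² ∩ V(f) ∩ V(z_0)) = 0`
      germDim (polarIdeal f (hfU 0 h0U) ⊔ Ideal.span {germAtZero f (hfU 0 h0U)}
        ⊔ Ideal.span {coordGerm 0}) = 0,
      -- each irreducible component of `Γ² ∩ V(f)` at `0` is a curve that `V(z_0)` meets properly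
      ∀ C : PrimeSpectrum (LocalAnalyticRing (n + 1)),
        C.asIdeal ∈ (polarIdeal f (hfU 0 h0U) ⊔
            Ideal.span {germAtZero f (hfU 0 h0U)}).minimalPrimes →
          germDim C.asIdeal = 1 ∧ MeetsProperly C (Ideal.span {coordGerm 0}),
      -- `V(z_0, z_1)` meets each component of the cycle `Γ²` properly
      ∀ C ∈ (polarSurface f (hfU 0 h0U)).support,
        MeetsProperly C (Ideal.span {coordGerm 0, coordGerm 1}) ].TFAE ∧
    (germDim (polarIdeal f (hfU 0 h0U) ⊔ Ideal.span {germAtZero f (hfU 0 h0U)}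
        ⊔ Ideal.span {coordGerm 0}) = 0 →
      (((polarSurface f (hfU 0 h0U)).inter (germAtZero f (hfU 0 h0U))).inter
          (coordGerm 0)).numberAtZero =
        (milnorNumber (restrictHyperplane f)
          (analyticAt_restrictHyperplane (hfU 0 h0U)) : ℤ) +
        ((polarSurface f (hfU 0 h0U)).interCI [coordGerm 0, coordGerm 1]).numberAtZero) := by
  -- with `n + 1` for `n`, the coordinates are `z_0, …, z_{n+1}`, and `z_1` is always among them
  obtain ⟨n, rfl⟩ : ∃ k, n = k + 1 := ⟨n - 1, by omega⟩
  have hf := hfU 0 h0U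
  set R := LocalAnalyticRing (n + 1 + 1)
  let I : Ideal R := polarIdeal f hf
  let φ : R := germAtZero f hf
  let ψ : R := germAtZero (partialDeriv f 1) (analyticAt_partialDeriv hf 1)
  let x : R := coordGerm 0
  let y : R := coordGerm 1
  -- the isolated critical point of the restriction, read in the ambient space
  have hK := hcrit0
  rw [← germDim_comap_germRestrict, comap_jacobianIdeal_restrictHyperplane hf, germDim,
    ringKrullDim_quotient_eq_zero_iff] at hK
  obtain ⟨hKtop, hK⟩ := hK
  obtain ⟨hIψ, -⟩ := mem_of_sup_span_le (IsLocalRing.le_maximalIdeal hKtop)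
  obtain ⟨hIm, hψ⟩ := mem_of_sup_span_le hIψ
  have hφ : φ ∈ IsLocalRing.maximalIdeal R := mem_maximalIdeal_iff_evalAtZero.mpr hf0
  have hx : x ∈ IsLocalRing.maximalIdeal R := coordGerm_mem_maximalIdeal 0
  have hy : y ∈ IsLocalRing.maximalIdeal R := coordGerm_mem_maximalIdeal 1
  -- so the polar surface is a complete intersection, of pure dimension two
  have hd : DepthGE 2 I := depthGE_two_polarIdeal hf hIm hψ hK
  have h1 : germDim (I ⊔ Ideal.span {φ} ⊔ Ideal.span {x}) = 0 ↔
      OnlyOrigin (I ⊔ Ideal.span {φ} ⊔ Ideal.span {x}) := by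
    refine ringKrullDim_quotient_eq_zero_iff.trans (and_iff_right fun htop => ?_)
    have := sup_span_le (sup_span_le hIm hφ) hx
    rw [htop] at this
    exact (IsLocalRing.maximalIdeal.isMaximal R).ne_top (top_le_iff.mp this)
  -- on the curve `V(I, z_0)`, the function `f` vanishes on the same branches as `z_1`
  have hxy : OnlyOrigin (I ⊔ Ideal.span {φ} ⊔ Ideal.span {x}) ↔
      OnlyOrigin (I ⊔ Ideal.span {x} ⊔ Ideal.span {y}) :=
    onlyOrigin_iff_of_curves hψ hK fun q _ _ hqm hIq hxq hψq =>
      germ_mem_iff_coordGerm_mem hf hf0 hqm hIq hxq hψq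
  -- the components are of the expected dimension, by depth
  have h2 := onlyOrigin_iff_forall_minimalPrimes (J := I ⊔ Ideal.span {φ}) hx fun h =>
    DepthGE.sup_span_singleton hd hφ (DepthGE.regular hd hx h le_rfl)
  have h3 := onlyOrigin_iff_forall_minimalPrimes_pair (I := I) hx hy
  refine ⟨?_, fun h => ?_⟩
  · tfae_have 1 ↔ 2 := by
      refine h1.trans (h2.trans ⟨fun h C hC => ?_, fun h C hC => ?_⟩)
      · obtain ⟨hC1, hC0⟩ := h C.asIdeal hC
        refine ⟨hC1, ?_⟩
        have hC1' : germDim C.asIdeal = 1 := hC1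
        have hC0' : germDim (C.asIdeal ⊔ Ideal.span {coordGerm 0}) = 0 := hC0
        rw [MeetsProperly, hC1', hC0', germDim_span_coordGerm_zero, zero_add, add_comm]
        push_cast
        rfl
      · obtain ⟨hC1, hC0⟩ := h ⟨C, hC.1.1⟩ hC
        refine ⟨hC1, ?_⟩
        rw [MeetsProperly, hC1, germDim_span_coordGerm_zero, add_comm 1] at hC0
        have hC0' : germDim (C ⊔ Ideal.span {coordGerm 0}) + ((n + 1 + 1 : ℕ) : WithBot ℕ∞) =
            0 + ((n + 1 + 1 : ℕ) : WithBot ℕ∞) := by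
          rw [zero_add, hC0]
          push_cast
          rfl
        exact ENat.WithBot.add_natCast_cancel.mp hC0'
    tfae_have 1 ↔ 3 := by
      refine h1.trans (hxy.trans (h3.trans ?_))
      have key : ∀ C : PrimeSpectrum R, C.asIdeal ∈ I.minimalPrimes →
          (ringKrullDim (R ⧸ (C.asIdeal ⊔ Ideal.span {x, y})) = 0 ↔
            MeetsProperly C (Ideal.span {coordGerm 0, coordGerm 1})) := by
        intro C hC
        have hC2 : germDim C.asIdeal = 2 := ringKrullDim_eq_two hd hx hψ hK hC
        have hsum : (2 : WithBot ℕ∞) + (n : WithBot ℕ∞) =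
            0 + ((n + 1 + 1 : ℕ) : WithBot ℕ∞) := by
          rw [zero_add, add_comm]
          push_cast
          rw [add_assoc, one_add_one_eq_two]
        -- proper intersection reads `dim (C ∩ V(z_0, z_1)) + (n + 2) = 2 + n`
        rw [MeetsProperly, hC2, germDim_span_coordGerm_pair, hsum]
        exact ENat.WithBot.add_natCast_cancel.symm
      exact ⟨fun h C hC => (key C (mem_support_cycleOf.mp hC)).mp
          (h C.asIdeal (mem_support_cycleOf.mp hC)),
        fun h C hC => (key ⟨C, hC.1.1⟩ hC).mpr (h ⟨C, hC.1.1⟩ (mem_support_cycleOf.mpr hC))⟩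
    tfae_finish
  · have hφx := h1.mp h
    have hxy' := hxy.mp hφx
    have hsum := herbrandIndex_surface_eq_add hd hx hφ hψ hy hφx hK hxy'
      fun q _ _ hqm hIq hxq hψq hyq => lengthInt_quotient_germ_eq_add hf hf0 hqm hIq hxq hψq hyq
    -- all three numbers are indices on the polar surface
    rw [milnorNumber_restrictHyperplane hf hK]
    refine (numberHom_interHom_interHom hφ hx hφx).trans (hsum.trans (congrArg _ ?_))
    exact (numberHom_interHom_interHom hx hy hxy').symm
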